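/- **Conventions.** A group pair $(G,\mathbf S)$ is a group $G$ with a family $\mathbf S=\{S_i\}_{i\in I}$ of not necessarily distinct subgroups. Let $k$ be a commutative ring (for instance $k=\mathbf Z$). For a $kG$-module $A$, $H_n(G,\mathbf S;A)$ is the homology of the mapping cone of $C_*(G;k[\bigsqcup_i G/S_i]\otimes A)\to C_*(G;A)$. So there is a long exact sequence $\cdots\to\bigoplus_i H_n(S_i;A)\to H_n(G;A)\to H_n(G,\mathbf S;A)\to\bigoplus_i H_{n-1}(S_i;A)\to\cdots$, and $H_n(G,\emptyset;A)=H_n(G;A)$. Coefficients in a $kG$-module are restricted to groups mapping to $G$. All relative groups depend only on the conjugacy classes of the subgroups. A subgroup $U\ast_{\partial U}W$ of $G$, where $\partial U=\{P_j\}_{j\in J}$ is a family of subgroups of $U$ and $W=\{W_c\}_{c\in K}$ is a family of groups, is a subgroup of $G$ that is the fundamental group of a connected graph of groups with one vertex carrying $U$, further vertices carrying the groups $W_c$, and edges $j\in J$ with edge groups $P_j$, the $j$-th edge joining the vertex of $U$ to the vertex of some $W_{\kappa(j)}$. (If $J$ and $K$ have one element, this is an amalgamated free product of two groups. Both may be empty.)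 The groups $W_c$ are regarded as subgroups of $U\ast_{\partial U}W$ by means of a maximal tree. **Theorem 2.** Let $(G_i,\mathbf S_i)$, $i=1,2$, be group pairs, and let $U_i\ast_{\partial U_i}W_i$ be a subgroup of $G_i$ such that $(U_1,\partial U_1)\cong(U_2,\partial U_2)$. That is, there are an isomorphism $U_1\cong U_2$ and a bijection of the index sets under which the members of the two families correspond. Put $G=G_1\ast_{U_1=U_2}G_2$, and let $(U,\partial U)$ be the common image of the $(U_i,\partial U_i)$ in $G$. Let $W_1\ast_{\partial U_1=\partial U_2}W_2$ be the family of the images in $G$ of the fundamental groups of the components of the graph of groups whose vertices carry the members of $W_1$ and of $W_2$, and which has one edge for every member of $\partial U$, carrying it and joining the two vertices to which it is attached. Put $$\partial G=\mathbf S_1\cup\mathbf S_2\cup(W_1\ast_{\partial U_1=\partial U_2}W_2),\qquad \partial G_i=\mathbf S_i\cup(U_i\ast_{\partial U_i}W_i)\quad(i=1,2).$$ Then for every $kG$-module $A$ (coefficients in $A$ throughout) the sequence $$\cdots\to H_n(U,\partial U)\xrightarrow{\ \alpha\ }H_n(G,\partial G)\xrightarrow{(\beta_1,\beta_2)}H_n(G_1,\partial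 G_1)\oplus H_n(G_2,\partial G_2)\xrightarrow{\gamma_1+\gamma_2}H_{n-1}(U,\partial U)\to\cdots\to H_0(G_1,\partial G_1)\oplus H_0(G_2,\partial G_2)\to0$$ is exact. Here $\alpha$ is induced by inclusion. With $i'$ the index other than $i$, let $\partial G\cup G_{i'}$ denote the family of $\mathbf S_i$ together with the subgroup of $G$ generated by $U_i\ast_{\partial U_i}W_i$ and $G_{i'}$. Then $\beta_i$ is the composite $H_n(G,\partial G)\to H_n(G,\partial G\cup G_{i'})\cong H_n(G_i,\partial G_i)$ of the map induced by inclusion and the inverse of the map induced by inclusion $(G_i,\partial G_i)\to(G,\partial G\cup G_{i'})$, which is an (excision) isomorphism. The map $\gamma_i$ is the composite $H_n(G_i,\partial G_i)\to H_{n-1}(\partial G_i,\mathbf S_i\cup W_i)\cong H_{n-1}(U,\partial U)$ of the boundary map of the triple $(G_i,\partial G_i,\mathbf S_i\cup W_i)$ and the inverse of the map induced by inclusion, which is also an (excision) isomorphism. The relative groups $H_*(\partial G_i,\mathbf S_i\cup W_i;A)$ are the homology of the mapping cone of $C_*(G_i;k[Z]\otimes A)\to C_*(G_i;k[Y]\otimes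 A)$, where $Z$ and $Y$ are the disjoint unions of the coset spaces of $G_i$ by the members of $\mathbf S_i\cup W_i$ and of $\partial G_i$. -/

import Mathlib

open CategoryTheory

universe u

noncomputable section

/-! ## Relative homology of groups -/

section Coefficients

variable {k : Type u} [CommRing k] {G H H' : Type u} [Group G] [Group H] [Group H']

/-- For a group homomorphism `f : H →* G`, an `H`-set `Y` and a `G`-module `A`, this is the
`H`-module `k[Y] ⊗ A` with the diagonal action, where `H` acts on `A` through `f`. It is realised
as the module of finitely supported functions `Y → A`; the element `y ⊗ a` is `single y a`, and
`h • (y ⊗ a) = (h • y) ⊗ (f h • a)`. -/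
def permRep (f : H →* G) (Y : Type u) [MulAction H Y] (A : Rep.{u} k G) :
    Representation k H (Y →₀ A.V) where
  toFun h := Finsupp.lmapDomain A.V k (fun y : Y => h • y) ∘ₗ
    Finsupp.mapRange.linearMap (A.ρ (f h))
  map_one' := by
    ext; simp
  map_mul' g h := by
    ext; simp [mul_smul]

lemma permRep_single (f : H →* G) (Y : Type u) [MulAction H Y] (A : Rep.{u} k G) (h : H) (y : Y)
    (a : A.V) :
    permRep f Y A h (Finsupp.single y a) = Finsupp.single (h • y) (A.ρ (f h) a) := by
  simp [permRep]

/-- The chain complex `C_*(H; k[Y] ⊗ A)` of inhomogeneous chains. When `Y` is the disjoint union of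
the coset spaces `H / S_i`, its homology is the direct sum of the `H_*(S_i; A)` (Shapiro). -/
abbrev permChains (f : H →* G) (Y : Type u) [MulAction H Y] (A : Rep.{u} k G) :
    ChainComplex (ModuleCat k) ℕ :=
  groupHomology.inhomogeneousChains (Rep.of (permRep f Y A))

/-- A homomorphism `h : H →* H'` over `G` and an `h`-equivariant map `Y → Y'` induce a chain map
`C_*(H; k[Y] ⊗ A) → C_*(H'; k[Y'] ⊗ A)`. -/
def permChainsMap (f : H →* G) (f' : H' →* G) (h : H →* H') (hf : f'.comp h = f)
    {Y Y' : Type u} [MulAction H Y] [MulAction H' Y'] (q : Y → Y')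
    (hq : ∀ (x : H) (y : Y), q (x • y) = h x • q y) (A : Rep.{u} k G) :
    permChains f Y A ⟶ permChains f' Y' A :=
  groupHomology.chainsMap (A := Rep.of (permRep f Y A)) (B := Rep.of (permRep f' Y' A)) h
    (Rep.ofHom ⟨Finsupp.lmapDomain A.V k q, by
      intro x
      subst hf
      refine Finsupp.lhom_ext fun y a => ?_
      simp [permRep_single, hq]⟩)

end Coefficients

/-- An equivariant map `proj : Y → X` of `H`-sets, regarded as a pair `(X, Y)`. -/
structure ActionPair (H : Type u) [Group H] where
  X : Type u
  Y : Type u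
  [actX : MulAction H X]
  [actY : MulAction H Y]
  proj : Y → X
  proj_smul : ∀ (h : H) (y : Y), proj (h • y) = h • proj y

attribute [instance] ActionPair.actX ActionPair.actY

/-- Morphisms of pairs of sets with group action over a group homomorphism `h`. -/
structure ActionPair.Hom {H H' : Type u} [Group H] [Group H'] (h : H →* H')
    (P : ActionPair H) (P' : ActionPair H') where
  mapX : P.X → P'.X
  mapY : P.Y → P'.Y
  mapX_smul : ∀ (a : H) (x : P.X), mapX (a • x) = h a • mapX x
  mapY_smul : ∀ (a : H) (y : P.Y), mapY (a • y) = h a • mapY y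
  comm : ∀ y : P.Y, P'.proj (mapY y) = mapX (P.proj y)

lemma coneBoundary_aux {k : Type u} [CommRing k] {F E : ChainComplex (ModuleCat.{u} k) ℕ}
    (φ : F ⟶ E) (n : ℕ) :
    ((HomologicalComplex.homotopyCofiber φ).iCycles (n + 1) ≫
      HomologicalComplex.homotopyCofiber.fstX φ (n + 1) n rfl) ≫
        F.d n ((ComplexShape.down ℕ).next n) = 0 := by
  rcases n with _ | m
  · rw [F.shape _ _ (by simp), Limits.comp_zero]
  · have h := HomologicalComplex.homotopyCofiber.d_fstX φ (m + 2) (m + 1) m rfl rfl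
    have h2 := (HomologicalComplex.homotopyCofiber φ).iCycles_d (m + 2) (m + 1)
    rw [ChainComplex.next_nat_succ, Category.assoc, ← neg_eq_zero, ← Preadditive.comp_neg, ← h]
    erw [reassoc_of% h2]
    simp

lemma coneBoundary_aux' {k : Type u} [CommRing k] {F E : ChainComplex (ModuleCat.{u} k) ℕ}
    (φ : F ⟶ E) (n : ℕ) :
    (HomologicalComplex.homotopyCofiber φ).toCycles (n + 2) (n + 1) ≫
      F.liftCycles ((HomologicalComplex.homotopyCofiber φ).iCycles (n + 1) ≫
        HomologicalComplex.homotopyCofiber.fstX φ (n + 1) n rfl) _ rfl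
          (coneBoundary_aux φ n) ≫ F.homologyπ n = 0 := by
  have h := HomologicalComplex.homotopyCofiber.d_fstX φ (n + 2) (n + 1) n rfl rfl
  rw [← Category.assoc, HomologicalComplex.comp_liftCycles]
  refine F.liftCycles_homologyπ_eq_zero_of_boundary _ _ rfl
    (i' := n + 1) (-HomologicalComplex.homotopyCofiber.fstX φ (n + 2) (n + 1) rfl) ?_
  rw [HomologicalComplex.toCycles_i_assoc, Preadditive.neg_comp, ← h]
  rfl

/-- The connecting map `H_{n+1}(cone φ) ⟶ H_n(F)` of the mapping cone of a chain map
`φ : F ⟶ E`, given on cycles by the projection `cone_{n+1} = F_n ⊕ E_{n+1} → F_n`. -/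
def coneBoundary {k : Type u} [CommRing k] {F E : ChainComplex (ModuleCat.{u} k) ℕ} (φ : F ⟶ E)
    (n : ℕ) : (HomologicalComplex.homotopyCofiber φ).homology (n + 1) ⟶ F.homology n :=
  ((HomologicalComplex.homotopyCofiber φ).homologyIsCokernel (n + 2) (n + 1) (by simp)).desc
    (Limits.CokernelCofork.ofπ
      (F.liftCycles ((HomologicalComplex.homotopyCofiber φ).iCycles (n + 1) ≫
        HomologicalComplex.homotopyCofiber.fstX φ (n + 1) n rfl) _ rfl
          (coneBoundary_aux φ n) ≫ F.homologyπ n)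
      (coneBoundary_aux' φ n))

section Relative

variable {k : Type u} [CommRing k] {G H H' : Type u} [Group G] [Group H] [Group H']

/-- The chain map `C_*(H; k[Y] ⊗ A) → C_*(H; k[X] ⊗ A)` of a pair. -/
def pairChainsMap (f : H →* G) (P : ActionPair H) (A : Rep.{u} k G) :
    permChains f P.Y A ⟶ permChains f P.X A :=
  permChainsMap f f (MonoidHom.id H) rfl P.proj P.proj_smul A

/-- The relative chain complex of a pair `Y → X` of `H`-sets: the mapping cone of
`C_*(H; k[Y] ⊗ A) → C_*(H; k[X] ⊗ A)`. -/
def relChains (f : H →* G) (P : ActionPair H) (A : Rep.{u} k G) :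
    ChainComplex (ModuleCat k) ℕ :=
  HomologicalComplex.homotopyCofiber (pairChainsMap f P A)

/-- The relative homology `H_n(H; X, Y; A)` of a pair of `H`-sets, the `G`-module `A` being
restricted along `f : H →* G`. -/
def relHomology (f : H →* G) (P : ActionPair H) (A : Rep.{u} k G) (n : ℕ) : ModuleCat.{u} k :=
  (relChains f P A).homology n

lemma relChainsMap_comm (f : H →* G) (f' : H' →* G) {h : H →* H'} (hf : f'.comp h = f)
    {P : ActionPair H} {P' : ActionPair H'} (q : ActionPair.Hom h P P') (A : Rep.{u} k G) :
    permChainsMap f f' h hf q.mapY q.mapY_smul A ≫ pairChainsMap f' P' A =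
      pairChainsMap f P A ≫ permChainsMap f f' h hf q.mapX q.mapX_smul A := by
  unfold pairChainsMap permChainsMap
  rw [← groupHomology.chainsMap_comp, ← groupHomology.chainsMap_comp]
  refine groupHomology.chainsMap_congr rfl ?_
  refine Finsupp.lhom_ext fun y a => ?_
  simp [q.comm]

/-- The chain map induced by a morphism of pairs. -/
def relChainsMap (f : H →* G) (f' : H' →* G) {h : H →* H'} (hf : f'.comp h = f)
    {P : ActionPair H} {P' : ActionPair H'} (q : ActionPair.Hom h P P') (A : Rep.{u} k G) :
    relChains f P A ⟶ relChains f' P' A :=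
  HomologicalComplex.homotopyCofiber.mapArrowHom _ _ (fun j => ⟨j + 1, rfl⟩)
    (Arrow.homMk (permChainsMap f f' h hf q.mapY q.mapY_smul A)
      (permChainsMap f f' h hf q.mapX q.mapX_smul A) (relChainsMap_comm f f' hf q A))

/-- The map induced in relative homology by a morphism of pairs. -/
def relHomologyMap (f : H →* G) (f' : H' →* G) {h : H →* H'} (hf : f'.comp h = f)
    {P : ActionPair H} {P' : ActionPair H'} (q : ActionPair.Hom h P P') (A : Rep.{u} k G) (n : ℕ) :
    relHomology f P A n ⟶ relHomology f' P' A n :=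
  HomologicalComplex.homologyMap (relChainsMap f f' hf q A) n

/-- For equivariant maps `Z → Y → X` of `H`-sets, given as the pairs `P = (X, Y)` and `Q = (Y', Z)`
together with an equivariant identification `Y → Y'` (the identity in the application), the
boundary map of the triple, `H_{n+1}(H; X, Y; A) → H_n(H; Y; A) → H_n(H; Y', Z; A)`. -/
def tripleBoundary (f : H →* G) (P Q : ActionPair H) (q : P.Y → Q.X)
    (hq : ∀ (h : H) (y : P.Y), q (h • y) = h • q y) (A : Rep.{u} k G) (n : ℕ) :
    relHomology f P A (n + 1) ⟶ relHomology f Q A n :=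
  coneBoundary (pairChainsMap f P A) n ≫ HomologicalComplex.homologyMap
    (permChainsMap f f (MonoidHom.id H) rfl q hq A ≫
      HomologicalComplex.homotopyCofiber.inr (pairChainsMap f Q A)) n

end Relative

/-! ## Group pairs -/

section Families

variable {G G' : Type u} [Group G] [Group G']

/-- The `G`-set `⨆ G / S_i` of a family of subgroups. -/
abbrev CosetSet {I : Type u} (S : I → Subgroup G) : Type u := Σ i : I, G ⧸ S i

/-- A homomorphism `h : G →* G'` respects the families `S` and `S'` up to conjugacy: every
`h(S_i)` lies in the conjugate `c_i S'_{idx i} c_i⁻¹`, for chosen elements `c_i`. -/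
structure FamilyHom (h : G →* G') {I I' : Type u} (S : I → Subgroup G)
    (S' : I' → Subgroup G') where
  idx : I → I'
  c : I → G'
  mem : ∀ (i : I) (s : G), s ∈ S i → (c i)⁻¹ * h s * c i ∈ S' (idx i)

/-- The equivariant map `⨆ G / S_i → ⨆ G' / S'_{i'}`, `x S_i ↦ h(x) c_i S'_{idx i}`. -/
def FamilyHom.map {h : G →* G'} {I I' : Type u} {S : I → Subgroup G} {S' : I' → Subgroup G'}
    (q : FamilyHom h S S') (y : CosetSet S) : CosetSet S' :=
  ⟨q.idx y.1, Quotient.liftOn' y.2 (fun x => ((h x * q.c y.1 : G') : G' ⧸ S' (q.idx y.1))) (by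
    intro a b hab
    rw [QuotientGroup.leftRel_apply] at hab
    refine QuotientGroup.eq.2 ?_
    have := q.mem y.1 _ hab
    simpa [mul_assoc] using this)⟩

@[simp] lemma FamilyHom.map_mk {h : G →* G'} {I I' : Type u} {S : I → Subgroup G}
    {S' : I' → Subgroup G'} (q : FamilyHom h S S') (i : I) (x : G) :
    q.map ⟨i, (x : G ⧸ S i)⟩ = ⟨q.idx i, ((h x * q.c i : G') : G' ⧸ S' (q.idx i))⟩ := rfl

lemma FamilyHom.map_smul {h : G →* G'} {I I' : Type u} {S : I → Subgroup G}
    {S' : I' → Subgroup G'} (q : FamilyHom h S S') (g : G) (y : CosetSet S) :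
    q.map (g • y) = h g • q.map y := by
  obtain ⟨i, x⟩ := y
  induction x using QuotientGroup.induction_on with
  | H x =>
    change q.map ⟨i, ((g * x : G) : G ⧸ S i)⟩ = _
    rw [FamilyHom.map_mk, FamilyHom.map_mk, Sigma.smul_mk, map_mul, mul_assoc]
    rfl

/-- The pair of `G`-sets `(pt, ⨆ G / S_i)` of a group pair `(G, S)`. -/
def groupPair {I : Type u} (S : I → Subgroup G) : ActionPair G where
  X := PUnit.{u + 1}
  Y := CosetSet S
  actX := { smul := fun _ x => x, one_smul := fun _ => rfl, mul_smul := fun _ _ _ => rfl }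
  proj _ := PUnit.unit
  proj_smul _ _ := rfl

/-- The pair of `G`-sets `(⨆ G / S_i, ⨆ G / T_j)` of two families of subgroups of `G` such that
every `T_j` is contained, up to conjugacy, in a member of `S`. -/
def familyPair {I J : Type u} {S : I → Subgroup G} {T : J → Subgroup G}
    (q : FamilyHom (MonoidHom.id G) T S) : ActionPair G where
  X := CosetSet S
  Y := CosetSet T
  proj := q.map
  proj_smul := q.map_smul

/-- The morphism of group pairs given by a homomorphism that respects the families. -/
def FamilyHom.toPairHom {h : G →* G'} {I I' : Type u} {S : I → Subgroup G}
    {S' : I' → Subgroup G'} (q : FamilyHom h S S') :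
    ActionPair.Hom h (groupPair S) (groupPair S') where
  mapX := id
  mapY := q.map
  mapX_smul _ _ := rfl
  mapY_smul := q.map_smul
  comm _ := rfl

/-- The relative homology `H_n(H, S; A)` of a group pair `(H, S)` with coefficients in a
`G`-module `A` restricted along `f : H →* G`: the homology of the mapping cone of
`C_*(H; k[⨆ H / S_i] ⊗ A) → C_*(H; A)`. If the family is not empty, this is
`Tor_{n-1}^{k[H]}(Δ, A)` with `Δ` the kernel of the augmentation `⨁ k[H / S_i] → k`; if it is
empty, this is `H_n(H; A)`. -/
abbrev pairHomology {k : Type u} [CommRing k] {H : Type u} [Group H] (f : H →* G) {I : Type u}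
    (S : I → Subgroup H) (A : Rep.{u} k G) (n : ℕ) : ModuleCat.{u} k :=
  relHomology f (groupPair S) A n

end Families

/-! ## Graphs of groups -/

/-- A graph of groups: an oriented graph with vertex groups, edge groups and an injection of every
edge group into the groups of the two ends of the edge. The graph need not be connected. -/
structure GraphOfGroups where
  V : Type u
  E : Type u
  src : E → V
  tgt : E → V
  vGrp : V → Type u
  eGrp : E → Type u
  [vGroup : ∀ v, Group (vGrp v)]
  [eGroup : ∀ e, Group (eGrp e)]
  srcHom : ∀ e, eGrp e →* vGrp (src e)
  tgtHom : ∀ e, eGrp e →* vGrp (tgt e)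
  srcHom_injective : ∀ e, Function.Injective (srcHom e)
  tgtHom_injective : ∀ e, Function.Injective (tgtHom e)

namespace GraphOfGroups

attribute [instance] vGroup eGroup

variable (Γ : GraphOfGroups.{u})

/-- The free product of all vertex groups and of the free group on the edges. -/
abbrev PreUniversal : Type u := Monoid.Coprod (Monoid.CoprodI Γ.vGrp) (FreeGroup Γ.E)

/-- The relators `e · tgt(b) · e⁻¹ · src(b)⁻¹`, for an edge `e` and `b` in the edge group. -/
def relators : Set Γ.PreUniversal :=
  {r | ∃ (e : Γ.E) (b : Γ.eGrp e),
    r = Monoid.Coprod.inr (FreeGroup.of e) *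
      Monoid.Coprod.inl (Monoid.CoprodI.of (Γ.tgtHom e b)) *
      (Monoid.Coprod.inr (FreeGroup.of e))⁻¹ *
      (Monoid.Coprod.inl (Monoid.CoprodI.of (Γ.srcHom e b)))⁻¹}

/-- The universal group `F(Γ)` of a graph of groups, generated by the vertex groups and the edges
subject to `e · tgt(b) · e⁻¹ = src(b)`. -/
abbrev Universal : Type u := Γ.PreUniversal ⧸ Subgroup.normalClosure Γ.relators

def vert (v : Γ.V) : Γ.vGrp v →* Γ.Universal :=
  (QuotientGroup.mk' _).comp (Monoid.Coprod.inl.comp Monoid.CoprodI.of)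

def edge (e : Γ.E) : Γ.Universal :=
  QuotientGroup.mk' _ (Monoid.Coprod.inr (FreeGroup.of e))

/-- `Γ.IsPath u v x`: the element `x` of `F(Γ)` is represented by a path
`a₀ e₁^{±1} a₁ ⋯ e_m^{±1} a_m` of the graph of groups from the vertex `u` to the vertex `v`. -/
inductive IsPath : Γ.V → Γ.V → Γ.Universal → Prop
  | vert (v : Γ.V) (a : Γ.vGrp v) : IsPath v v (Γ.vert v a)
  | edge (e : Γ.E) : IsPath (Γ.src e) (Γ.tgt e) (Γ.edge e)
  | edgeInv (e : Γ.E) : IsPath (Γ.tgt e) (Γ.src e) (Γ.edge e)⁻¹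
  | trans {u v w : Γ.V} {x y : Γ.Universal} :
      IsPath u v x → IsPath v w y → IsPath u w (x * y)

variable {Γ} in
lemma IsPath.refl (v : Γ.V) : Γ.IsPath v v 1 := by
  simpa using IsPath.vert v (1 : Γ.vGrp v)

variable {Γ} in
lemma IsPath.inv {u v : Γ.V} {x : Γ.Universal} (h : Γ.IsPath u v x) : Γ.IsPath v u x⁻¹ := by
  induction h with
  | vert v a => simpa using IsPath.vert v a⁻¹
  | edge e => exact IsPath.edgeInv e
  | edgeInv e => simpa using IsPath.edge e
  | trans _ _ h₁ h₂ => simpa using h₂.trans h₁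

/-- The fundamental group `π₁(Γ, v)`: the subgroup of `F(Γ)` of the elements represented by closed
paths at the vertex `v`. -/
def fundamentalGroup (v : Γ.V) : Subgroup Γ.Universal where
  carrier := {x | Γ.IsPath v v x}
  one_mem' := IsPath.refl v
  mul_mem' := IsPath.trans
  inv_mem' := IsPath.inv

/-- Two vertices lie in the same connected component. -/
def componentSetoid : Setoid Γ.V where
  r u v := ∃ x, Γ.IsPath u v x
  iseqv := ⟨fun v => ⟨1, IsPath.refl v⟩, fun ⟨x, h⟩ => ⟨x⁻¹, h.inv⟩,
    fun ⟨x, h⟩ ⟨y, h'⟩ => ⟨x * y, h.trans h'⟩⟩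

/-- The set of connected components of the graph. -/
abbrev Component : Type u := Quotient Γ.componentSetoid

/-- The homomorphism `F(Γ) → G` given by homomorphisms on the vertex groups and by elements for the
edges. -/
def lift {G : Type u} [Group G] (α : ∀ v, Γ.vGrp v →* G) (ε : Γ.E → G)
    (h : ∀ (e : Γ.E) (b : Γ.eGrp e),
      ε e * α _ (Γ.tgtHom e b) * (ε e)⁻¹ = α _ (Γ.srcHom e b)) : Γ.Universal →* G :=
  QuotientGroup.lift _ (Monoid.Coprod.lift (Monoid.CoprodI.lift α) (FreeGroup.lift ε)) (by
    have : Subgroup.normalClosure Γ.relators ≤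
        (Monoid.Coprod.lift (Monoid.CoprodI.lift α) (FreeGroup.lift ε)).ker := by
      refine Subgroup.normalClosure_le_normal ?_
      rintro r ⟨e, b, rfl⟩
      simp [MonoidHom.mem_ker, h]
    intro x hx
    exact this hx)

@[simp] lemma lift_vert {G : Type u} [Group G] (α : ∀ v, Γ.vGrp v →* G) (ε : Γ.E → G) (h)
    (v : Γ.V) (a : Γ.vGrp v) : Γ.lift α ε h (Γ.vert v a) = α v a := by
  simp [lift, vert]

@[simp] lemma lift_edge {G : Type u} [Group G] (α : ∀ v, Γ.vGrp v →* G) (ε : Γ.E → G) (h)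
    (e : Γ.E) : Γ.lift α ε h (Γ.edge e) = ε e := by
  simp [lift, edge]

end GraphOfGroups

/-- A graph of subgroups of `G`: every vertex and every edge carries a subgroup of `G`, and the
subgroup of an edge `e` is conjugated into the subgroups of its ends by `srcElt e` and
`tgtElt e`. -/
structure SubgroupGraph (G : Type u) [Group G] where
  V : Type u
  E : Type u
  src : E → V
  tgt : E → V
  vSub : V → Subgroup G
  eSub : E → Subgroup G
  srcElt : E → G
  tgtElt : E → G
  src_mem : ∀ e b, b ∈ eSub e → (srcElt e)⁻¹ * b * srcElt e ∈ vSub (src e)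
  tgt_mem : ∀ e b, b ∈ eSub e → (tgtElt e)⁻¹ * b * tgtElt e ∈ vSub (tgt e)

/-- The homomorphism `A → B`, `a ↦ c⁻¹ a c`, for subgroups with `c⁻¹ A c ≤ B`. -/
def conjHom {G : Type u} [Group G] (A B : Subgroup G) (c : G)
    (h : ∀ a, a ∈ A → c⁻¹ * a * c ∈ B) : A →* B where
  toFun a := ⟨c⁻¹ * a * c, h a a.2⟩
  map_one' := by ext; simp
  map_mul' a b := by ext; simp [mul_assoc]

lemma conjHom_injective {G : Type u} [Group G] (A B : Subgroup G) (c : G)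
    (h : ∀ a, a ∈ A → c⁻¹ * a * c ∈ B) : Function.Injective (conjHom A B c h) := by
  intro a b hab
  have := congrArg Subtype.val hab
  simpa [conjHom] using this

namespace SubgroupGraph

variable {G : Type u} [Group G] (Δ : SubgroupGraph G)

/-- The underlying abstract graph of groups. -/
abbrev toGraph : GraphOfGroups.{u} where
  V := Δ.V
  E := Δ.E
  src := Δ.src
  tgt := Δ.tgt
  vGrp v := Δ.vSub v
  eGrp e := Δ.eSub e
  srcHom e := conjHom _ _ (Δ.srcElt e) (Δ.src_mem e)
  tgtHom e := conjHom _ _ (Δ.tgtElt e) (Δ.tgt_mem e)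
  srcHom_injective _ := conjHom_injective _ _ _ _
  tgtHom_injective _ := conjHom_injective _ _ _ _

/-- The canonical homomorphism `F(Γ) → G`, which is the inclusion on the vertex groups and sends
the edge `e` to `(srcElt e)⁻¹ * tgtElt e`. -/
def toGroup : Δ.toGraph.Universal →* G :=
  Δ.toGraph.lift (fun v => (Δ.vSub v).subtype) (fun e => (Δ.srcElt e)⁻¹ * Δ.tgtElt e) (by
    intro e b
    change ((Δ.srcElt e)⁻¹ * Δ.tgtElt e) * ((Δ.tgtElt e)⁻¹ * b.1 * Δ.tgtElt e) *
      ((Δ.srcElt e)⁻¹ * Δ.tgtElt e)⁻¹ = (Δ.srcElt e)⁻¹ * b.1 * Δ.srcElt e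
    group)

/-- The image in `G` of the fundamental group with base vertex `v`. -/
def fundamentalSubgroup (v : Δ.V) : Subgroup G :=
  (Δ.toGraph.fundamentalGroup v).map Δ.toGroup

lemma toGroup_vert (v : Δ.V) (a : Δ.vSub v) : Δ.toGroup (Δ.toGraph.vert v a) = a :=
  Δ.toGraph.lift_vert _ _ _ v a

lemma toGroup_edge (e : Δ.E) : Δ.toGroup (Δ.toGraph.edge e) = (Δ.srcElt e)⁻¹ * Δ.tgtElt e :=
  Δ.toGraph.lift_edge _ _ _ e

lemma toGroup_mem (Q : Subgroup G) (hv : ∀ v, Δ.vSub v ≤ Q)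
    (he : ∀ e, (Δ.srcElt e)⁻¹ * Δ.tgtElt e ∈ Q) {u v : Δ.toGraph.V} {x : Δ.toGraph.Universal}
    (h : Δ.toGraph.IsPath u v x) : Δ.toGroup x ∈ Q := by
  induction h with
  | vert v a =>
    have := Δ.toGroup_vert v a
    rw [this]
    exact hv v a.2
  | edge e =>
    have := Δ.toGroup_edge e
    rw [this]
    exact he e
  | edgeInv e =>
    have := Δ.toGroup_edge e
    rw [map_inv, this]
    exact inv_mem (he e)
  | trans _ _ h₁ h₂ => rw [map_mul]; exact mul_mem h₁ h₂

end SubgroupGraph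

/-! ## Subgroups of the form `U *_{∂U} W` -/

/-- A graph of subgroups of `G` with a distinguished vertex carrying `U`, further vertices
`k : K` carrying the members of the family `W`, and edges `j : J`, the edge `j` joining the
distinguished vertex to the vertex `κ j` and carrying the member `P j` of the family `∂U` of
subgroups of `U`; `t j` conjugates `P j` into `W (κ j)`. A maximal tree consists of one edge
`root k` for every `k`, with `t (root k) = 1`; so the graph is connected. -/
structure StarOfSubgroups (G : Type u) [Group G] (J : Type u) where
  U : Subgroup G
  P : J → Subgroup G
  P_le : ∀ j, P j ≤ U
  K : Type u
  W : K → Subgroup G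
  κ : J → K
  t : J → G
  conj_mem : ∀ j p, p ∈ P j → (t j)⁻¹ * p * t j ∈ W (κ j)
  root : K → J
  κ_root : ∀ k, κ (root k) = k
  t_root : ∀ k, t (root k) = 1

/-- The graph of subgroups of a star. The distinguished vertex is `none`. -/
abbrev StarOfSubgroups.graph {G : Type u} [Group G] {J : Type u} (D : StarOfSubgroups G J) :
    SubgroupGraph G where
  V := Option D.K
  E := J
  src _ := none
  tgt j := some (D.κ j)
  vSub v := v.elim D.U D.W
  eSub := D.P
  srcElt _ := 1
  tgtElt := D.t
  src_mem j b hb := by simpa using D.P_le j hb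
  tgt_mem j b hb := D.conj_mem j b hb

/-- The data of a subgroup `U *_{∂U} W` of `G`, with `∂U` and `W` families of groups: a star of
subgroups whose fundamental group maps injectively to `G`. If `J` and `K` have one element,
this says that the subgroup of `G` generated by `U` and `W` is the free product of `U` and `W`
amalgamated along the common subgroup `∂U`. -/
structure AmalgamSubgroup (G : Type u) [Group G] (J : Type u) extends StarOfSubgroups G J where
  faithful : Set.InjOn toStarOfSubgroups.graph.toGroup
    (toStarOfSubgroups.graph.toGraph.fundamentalGroup (none : Option K))

namespace AmalgamSubgroup

variable {G : Type u} [Group G] {J : Type u} (D : AmalgamSubgroup G J)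

/-- The subgroup `U *_{∂U} W` of `G`. -/
def total : Subgroup G := D.graph.fundamentalSubgroup (none : Option D.K)

lemma t_mem (j : J) : D.t j ∈ D.total := by
  refine ⟨D.graph.toGraph.edge j * (D.graph.toGraph.edge (D.root (D.κ j)))⁻¹,
    (GraphOfGroups.IsPath.edge (Γ := D.graph.toGraph) j).trans ?_, ?_⟩
  · have := (GraphOfGroups.IsPath.edgeInv (Γ := D.graph.toGraph) (D.root (D.κ j)))
    have h : D.graph.toGraph.tgt (D.root (D.κ j)) = D.graph.toGraph.tgt j :=
      congrArg some (D.κ_root (D.κ j))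
    rw [h] at this
    exact this
  · have e1 := D.graph.toGroup_edge j
    have e2 := D.graph.toGroup_edge (D.root (D.κ j))
    rw [map_mul, map_inv]
    erw [e1, e2]
    simp [D.t_root]

lemma U_le : D.U ≤ D.total := fun u hu =>
  ⟨D.graph.toGraph.vert (none : Option D.K) ⟨u, hu⟩, GraphOfGroups.IsPath.vert _ _,
    D.graph.toGroup_vert (none : Option D.K) ⟨u, hu⟩⟩

lemma W_le (k : D.K) : D.W k ≤ D.total := by
  intro w hw
  have h : D.graph.toGraph.tgt (D.root k) = some k := congrArg some (D.κ_root k)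
  have h1 := GraphOfGroups.IsPath.edge (Γ := D.graph.toGraph) (D.root k)
  have h2 := GraphOfGroups.IsPath.edgeInv (Γ := D.graph.toGraph) (D.root k)
  rw [h] at h1 h2
  refine ⟨D.graph.toGraph.edge (D.root k) * D.graph.toGraph.vert (some k : Option D.K) ⟨w, hw⟩ *
    (D.graph.toGraph.edge (D.root k))⁻¹, (h1.trans (GraphOfGroups.IsPath.vert _ _)).trans h2, ?_⟩
  rw [map_mul, map_mul, map_inv]
  have e1 := D.graph.toGroup_vert (some k : Option D.K) ⟨w, hw⟩
  have e2 := D.graph.toGroup_edge (D.root k)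
  erw [e1, e2]
  simp [D.t_root]

end AmalgamSubgroup

/-! ## Gluing two group pairs -/

/-- Two group pairs `(G_i, S_i)`, indexed by `i : Bool`, with subgroups `U_i *_{∂U_i} W_i` of `G_i`,
and a pair `(U, ∂U)` isomorphic to `(U_i, ∂U_i)` for both `i`. -/
structure GluingData where
  J : Type u
  U : Type u
  [groupU : Group U]
  bdU : J → Subgroup U
  G : Bool → Type u
  [groupG : ∀ i, Group (G i)]
  I : Bool → Type u
  S : ∀ i, I i → Subgroup (G i)
  D : ∀ i, AmalgamSubgroup (G i) J
  φ : ∀ i, U ≃* (D i).U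
  φ_bdU : ∀ i j u, (φ i u : G i) ∈ (D i).P j ↔ u ∈ bdU j

namespace GluingData

attribute [instance] groupU groupG

variable (X : GluingData.{u})

/-- The embedding of `U` in `G_i` with image `U_i`. -/
def emb (i : Bool) : X.U →* X.G i := (X.D i).U.subtype.comp (X.φ i).toMonoidHom

/-- The amalgamated free product `G = G_1 *_{U_1 = U_2} G_2`. -/
abbrev Total : Type u := Monoid.PushoutI X.emb

/-- The homomorphism `G_i → G`. -/
abbrev incl (i : Bool) : X.G i →* X.Total := Monoid.PushoutI.of i

/-- The homomorphism `U → G`. -/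
abbrev inclU : X.U →* X.Total := Monoid.PushoutI.base X.emb

lemma incl_emb (i : Bool) (u : X.U) : X.incl i (X.emb i u) = X.inclU u :=
  Monoid.PushoutI.of_apply_eq_base _ i u

/-- The graph of subgroups of `G` whose vertices carry the members of `W_1` and of `W_2`, with one
edge for every `j`, joining the vertex of `W_1` to the vertex of `W_2` to which the member
`∂U_j` is attached and carrying this member. It need not be connected. -/
abbrev wallGraph : SubgroupGraph X.Total where
  V := Σ i : Bool, (X.D i).K
  E := X.J
  src j := ⟨false, (X.D false).κ j⟩
  tgt j := ⟨true, (X.D true).κ j⟩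
  vSub v := ((X.D v.1).W v.2).map (X.incl v.1)
  eSub j := (X.bdU j).map X.inclU
  srcElt j := X.incl false ((X.D false).t j)
  tgtElt j := X.incl true ((X.D true).t j)
  src_mem := by
    rintro j _ ⟨u, hu, rfl⟩
    refine ⟨_, (X.D false).conj_mem j _ ((X.φ_bdU false j u).2 hu), ?_⟩
    simp [← X.incl_emb false u, emb]
  tgt_mem := by
    rintro j _ ⟨u, hu, rfl⟩
    refine ⟨_, (X.D true).conj_mem j _ ((X.φ_bdU true j u).2 hu), ?_⟩
    simp [← X.incl_emb true u, emb]

/-- A base vertex in every component of the graph. -/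
def baseVertex (c : X.wallGraph.toGraph.Component) : X.wallGraph.V := Quotient.out c

/-- The family `W_1 *_{∂U_1 = ∂U_2} W_2` of subgroups of `G`: the fundamental groups of the
components of the graph, each embedded with respect to a base vertex. -/
def wall (c : X.wallGraph.toGraph.Component) : Subgroup X.Total :=
  X.wallGraph.fundamentalSubgroup (X.baseVertex c)

/-- The family `∂G = S_1 ∪ S_2 ∪ (W_1 *_{∂U_1 = ∂U_2} W_2)`. -/
def bdG : (Σ i : Bool, X.I i) ⊕ X.wallGraph.toGraph.Component → Subgroup X.Total :=
  Sum.elim (fun s => (X.S s.1 s.2).map (X.incl s.1)) X.wall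

/-- The family `∂G_i = S_i ∪ (U_i *_{∂U_i} W_i)`. -/
def bdGi (i : Bool) : X.I i ⊕ PUnit.{u + 1} → Subgroup (X.G i) :=
  Sum.elim (X.S i) (fun _ => (X.D i).total)

/-- The family `S_i ∪ W_i`. -/
def bdGiOpen (i : Bool) : X.I i ⊕ (X.D i).K → Subgroup (X.G i) :=
  Sum.elim (X.S i) (X.D i).W

/-- The subgroup of `G` generated by `U_i *_{∂U_i} W_i` and by `G_{i'}`, where `i'` is the other
index. -/
def far (i : Bool) : Subgroup X.Total := (X.D i).total.map (X.incl i) ⊔ (X.incl (!i)).range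

/-- The family `∂G ∪ G_{i'}`, that is, the family of the `S_i` together with the subgroup
generated by `U_i *_{∂U_i} W_i` and `G_{i'}`. -/
def bdFar (i : Bool) : X.I i ⊕ PUnit.{u + 1} → Subgroup X.Total :=
  Sum.elim (fun s => (X.S i s).map (X.incl i)) (fun _ => X.far i)

/-! ### Morphisms of pairs -/

/-- A path in the graph from the first end of the edge `j` to the base vertex of its component. -/
lemma exists_path (j : X.J) : ∃ x, X.wallGraph.toGraph.IsPath (X.wallGraph.src j)
    (X.baseVertex (Quotient.mk _ (X.wallGraph.src j))) x := by
  obtain ⟨x, hx⟩ := Quotient.mk_out (s := X.wallGraph.toGraph.componentSetoid) (X.wallGraph.src j)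
  exact ⟨x⁻¹, hx.inv⟩

/-- The inclusion `(U, ∂U) → (G, ∂G)`. The group `∂U_j` is an edge group of one component of the
graph. It is mapped to the fundamental group of this component by going from the vertex of `U`
to the first end of the edge and from there along any path to the base vertex. -/
def homU : FamilyHom X.inclU X.bdU X.bdG where
  idx j := Sum.inr (Quotient.mk _ (X.wallGraph.src j))
  c j := X.wallGraph.srcElt j * X.wallGraph.toGroup (X.exists_path j).choose
  mem := by
    intro j u hu
    have h := (X.exists_path j).choose_spec
    set x := (X.exists_path j).choose
    have hm := X.wallGraph.src_mem j _ (Subgroup.mem_map_of_mem X.inclU hu)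
    refine ⟨x⁻¹ * X.wallGraph.toGraph.vert (X.wallGraph.src j) ⟨_, hm⟩ * x,
      (h.inv.trans (GraphOfGroups.IsPath.vert _ _)).trans h, ?_⟩
    rw [map_mul, map_mul, map_inv]
    have := X.wallGraph.toGroup_vert (X.wallGraph.src j) ⟨_, hm⟩
    erw [this]
    simp [mul_assoc]

lemma incl_ne_mem_far {i i' : Bool} (h : i' ≠ i) (g : X.G i') : X.incl i' g ∈ X.far i := by
  obtain rfl : i' = !i := by cases i <;> cases i' <;> simp_all
  exact Subgroup.mem_sup_right ⟨g, rfl⟩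

lemma incl_total_mem_far (i i' : Bool) {g : X.G i'} (hg : g ∈ (X.D i').total) :
    X.incl i' g ∈ X.far i := by
  by_cases h : i' = i
  · subst h
    exact Subgroup.mem_sup_left (Subgroup.mem_map_of_mem _ hg)
  · exact X.incl_ne_mem_far h g

lemma path_mem_far (i : Bool) {u v : X.wallGraph.V} {x : X.wallGraph.toGraph.Universal}
    (h : X.wallGraph.toGraph.IsPath u v x) : X.wallGraph.toGroup x ∈ X.far i := by
  refine X.wallGraph.toGroup_mem (X.far i) ?_ ?_ h
  · rintro v _ ⟨w, hw, rfl⟩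
    exact X.incl_total_mem_far i v.1 ((X.D v.1).W_le v.2 hw)
  · intro j
    exact mul_mem (inv_mem (X.incl_total_mem_far i false ((X.D false).t_mem j)))
      (X.incl_total_mem_far i true ((X.D true).t_mem j))

/-- The inclusion `(G_i, ∂G_i) → (G, ∂G ∪ G_{i'})`. -/
def homExc (i : Bool) : FamilyHom (X.incl i) (X.bdGi i) (X.bdFar i) where
  idx := id
  c _ := 1
  mem := by
    rintro (s | _) g hg
    · rw [inv_one, one_mul, mul_one]
      exact Subgroup.mem_map_of_mem (X.incl i) hg
    · rw [inv_one, one_mul, mul_one]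
      exact X.incl_total_mem_far i i hg

/-- The inclusion `(G, ∂G) → (G, ∂G ∪ G_{i'})`. -/
def homCollapse (i : Bool) : FamilyHom (MonoidHom.id X.Total) X.bdG (X.bdFar i) where
  idx := Sum.elim (fun s => if h : s.1 = i then Sum.inl (h ▸ s.2) else Sum.inr PUnit.unit)
    (fun _ => Sum.inr PUnit.unit)
  c _ := 1
  mem := by
    rintro (⟨i', s⟩ | c) g hg
    · by_cases h : i' = i
      · subst h
        simpa [bdFar, bdG] using hg
      · obtain ⟨g, _, rfl⟩ := hg
        simpa [bdFar, h] using X.incl_ne_mem_far h g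
    · obtain ⟨x, hx, rfl⟩ := hg
      simpa [bdFar] using X.path_mem_far i hx

/-- Every member of `S_i ∪ W_i` is contained in a member of `∂G_i`. -/
def homOpen (i : Bool) : FamilyHom (MonoidHom.id (X.G i)) (X.bdGiOpen i) (X.bdGi i) where
  idx := Sum.map id (fun _ => PUnit.unit)
  c _ := 1
  mem := by
    rintro (s | k) g hg
    · rw [inv_one, one_mul, mul_one]
      exact hg
    · rw [inv_one, one_mul, mul_one]
      exact (X.D i).W_le k hg

/-- The inclusion of `(U, ∂U)` in the pair `(∂G_i, S_i ∪ W_i)`, in terms of coset spaces: `U` acts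
on the coset of `U_i *_{∂U_i} W_i`, and the coset `u ∂U_j` is mapped to `u t_j W_{κ j}`. -/
def homWall (i : Bool) :
    ActionPair.Hom (X.emb i) (groupPair X.bdU) (familyPair (X.homOpen i)) where
  mapX _ := ⟨Sum.inr PUnit.unit, ((1 : X.G i) : X.G i ⧸ (X.D i).total)⟩
  mapY := FamilyHom.map (h := X.emb i) (S := X.bdU) (S' := X.bdGiOpen i)
    { idx := fun j => Sum.inr ((X.D i).κ j)
      c := fun j => (X.D i).t j
      mem := fun j u hu => (X.D i).conj_mem j _ ((X.φ_bdU i j u).2 hu) }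
  mapX_smul a _ := by
    have h : X.emb i a ∈ (X.D i).total := (X.D i).U_le (X.φ i a).2
    change _ = (⟨Sum.inr PUnit.unit, ((X.emb i a * 1 : X.G i) : X.G i ⧸ (X.D i).total)⟩ :
      CosetSet (X.bdGi i))
    congr 1
    exact QuotientGroup.eq.2 (by simpa using h)
  mapY_smul := FamilyHom.map_smul _
  comm := by
    rintro ⟨j, x⟩
    induction x using QuotientGroup.induction_on with
    | H u =>
      change (⟨Sum.inr PUnit.unit, ((X.emb i u * (X.D i).t j * 1 : X.G i) :
        X.G i ⧸ (X.D i).total)⟩ : CosetSet (X.bdGi i)) = _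
      congr 1
      refine QuotientGroup.eq.2 ?_
      have h : X.emb i u ∈ (X.D i).total := (X.D i).U_le (X.φ i u).2
      simpa using mul_mem (inv_mem ((X.D i).t_mem j)) (inv_mem h)

/-! ### The maps in homology -/

variable {k : Type u} [CommRing k] (A : Rep.{u} k X.Total)

/-- `H_n(U, ∂U; A)`. -/
abbrev HU (n : ℕ) : ModuleCat.{u} k := pairHomology X.inclU X.bdU A n

/-- `H_n(G, ∂G; A)`. -/
abbrev HG (n : ℕ) : ModuleCat.{u} k := pairHomology (MonoidHom.id X.Total) X.bdG A n

/-- `H_n(G_i, ∂G_i; A)`. -/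
abbrev HGi (i : Bool) (n : ℕ) : ModuleCat.{u} k := pairHomology (X.incl i) (X.bdGi i) A n

/-- `H_n(G, ∂G ∪ G_{i'}; A)`. -/
abbrev HFar (i : Bool) (n : ℕ) : ModuleCat.{u} k :=
  pairHomology (MonoidHom.id X.Total) (X.bdFar i) A n

/-- `H_n(∂G_i, S_i ∪ W_i; A)`. -/
abbrev HWall (i : Bool) (n : ℕ) : ModuleCat.{u} k :=
  relHomology (X.incl i) (familyPair (X.homOpen i)) A n

/-- `H_n(U, ∂U; A) → H_n(G, ∂G; A)`, induced by inclusion. -/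
def mapU (n : ℕ) : X.HU A n ⟶ X.HG A n :=
  relHomologyMap X.inclU (MonoidHom.id X.Total) (MonoidHom.id_comp _) X.homU.toPairHom A n

/-- `H_n(G_i, ∂G_i; A) → H_n(G, ∂G ∪ G_{i'}; A)`, induced by inclusion (excision). -/
def mapExc (i : Bool) (n : ℕ) : X.HGi A i n ⟶ X.HFar A i n :=
  relHomologyMap (X.incl i) (MonoidHom.id X.Total) (MonoidHom.id_comp _) (X.homExc i).toPairHom A n

/-- `H_n(G, ∂G; A) → H_n(G, ∂G ∪ G_{i'}; A)`, induced by inclusion. -/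
def mapCollapse (i : Bool) (n : ℕ) : X.HG A n ⟶ X.HFar A i n :=
  relHomologyMap (MonoidHom.id X.Total) (MonoidHom.id X.Total) (MonoidHom.id_comp _)
    (X.homCollapse i).toPairHom A n

/-- `H_n(U, ∂U; A) → H_n(∂G_i, S_i ∪ W_i; A)`, induced by inclusion (excision). -/
def mapWall (i : Bool) (n : ℕ) : X.HU A n ⟶ X.HWall A i n :=
  relHomologyMap X.inclU (X.incl i) (MonoidHom.ext (X.incl_emb i)) (X.homWall i) A n

/-- The boundary map `H_{n+1}(G_i, ∂G_i; A) → H_n(∂G_i, S_i ∪ W_i; A)` of the triple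
`(G_i, ∂G_i, S_i ∪ W_i)`. -/
def boundary (i : Bool) (n : ℕ) : X.HGi A i (n + 1) ⟶ X.HWall A i n :=
  tripleBoundary (X.incl i) (groupPair (X.bdGi i)) (familyPair (X.homOpen i)) id
    (fun _ _ => rfl) A n

end GluingData

end

/-! Write T_i for the image of U_i *_{∂U_i} W_i in G, C for the subgroup generated by T_1 and T_2
(`center`), D_c for the members of the family `wall`, and `bdCenter` for S_1 ∪ S_2 ∪ {C}. The
sequence of the theorem is the long exact sequence of the triple (G, `bdCenter`, ∂G) with two of its
three terms rewritten: H_n(`bdCenter`, ∂G) is H_n(U, ∂U) by `mapCenter_bijective`, and H_n(G,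
`bdCenter`) is H_n(G_1, ∂G_1) ⊕ H_n(G_2, ∂G_2) by `mapInj_add_eq_iff`. The second identification
comes from the triple (G, ∂G ∪ G_{i'}, `bdCenter`): H_n(G_i, ∂G_i) is H_n(G, ∂G ∪ G_{i'}) by
`mapExc_bijective`, H_n(G_{i'}, ∂G_{i'}) is H_n(∂G ∪ G_{i'}, `bdCenter`) by `farHom_bijective`, and
the inclusion of (G_i, ∂G_i) in (G, `bdCenter`) splits the sequence.

All these identifications, and `mapWall_bijective`, are excisions with the same proof. Shapiro's
lemma (`permChainsMap_bijective`) replaces every pair by a pair of G-sets. What remains is a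
commutative square of G-sets E → A, B → C. If 0 → M[E] → M[A] ⊕ M[B] → M[C] → 0 is exact for the
coefficient group M, the relative homology of A ← E and that of C ← B agree
(`relHomologyMap_bijective_of_isSetBicartesian`). Everything thus reduces to squares of coset
spaces.

Two squares are fundamental: G/U → G/G_1, G/G_2 → pt (`isSetBicartesian_amalgam`), and ⨆ G/∂U_j →
G/U, ⨆ G/W_c → G/T_i (`AmalgamSubgroup.isSetBicartesian_star`). They express that the Bass–Serre
trees of the two decompositions are acyclic. Exactness in the middle and on the right holds because
the squares are pushouts of sets (`IsSetBicartesian.of_pushout`). Injectivity on the left is proved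
without trees or normal forms: the group acts on ℤ[edges] by affine maps with the permutation action
as linear part, in such a way that every vertex group fixes a point and the fixed points of the two
ends of an edge differ by that edge. The orbit maps of these fixed points give a retraction onto
ℤ[edges] (`eq_zero_of_mapDomain_eq_zero`). The affine action exists by the universal property of the
amalgam or of the graph of groups; for the star, the hypothesis `faithful` transfers it to the
subgroup of G_i.

The other squares result from these by pasting, cancelling and adding common summands, together with
the pushout property of the cosets of a join and of the square of walls ⨆ G/∂U_j → ⨆ G/W_1, ⨆ G/W_2
→ ⨆ G/D_c. The fundamental groups of the components of the wall graph enter only through their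
images D_c in G. -/

noncomputable section

/-! ## Homology classes and their representing cycles -/

section Represents

variable {k : Type u} [CommRing k]

/-- The homology class `x` is represented by the cycle `c`. -/
def Represents (K : ChainComplex (ModuleCat.{u} k) ℕ) (n : ℕ) (c : K.X n) (x : K.homology n) :
    Prop :=
  ∃ z : K.cycles n, K.iCycles n z = c ∧ K.homologyπ n z = x

namespace Represents

variable {K L : ChainComplex (ModuleCat.{u} k) ℕ} {n : ℕ}

lemma exists_cycle (x : K.homology n) : ∃ c, Represents K n c x := by
  obtain ⟨z, rfl⟩ := (ModuleCat.epi_iff_surjective (K.homologyπ n)).1 inferInstance x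
  exact ⟨_, z, rfl, rfl⟩

lemma d_eq_zero {c : K.X n} {x : K.homology n} (h : Represents K n c x) (m : ℕ) :
    K.d n m c = 0 := by
  obtain ⟨z, rfl, -⟩ := h
  rw [← ModuleCat.comp_apply, HomologicalComplex.iCycles_d]
  rfl

lemma exists_class {c : K.X n} (h : ∀ m, K.d n m c = 0) : ∃ x, Represents K n c x := by
  -- A cycle is regarded as a morphism out of `k` that is killed by the differential, so that it
  -- lifts to the object of cycles.
  let g : ModuleCat.of k k ⟶ K.X n := ModuleCat.ofHom (LinearMap.toSpanSingleton k _ c)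
  have hg : g ≫ K.d n ((ComplexShape.down ℕ).next n) = 0 := by
    ext
    simp [g, h]
  refine ⟨_, K.liftCycles g _ rfl hg (1 : k), ?_, rfl⟩
  rw [← ModuleCat.comp_apply, HomologicalComplex.liftCycles_i]
  simp [g]

lemma sub {c c' : K.X n} {x x' : K.homology n} (h : Represents K n c x)
    (h' : Represents K n c' x') : Represents K n (c - c') (x - x') := by
  obtain ⟨z, rfl, rfl⟩ := h
  obtain ⟨z', rfl, rfl⟩ := h'
  exact ⟨z - z', map_sub _ _ _, map_sub _ _ _⟩

lemma boundary (b : K.X (n + 1)) : Represents K n (K.d (n + 1) n b) 0 := by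
  refine ⟨K.toCycles (n + 1) n b, ?_, ?_⟩
  · rw [← ModuleCat.comp_apply, HomologicalComplex.toCycles_i]
  · rw [← ModuleCat.comp_apply, HomologicalComplex.toCycles_comp_homologyπ]
    rfl

/-- Homology is the cokernel of the chains mapping to the cycles, and the cycles embed in the
chains. This turns equations between classes into equations between chains, and all the diagram
chases below rest on it. -/
lemma eq_zero_iff {c : K.X n} {x : K.homology n} (h : Represents K n c x) :
    x = 0 ↔ ∃ b, K.d (n + 1) n b = c := by
  obtain ⟨z, rfl, rfl⟩ := h
  constructor
  · intro hz
    have hex : (ShortComplex.mk _ _ (K.toCycles_comp_homologyπ (n + 1) n)).Exact :=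
      ShortComplex.exact_of_g_is_cokernel _ (K.homologyIsCokernel (n + 1) n (by simp))
    obtain ⟨b, hb⟩ := (ShortComplex.moduleCat_exact_iff _).1 hex z hz
    refine ⟨b, ?_⟩
    rw [← K.toCycles_i (n + 1) n, ModuleCat.comp_apply]
    exact congrArg _ hb
  · rintro ⟨b, hb⟩
    have : K.toCycles (n + 1) n b = z := by
      apply (ModuleCat.mono_iff_injective (K.iCycles n)).1 inferInstance
      rw [← hb, ← ModuleCat.comp_apply, HomologicalComplex.toCycles_i]
    rw [← this, ← ModuleCat.comp_apply, HomologicalComplex.toCycles_comp_homologyπ]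
    rfl

lemma unique {c : K.X n} {x x' : K.homology n} (h : Represents K n c x)
    (h' : Represents K n c x') : x = x' := by
  rw [← sub_eq_zero]
  exact (h.sub h').eq_zero_iff.2 ⟨0, by simp⟩

lemma map {c : K.X n} {x : K.homology n} (h : Represents K n c x) (φ : K ⟶ L) :
    Represents L n (φ.f n c) (HomologicalComplex.homologyMap φ n x) := by
  obtain ⟨z, rfl, rfl⟩ := h
  refine ⟨HomologicalComplex.cyclesMap φ n z, ?_, ?_⟩
  · rw [← ModuleCat.comp_apply, HomologicalComplex.cyclesMap_i, ModuleCat.comp_apply]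
  · rw [← ModuleCat.comp_apply, ← HomologicalComplex.homologyπ_naturality, ModuleCat.comp_apply]

lemma homologous {c c' : K.X n} {x : K.homology n} (h : Represents K n c x) (b : K.X (n + 1))
    (hb : c - c' = K.d (n + 1) n b) : Represents K n c' x := by
  have := h.sub (boundary b)
  rwa [← hb, sub_sub_cancel, sub_zero] at this

end Represents

end Represents

/-! ## Chains of the mapping cone -/

section Cone

variable {k : Type u} [CommRing k] {F E : ChainComplex (ModuleCat.{u} k) ℕ}

open HomologicalComplex

lemma down_rel (n : ℕ) : (ComplexShape.down ℕ).Rel (n + 1) n := rfl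

/-- The inclusion of `F_n` in degree `n + 1` of the mapping cone. -/
def coneInl (φ : F ⟶ E) (n : ℕ) : F.X n →ₗ[k] (homotopyCofiber φ).X (n + 1) :=
  (homotopyCofiber.inlX φ n (n + 1) rfl).hom

/-- The inclusion of `E_n` in degree `n` of the mapping cone. -/
def coneInr (φ : F ⟶ E) (n : ℕ) : E.X n →ₗ[k] (homotopyCofiber φ).X n :=
  (homotopyCofiber.inrX φ n).hom

/-- The projection of the mapping cone in degree `n + 1` to `F_n`. -/
def coneFst (φ : F ⟶ E) (n : ℕ) : (homotopyCofiber φ).X (n + 1) →ₗ[k] F.X n :=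
  (homotopyCofiber.fstX φ (n + 1) n rfl).hom

/-- The projection of the mapping cone in degree `n` to `E_n`. -/
def coneSnd (φ : F ⟶ E) (n : ℕ) : (homotopyCofiber φ).X n →ₗ[k] E.X n :=
  (homotopyCofiber.sndX φ n).hom

variable (φ : F ⟶ E)

@[simp] lemma coneFst_inl (n : ℕ) (z : F.X n) : coneFst φ n (coneInl φ n z) = z :=
  congrArg (fun f => f.hom z) (homotopyCofiber.inlX_fstX φ n (n + 1) rfl)

@[simp] lemma coneFst_inr (n : ℕ) (y : E.X (n + 1)) : coneFst φ n (coneInr φ (n + 1) y) = 0 :=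
  congrArg (fun f => f.hom y) (homotopyCofiber.inrX_fstX φ (n + 1) n rfl)

@[simp] lemma coneSnd_inl (n : ℕ) (z : F.X n) : coneSnd φ (n + 1) (coneInl φ n z) = 0 :=
  congrArg (fun f => f.hom z) (homotopyCofiber.inlX_sndX φ n (n + 1) rfl)

@[simp] lemma coneSnd_inr (n : ℕ) (y : E.X n) : coneSnd φ n (coneInr φ n y) = y :=
  congrArg (fun f => f.hom y) (homotopyCofiber.inrX_sndX φ n)

lemma cone_zero_eq (c : (homotopyCofiber φ).X 0) : ∃ y, c = coneInr φ 0 y :=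
  ⟨coneSnd φ 0 c, (congrArg (fun f => f.hom c)
    (homotopyCofiber.sndX_inrX φ 0 (by simp))).symm⟩

lemma cone_succ_eq (n : ℕ) (c : (homotopyCofiber φ).X (n + 1)) :
    ∃ z y, c = coneInl φ n z + coneInr φ (n + 1) y := by
  refine ⟨coneFst φ n c, coneSnd φ (n + 1) c, ?_⟩
  have : 𝟙 (homotopyCofiber.X φ (n + 1)) =
      homotopyCofiber.fstX φ (n + 1) n (down_rel n) ≫ homotopyCofiber.inlX φ n (n + 1) (down_rel n) +
        homotopyCofiber.sndX φ (n + 1) ≫ homotopyCofiber.inrX φ (n + 1) := by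
    apply homotopyCofiber.ext_from_X φ n (n + 1) (down_rel n)
    · rw [Preadditive.comp_add, homotopyCofiber.inlX_fstX_assoc,
        homotopyCofiber.inlX_sndX_assoc, Limits.zero_comp, add_zero, Category.comp_id]
    · rw [Preadditive.comp_add, homotopyCofiber.inrX_fstX_assoc,
        homotopyCofiber.inrX_sndX_assoc, Limits.zero_comp, zero_add, Category.comp_id]
  exact congrArg (fun f => f.hom c) this

lemma cone_d_inr (m n : ℕ) (y : E.X m) :
    (homotopyCofiber φ).d m n (coneInr φ m y) = coneInr φ n (E.d m n y) :=
  congrArg (fun f => f.hom y) (homotopyCofiber.inrX_d φ m n)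

lemma cone_d_inl_succ (n : ℕ) (z : F.X (n + 1)) :
    (homotopyCofiber φ).d (n + 2) (n + 1) (coneInl φ (n + 1) z) =
      -coneInl φ n (F.d (n + 1) n z) + coneInr φ (n + 1) (φ.f (n + 1) z) :=
  congrArg (fun f => f.hom z) (homotopyCofiber.inlX_d φ (n + 2) (n + 1) n rfl rfl)

lemma cone_d_inl_zero (z : F.X 0) :
    (homotopyCofiber φ).d 1 0 (coneInl φ 0 z) = coneInr φ 0 (φ.f 0 z) :=
  congrArg (fun f => f.hom z) (homotopyCofiber.inlX_d' φ 1 0 rfl (by simp))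

lemma coneInr_injective (n : ℕ) : Function.Injective (coneInr φ n) :=
  Function.LeftInverse.injective (coneSnd_inr φ n)

lemma cone_ext {n : ℕ} {z z' : F.X n} {y y' : E.X (n + 1)} :
    coneInl φ n z + coneInr φ (n + 1) y = coneInl φ n z' + coneInr φ (n + 1) y' ↔
      z = z' ∧ y = y' := by
  constructor
  · intro h
    constructor
    · simpa only [map_add, coneFst_inl, coneFst_inr, add_zero] using congrArg (coneFst φ n) h
    · simpa only [map_add, coneSnd_inl, coneSnd_inr, zero_add] using congrArg (coneSnd φ (n + 1)) h
  · rintro ⟨rfl, rfl⟩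
    rfl

lemma d_eq_zero_of_ne {K : ChainComplex (ModuleCat.{u} k) ℕ} {n m : ℕ} (h : n ≠ m + 1)
    (c : K.X n) : K.d n m c = 0 := by
  rw [K.shape n m (by simpa using h.symm)]
  rfl

lemma cone_cycle_zero (c : (homotopyCofiber φ).X 0) (m : ℕ) :
    (homotopyCofiber φ).d 0 m c = 0 :=
  d_eq_zero_of_ne (by omega) c

/-- The cone has no `F`-summand in degree zero, so its differential has one formula out of degree
one and another in higher degrees. The term `w` absorbs the difference: it stands for `-coneInl (d
z)`, and is zero if `z` is a cycle or `n = 0`. -/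
lemma cone_d_eq (n : ℕ) (z : F.X n) (y : E.X (n + 1)) :
    (∃ w, (homotopyCofiber φ).d (n + 1) n (coneInl φ n z + coneInr φ (n + 1) y) =
      w + coneInr φ n (φ.f n z + E.d (n + 1) n y) ∧ ∀ m, n = m + 1 → F.d n m z = 0 → w = 0) := by
  rcases n with _ | n
  · refine ⟨0, ?_, fun _ _ _ => rfl⟩
    rw [map_add, cone_d_inl_zero, cone_d_inr, map_add]
    exact (zero_add _).symm
  · refine ⟨-coneInl φ n (F.d (n + 1) n z), ?_, ?_⟩
    · rw [map_add, cone_d_inl_succ, cone_d_inr, map_add, add_assoc]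
    · rintro m hm h
      obtain rfl : n = m := by omega
      rw [h, map_zero, neg_zero]

/-- The cycles of the mapping cone in positive degrees. -/
lemma cone_cycle_succ (n : ℕ) (z : F.X n) (y : E.X (n + 1)) :
    (∀ m, (homotopyCofiber φ).d (n + 1) m (coneInl φ n z + coneInr φ (n + 1) y) = 0) ↔
      (∀ m, F.d n m z = 0) ∧ φ.f n z + E.d (n + 1) n y = 0 := by
  constructor
  · intro h
    have h0 := h n
    rcases n with _ | n
    · rw [map_add, cone_d_inl_zero, cone_d_inr, ← map_add] at h0
      exact ⟨fun m => d_eq_zero_of_ne (by omega) z, coneInr_injective φ 0 (by rw [h0, map_zero])⟩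
    · rw [map_add, cone_d_inl_succ, cone_d_inr, add_assoc, ← map_add, ← map_neg] at h0
      have := (cone_ext φ (z' := 0) (y' := 0)).1 (by rw [h0, map_zero, map_zero, add_zero])
      refine ⟨fun m => ?_, this.2⟩
      by_cases hm : m = n
      · subst hm
        exact neg_eq_zero.1 this.1
      · exact d_eq_zero_of_ne (by omega) z
  · rintro ⟨h1, h2⟩ m
    by_cases hm : m = n
    · subst hm
      obtain ⟨w, hw, hw'⟩ := cone_d_eq φ m z y
      rcases m with _ | m
      · rw [map_add, cone_d_inl_zero, cone_d_inr, ← map_add, h2, map_zero]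
      · rw [hw, h2, map_zero, hw' m rfl (h1 m), add_zero]
    · exact d_eq_zero_of_ne (by omega) _

/-- The boundary of a chain of the mapping cone of degree at least two. -/
lemma cone_d_succ (n : ℕ) (z : F.X (n + 1)) (y : E.X (n + 2)) :
    (homotopyCofiber φ).d (n + 2) (n + 1) (coneInl φ (n + 1) z + coneInr φ (n + 2) y) =
      coneInl φ n (-F.d (n + 1) n z) +
        coneInr φ (n + 1) (φ.f (n + 1) z + E.d (n + 2) (n + 1) y) := by
  rw [map_add, cone_d_inl_succ, cone_d_inr, map_add, add_assoc, map_neg]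

lemma cone_d_one (z : F.X 0) (y : E.X 1) :
    (homotopyCofiber φ).d 1 0 (coneInl φ 0 z + coneInr φ 1 y) =
      coneInr φ 0 (φ.f 0 z + E.d 1 0 y) := by
  rw [map_add, cone_d_inl_zero, cone_d_inr, map_add]

variable {F' E' : ChainComplex (ModuleCat.{u} k) ℕ} {φ} {φ' : F' ⟶ E'}

/-- The map of mapping cones induced by a commutative square. -/
def coneMap (a : F ⟶ F') (b : E ⟶ E') (w : a ≫ φ' = φ ≫ b) :
    homotopyCofiber φ ⟶ homotopyCofiber φ' :=
  homotopyCofiber.mapArrowHom φ φ' (fun j => ⟨j + 1, rfl⟩) (Arrow.homMk a b w)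

lemma coneMap_inl (a : F ⟶ F') (b : E ⟶ E') (w : a ≫ φ' = φ ≫ b) (n : ℕ) (z : F.X n) :
    (coneMap a b w).f (n + 1) (coneInl φ n z) = coneInl φ' n (a.f n z) := by
  have : homotopyCofiber.inlX φ n (n + 1) rfl ≫ (coneMap a b w).f (n + 1) =
      a.f n ≫ homotopyCofiber.inlX φ' n (n + 1) rfl := by
    refine (homotopyCofiber.inlX_desc_f _ _ _ n (n + 1) rfl).trans ?_
    simp [homotopyCofiber.inrCompHomotopy_hom]
  exact congrArg (fun f => f.hom z) this

lemma coneMap_inr (a : F ⟶ F') (b : E ⟶ E') (w : a ≫ φ' = φ ≫ b) (n : ℕ) (y : E.X n) :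
    (coneMap a b w).f n (coneInr φ n y) = coneInr φ' n (b.f n y) := by
  have : homotopyCofiber.inrX φ n ≫ (coneMap a b w).f n =
      b.f n ≫ homotopyCofiber.inrX φ' n := by
    simp [coneMap, homotopyCofiber.mapArrowHom]
  exact congrArg (fun f => f.hom y) this

lemma coneMap_apply (a : F ⟶ F') (b : E ⟶ E') (w : a ≫ φ' = φ ≫ b) (n : ℕ) (z : F.X n)
    (y : E.X (n + 1)) :
    (coneMap a b w).f (n + 1) (coneInl φ n z + coneInr φ (n + 1) y) =
      coneInl φ' n (a.f n z) + coneInr φ' (n + 1) (b.f (n + 1) y) := by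
  rw [map_add, coneMap_inl, coneMap_inr]

/-- The connecting map descends from the projection of the cone to `F`, so on representatives it
picks the first component, with no sign. -/
lemma Represents.coneBoundary {n : ℕ} {z : F.X n} {y : E.X (n + 1)}
    {x : (homotopyCofiber φ).homology (n + 1)}
    (h : Represents (homotopyCofiber φ) (n + 1) (coneInl φ n z + coneInr φ (n + 1) y) x) :
    Represents F n z (coneBoundary φ n x) := by
  obtain ⟨c, hc, rfl⟩ := h
  refine ⟨F.liftCycles ((homotopyCofiber φ).iCycles (n + 1) ≫
        homotopyCofiber.fstX φ (n + 1) n rfl) _ rfl (coneBoundary_aux φ n) c, ?_, ?_⟩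
  · rw [← ModuleCat.comp_apply, HomologicalComplex.liftCycles_i, ModuleCat.comp_apply, hc]
    exact (map_add (coneFst φ n) _ _).trans (by rw [coneFst_inl, coneFst_inr, add_zero])
  · rw [← ModuleCat.comp_apply, ← ModuleCat.comp_apply]
    have : (homotopyCofiber φ).homologyπ (n + 1) ≫ _root_.coneBoundary φ n = _ :=
      Limits.Cofork.IsColimit.π_desc
        ((homotopyCofiber φ).homologyIsCokernel (n + 2) (n + 1) (by simp))
    rw [this]
    rfl

/-- Every class of the mapping cone in positive degree has a representing cycle
`coneInl z + coneInr y`. -/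
lemma cone_exists_cycle_succ {n : ℕ} (x : (homotopyCofiber φ).homology (n + 1)) :
    ∃ (z : F.X n) (y : E.X (n + 1)),
      Represents (homotopyCofiber φ) (n + 1) (coneInl φ n z + coneInr φ (n + 1) y) x ∧
      (∀ m, F.d n m z = 0) ∧ φ.f n z + E.d (n + 1) n y = 0 := by
  obtain ⟨c, hc⟩ := Represents.exists_cycle x
  obtain ⟨z, y, rfl⟩ := cone_succ_eq φ n c
  exact ⟨z, y, hc, (cone_cycle_succ φ n z y).1 hc.d_eq_zero⟩

lemma cone_exists_cycle_zero (x : (homotopyCofiber φ).homology 0) :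
    ∃ y : E.X 0, Represents (homotopyCofiber φ) 0 (coneInr φ 0 y) x := by
  obtain ⟨c, hc⟩ := Represents.exists_cycle x
  obtain ⟨y, hy⟩ := cone_zero_eq φ c
  exact ⟨y, hy ▸ hc⟩

end Cone

/-! ## The exact sequence of a triple -/

section Triple

variable {k : Type u} [CommRing k]

open HomologicalComplex

section Cone

variable {F E : ChainComplex (ModuleCat.{u} k) ℕ} (φ : F ⟶ E)

lemma cone_sub (n : ℕ) (z z' : F.X n) (y y' : E.X (n + 1)) :
    coneInl φ n z + coneInr φ (n + 1) y - (coneInl φ n z' + coneInr φ (n + 1) y') =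
      coneInl φ n (z - z') + coneInr φ (n + 1) (y - y') := by
  rw [map_sub, map_sub]
  abel

/-- Change of a representing cycle of the mapping cone by the boundary of `z' + y'`. -/
lemma Represents.cone_homologous {n : ℕ} {z₁ z₂ : F.X n} {y₁ y₂ : E.X (n + 1)}
    {x : (homotopyCofiber φ).homology (n + 1)}
    (h : Represents (homotopyCofiber φ) (n + 1) (coneInl φ n z₁ + coneInr φ (n + 1) y₁) x)
    (z : F.X (n + 1)) (y : E.X (n + 2)) (hz : z₂ - z₁ = F.d (n + 1) n z)
    (hy : y₁ - y₂ = φ.f (n + 1) z + E.d (n + 2) (n + 1) y) :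
    Represents (homotopyCofiber φ) (n + 1) (coneInl φ n z₂ + coneInr φ (n + 1) y₂) x := by
  refine h.homologous (coneInl φ (n + 1) z + coneInr φ (n + 2) y) ?_
  rw [cone_d_succ, cone_sub, hy, ← hz, neg_sub]

lemma Represents.cone_homologous_zero {y₁ y₂ : E.X 0}
    {x : (homotopyCofiber φ).homology 0}
    (h : Represents (homotopyCofiber φ) 0 (coneInr φ 0 y₁) x)
    (z : F.X 0) (y : E.X 1) (hy : y₁ - y₂ = φ.f 0 z + E.d 1 0 y) :
    Represents (homotopyCofiber φ) 0 (coneInr φ 0 y₂) x := by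
  refine h.homologous (coneInl φ 0 z + coneInr φ 1 y) ?_
  rw [cone_d_one, ← hy, map_sub]

lemma Represents.cone_eq_zero_iff {n : ℕ} {z₁ : F.X n} {y₁ : E.X (n + 1)}
    {x : (homotopyCofiber φ).homology (n + 1)}
    (h : Represents (homotopyCofiber φ) (n + 1) (coneInl φ n z₁ + coneInr φ (n + 1) y₁) x) :
    x = 0 ↔ ∃ (z : F.X (n + 1)) (y : E.X (n + 2)), -F.d (n + 1) n z = z₁ ∧
      φ.f (n + 1) z + E.d (n + 2) (n + 1) y = y₁ := by
  rw [h.eq_zero_iff]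
  constructor
  · rintro ⟨b, hb⟩
    obtain ⟨z, y, rfl⟩ := cone_succ_eq φ (n + 1) b
    rw [cone_d_succ, cone_ext] at hb
    exact ⟨z, y, hb⟩
  · rintro ⟨z, y, rfl, rfl⟩
    exact ⟨_, cone_d_succ φ n z y⟩

lemma Represents.cone_eq_zero_iff_zero {y₁ : E.X 0} {x : (homotopyCofiber φ).homology 0}
    (h : Represents (homotopyCofiber φ) 0 (coneInr φ 0 y₁) x) :
    x = 0 ↔ ∃ (z : F.X 0) (y : E.X 1), φ.f 0 z + E.d 1 0 y = y₁ := by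
  rw [h.eq_zero_iff]
  constructor
  · rintro ⟨b, hb⟩
    obtain ⟨z, y, rfl⟩ := cone_succ_eq φ 0 b
    exact ⟨z, y, coneInr_injective φ 0 ((cone_d_one φ z y).symm.trans hb)⟩
  · rintro ⟨z, y, rfl⟩
    exact ⟨_, cone_d_one φ z y⟩

lemma Represents.inr {n : ℕ} {y : E.X n} {x : E.homology n} (h : Represents E n y x) :
    Represents (homotopyCofiber φ) n (coneInr φ n y) (homologyMap (homotopyCofiber.inr φ) n x) :=
  h.map (homotopyCofiber.inr φ)

lemma f_d_eq {K L : ChainComplex (ModuleCat.{u} k) ℕ} (f : K ⟶ L) (m n : ℕ) (c : K.X m) :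
    f.f n (K.d m n c) = L.d m n (f.f m c) :=
  congrArg (fun g => g.hom c) (f.comm m n).symm

lemma d_d_eq {K : ChainComplex (ModuleCat.{u} k) ℕ} (l m n : ℕ) (c : K.X l) :
    K.d m n (K.d l m c) = 0 :=
  congrArg (fun g => g.hom c) (K.d_comp_d l m n)

end Cone

variable {Z Y X : ChainComplex (ModuleCat.{u} k) ℕ} {φ : Z ⟶ Y} {ψ : Y ⟶ X} {χ : Z ⟶ X}
  {a : Z ⟶ Z} {b : X ⟶ X} {c : Y ⟶ Y}
  (ha : ∀ n z, a.f n z = z) (hb : ∀ n z, b.f n z = z) (hc : ∀ n z, c.f n z = z)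
  (w₁ : a ≫ χ = φ ≫ ψ) (w₂ : φ ≫ ψ = χ ≫ b)

-- The endomorphisms `a`, `b`, `c` fix every chain. They are not written as identity morphisms
-- because in the application they are the maps induced by identity maps of sets with group action.
include hb w₂ in
lemma triple_comp (n : ℕ) (z : Z.X n) : ψ.f n (φ.f n z) = χ.f n z := by
  have := congrArg (fun g => (g.f n).hom z) w₂
  exact this.trans (hb n _)

-- If the image (φ z, x₀) of a cycle (z, x₀) is the boundary of (y, x'), then φ z = -dy and x₀ = ψ y
-- + dx'. So (z, y) is a relative cycle of (Y, Z), and x' makes its image (z, ψ y) homologous to (z,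
-- x₀). Conversely the image of a cycle (z, y) is the boundary of (y, 0).
include ha hb in
lemma triple_exact_middle (n : ℕ) :
    Function.Exact (homologyMap (coneMap a ψ w₁) n) (homologyMap (coneMap φ b w₂) n) := by
  intro x
  rcases n with _ | n
  · constructor
    · intro hx
      obtain ⟨x₀, h₀⟩ := cone_exists_cycle_zero x
      have h₁ := h₀.map (coneMap φ b w₂)
      rw [coneMap_inr, hb, hx] at h₁
      obtain ⟨y, x', h⟩ := h₁.cone_eq_zero_iff_zero.1 rfl
      obtain ⟨t, ht⟩ := Represents.exists_class (cone_cycle_zero φ (coneInr φ 0 y))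
      refine ⟨t, ?_⟩
      have h₂ := ht.map (coneMap a ψ w₁)
      rw [coneMap_inr] at h₂
      refine h₂.unique (h₀.cone_homologous_zero χ 0 x' ?_)
      rw [← h, map_zero]
      abel
    · rintro ⟨t, rfl⟩
      obtain ⟨y, h₀⟩ := cone_exists_cycle_zero t
      have h₁ := (h₀.map (coneMap a ψ w₁)).map (coneMap φ b w₂)
      rw [coneMap_inr, coneMap_inr, hb] at h₁
      exact h₁.cone_eq_zero_iff_zero.2 ⟨y, 0, by rw [map_zero, add_zero]⟩
  · constructor
    · intro hx
      obtain ⟨z, x₀, h₀, hz, hzx⟩ := cone_exists_cycle_succ x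
      have h₁ := h₀.map (coneMap φ b w₂)
      rw [coneMap_apply, hb, hx] at h₁
      obtain ⟨y, x', h, h'⟩ := h₁.cone_eq_zero_iff.1 rfl
      obtain ⟨t, ht⟩ := Represents.exists_class ((cone_cycle_succ φ n z y).2
        ⟨hz, by rw [← h]; abel⟩)
      refine ⟨t, ?_⟩
      have h₂ := ht.map (coneMap a ψ w₁)
      rw [coneMap_apply, ha] at h₂
      refine h₂.unique (h₀.cone_homologous χ 0 x' ?_ ?_)
      · rw [map_zero, sub_self]
      · rw [← h', map_zero]
        abel
    · rintro ⟨t, rfl⟩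
      obtain ⟨z, y, h₀, hz, hzy⟩ := cone_exists_cycle_succ t
      have h₁ := (h₀.map (coneMap a ψ w₁)).map (coneMap φ b w₂)
      rw [coneMap_apply, coneMap_apply, hb, ha] at h₁
      exact h₁.cone_eq_zero_iff.2 ⟨y, 0, (eq_neg_of_add_eq_zero_left hzy).symm,
        by rw [map_zero, add_zero]⟩

include hb in
lemma triple_surjective_zero :
    Function.Surjective (homologyMap (coneMap φ b w₂) 0) := by
  intro x
  obtain ⟨x₀, h₀⟩ := cone_exists_cycle_zero x
  obtain ⟨t, ht⟩ := Represents.exists_class (cone_cycle_zero χ (coneInr χ 0 x₀))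
  have h₁ := ht.map (coneMap φ b w₂)
  rw [coneMap_inr, hb] at h₁
  exact ⟨t, h₁.unique h₀⟩

/-- The composite of the connecting map of the cone of `ψ` with the map to the cone of `φ`. -/
def coneTripleBoundary (φ : Z ⟶ Y) (ψ : Y ⟶ X) (c : Y ⟶ Y) (n : ℕ) :
    (homotopyCofiber ψ).homology (n + 1) ⟶ (homotopyCofiber φ).homology n :=
  coneBoundary ψ n ≫ homologyMap (c ≫ homotopyCofiber.inr φ) n

include hc in
lemma Represents.coneTripleBoundary {n : ℕ} {y : Y.X n} {x : X.X (n + 1)}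
    {t : (homotopyCofiber ψ).homology (n + 1)}
    (h : Represents (homotopyCofiber ψ) (n + 1) (coneInl ψ n y + coneInr ψ (n + 1) x) t) :
    Represents (homotopyCofiber φ) n (coneInr φ n y) (coneTripleBoundary φ ψ c n t) := by
  have := h.coneBoundary.map (c ≫ homotopyCofiber.inr φ)
  have e : (c ≫ homotopyCofiber.inr φ).f n y = coneInr φ n y :=
    congrArg (coneInr φ n) (hc n y)
  rwa [e] at this

-- The boundary of a class (y, x) is the class of y in (Y, Z). If it vanishes, then y = φ z + dy'
-- with z a cycle, and (z, x + ψ y') is a cycle of (X, Z) whose image differs from (y, x) by the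
-- boundary of -y'.
include hb hc in
lemma triple_exact_right (n : ℕ) :
    Function.Exact (homologyMap (coneMap φ b w₂) (n + 1)) (coneTripleBoundary φ ψ c n) := by
  intro t
  constructor
  · intro ht
    obtain ⟨y, x, h₀, hy, hyx⟩ := cone_exists_cycle_succ t
    have h₁ := h₀.coneTripleBoundary (φ := φ) hc
    rw [ht] at h₁
    -- That z is a cycle is automatic for `n = 0`. In higher degrees it is the first component of
    -- the equation in the cone, since y has first component zero there.
    have key : ∃ (z : Z.X n) (y' : Y.X (n + 1)), (∀ m, Z.d n m z = 0) ∧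
        φ.f n z + Y.d (n + 1) n y' = y := by
      rcases n with _ | n
      · obtain ⟨z, y', h⟩ := h₁.cone_eq_zero_iff_zero.1 rfl
        exact ⟨z, y', fun m => d_eq_zero_of_ne (by omega) z, h⟩
      · have h₂ : Represents (homotopyCofiber φ) (n + 1)
            (coneInl φ n 0 + coneInr φ (n + 1) y) 0 := by
          rwa [map_zero, zero_add]
        obtain ⟨z, y', h, h'⟩ := h₂.cone_eq_zero_iff.1 rfl
        refine ⟨z, y', fun m => ?_, h'⟩
        by_cases hm : m = n
        · subst hm
          exact neg_eq_zero.1 h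
        · exact d_eq_zero_of_ne (by omega) z
    obtain ⟨z, y', hz, hzy⟩ := key
    have hcyc : χ.f n z + X.d (n + 1) n (x + ψ.f (n + 1) y') = 0 := by
      rw [map_add, ← f_d_eq, ← triple_comp hb w₂, add_left_comm, ← map_add, hzy, add_comm, hyx]
    obtain ⟨s, hs⟩ := Represents.exists_class ((cone_cycle_succ χ n z _).2 ⟨hz, hcyc⟩)
    refine ⟨s, ?_⟩
    have h₂ := hs.map (coneMap φ b w₂)
    rw [coneMap_apply, hb] at h₂
    refine h₂.unique (h₀.cone_homologous ψ (-y') 0 ?_ ?_)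
    · rw [← hzy, map_neg]
      abel
    · rw [map_zero, map_neg]
      abel
  · rintro ⟨s, rfl⟩
    obtain ⟨z, x, h₀, hz, hzx⟩ := cone_exists_cycle_succ s
    have h₁ := h₀.map (coneMap φ b w₂)
    rw [coneMap_apply] at h₁
    have h₂ := h₁.coneTripleBoundary (φ := φ) hc
    rcases n with _ | n
    · exact h₂.cone_eq_zero_iff_zero.2 ⟨z, 0, by rw [map_zero, add_zero]⟩
    · rw [← zero_add (coneInr φ (n + 1) _), ← map_zero (coneInl φ n)] at h₂
      exact h₂.cone_eq_zero_iff.2 ⟨z, 0, by rw [hz, neg_zero], by rw [map_zero, add_zero]⟩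

include ha hb hc w₂ in
lemma triple_exact_left (n : ℕ) :
    Function.Exact (coneTripleBoundary φ ψ c n) (homologyMap (coneMap a ψ w₁) n) := by
  intro t
  constructor
  · intro ht
    -- If (z, ψ y) is the boundary of (z', x), then subtracting φ z' from y removes the component z.
    -- The class is then represented by an absolute cycle of Y, which bounds in X by means of x.
    have key : ∃ (y : Y.X n) (x : X.X (n + 1)), Represents (homotopyCofiber φ) n (coneInr φ n y) t ∧
        (∀ m, Y.d n m y = 0) ∧ ψ.f n y + X.d (n + 1) n x = 0 := by
      rcases n with _ | n
      · obtain ⟨y, h₀⟩ := cone_exists_cycle_zero t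
        have h₁ := h₀.map (coneMap a ψ w₁)
        rw [coneMap_inr, ht] at h₁
        obtain ⟨z, x, h⟩ := h₁.cone_eq_zero_iff_zero.1 rfl
        refine ⟨y - φ.f 0 z, -x, h₀.cone_homologous_zero φ z 0 ?_,
          fun m => d_eq_zero_of_ne (by omega) _, ?_⟩
        · rw [map_zero]
          abel
        · rw [map_sub, ← h, triple_comp hb w₂, map_neg]
          abel
      · obtain ⟨z, y, h₀, hz, hzy⟩ := cone_exists_cycle_succ t
        have h₁ := h₀.map (coneMap a ψ w₁)
        rw [coneMap_apply, ha, ht] at h₁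
        obtain ⟨z', x, h, h'⟩ := h₁.cone_eq_zero_iff.1 rfl
        refine ⟨y - φ.f (n + 1) z', -x, ?_, fun m => ?_, ?_⟩
        · have := h₀.cone_homologous φ z' 0 (z₂ := 0) (y₂ := y - φ.f (n + 1) z') ?_ ?_
          · rwa [map_zero, zero_add] at this
          · rw [← h]
            abel
          · rw [map_zero]
            abel
        · by_cases hm : m = n
          · subst hm
            rw [map_sub, ← f_d_eq, neg_eq_iff_eq_neg.1 h, map_neg, sub_neg_eq_add, add_comm, hzy]
          · exact d_eq_zero_of_ne (by omega) _
        · rw [map_sub, ← h', triple_comp hb w₂, map_neg]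
          abel
    obtain ⟨y, x, h₀, hy, hyx⟩ := key
    obtain ⟨s, hs⟩ := Represents.exists_class ((cone_cycle_succ ψ n y x).2 ⟨hy, hyx⟩)
    exact ⟨s, (hs.coneTripleBoundary hc).unique h₀⟩
  · rintro ⟨s, rfl⟩
    obtain ⟨y, x, h₀, hy, hyx⟩ := cone_exists_cycle_succ s
    have h₁ := (h₀.coneTripleBoundary (φ := φ) hc).map (coneMap a ψ w₁)
    rw [coneMap_inr] at h₁
    rcases n with _ | n
    · refine h₁.cone_eq_zero_iff_zero.2 ⟨0, -x, ?_⟩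
      rw [map_zero, zero_add, map_neg, eq_neg_of_add_eq_zero_left hyx]
    · rw [← zero_add (coneInr χ (n + 1) _), ← map_zero (coneInl χ n)] at h₁
      refine h₁.cone_eq_zero_iff.2 ⟨0, -x, by rw [map_zero, neg_zero], ?_⟩
      rw [map_zero, zero_add, map_neg, eq_neg_of_add_eq_zero_left hyx]

/-- Naturality of the boundary map of a triple. -/
lemma coneTripleBoundary_naturality {Z' Y' X' : ChainComplex (ModuleCat.{u} k) ℕ} {φ' : Z' ⟶ Y'}
    {ψ' : Y' ⟶ X'} {c' : Y' ⟶ Y'} (hc : ∀ n z, c.f n z = z) (hc' : ∀ n z, c'.f n z = z)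
    {f : Z ⟶ Z'} {g g' : Y ⟶ Y'} {h : X ⟶ X'} (wf : f ≫ φ' = φ ≫ g) (wg : g' ≫ ψ' = ψ ≫ h)
    (e : g = g') (n : ℕ) (t : (homotopyCofiber ψ).homology (n + 1)) :
    homologyMap (coneMap f g wf) n (coneTripleBoundary φ ψ c n t) =
      coneTripleBoundary φ' ψ' c' n (homologyMap (coneMap g' h wg) (n + 1) t) := by
  subst e
  obtain ⟨y, x, h₀, -, -⟩ := cone_exists_cycle_succ t
  have h₁ := (h₀.coneTripleBoundary (φ := φ) hc).map (coneMap f g wf)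
  have h₂ := h₀.map (coneMap g h wg)
  rw [coneMap_inr] at h₁
  rw [coneMap_apply] at h₂
  exact h₁.unique (h₂.coneTripleBoundary hc')

end Triple

/-! ## Comparison of mapping cones -/

section Comparison

variable {k : Type u} [CommRing k]

open HomologicalComplex

/-- A commutative square of abelian groups is bicartesian if the sequence
`0 → E → A ⊕ B → C → 0` is exact. -/
structure IsBicartesian {E A B C : Type*} [AddCommGroup E] [AddCommGroup A] [AddCommGroup B]
    [AddCommGroup C] (a : E →+ A) (b : E →+ B) (c : A →+ C) (d : B →+ C) : Prop where
  comm : ∀ x, c (a x) = d (b x)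
  inj : ∀ x, a x = 0 → b x = 0 → x = 0
  exact : ∀ y z, c y = d z → ∃ x, a x = y ∧ b x = z
  surj : ∀ w, ∃ y z, w = c y + d z

variable {E A B C : ChainComplex (ModuleCat.{u} k) ℕ} {a : E ⟶ A} {b : E ⟶ B} {c : A ⟶ C}
  {d : B ⟶ C} (w : b ≫ d = a ≫ c)

/-- The mapping cones of the two columns of a degreewise bicartesian square have the same
homology. -/
lemma homologyMap_coneMap_bijective_of_isBicartesian
    (h : ∀ n, IsBicartesian (a.f n).hom.toAddMonoidHom (b.f n).hom.toAddMonoidHom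
      (c.f n).hom.toAddMonoidHom (d.f n).hom.toAddMonoidHom) (n : ℕ) :
    Function.Bijective (homologyMap (coneMap b c w) n) := by
  have inj : ∀ n (x y : E.X n), a.f n x = a.f n y → b.f n x = b.f n y → x = y := by
    intro n x y h₁ h₂
    rw [← sub_eq_zero]
    exact (h n).inj _ (by simpa [sub_eq_zero] using h₁) (by simpa [sub_eq_zero] using h₂)
  have exact : ∀ n (y : A.X n) (z : B.X n), c.f n y = d.f n z → ∃ x, a.f n x = y ∧ b.f n x = z :=
    fun n => (h n).exact
  have surj : ∀ n (t : C.X n), ∃ y z, t = c.f n y + d.f n z := fun n => (h n).surj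
  constructor
  · rw [injective_iff_map_eq_zero]
    intro t ht
    rcases n with _ | n
    · obtain ⟨y, h₀⟩ := cone_exists_cycle_zero t
      have h₁ := h₀.map (coneMap b c w)
      rw [coneMap_inr, ht] at h₁
      obtain ⟨z, x, hzx⟩ := h₁.cone_eq_zero_iff_zero.1 rfl
      -- The bounding chain is split along C = c(A) + d(B), and its B-part is moved over to `z`. The
      -- remaining equation has the form c(…) = d(…), so both sides come from one chain `e` of E.
      obtain ⟨x₁, x₂, rfl⟩ := surj 1 x
      have hs : c.f 0 (y - A.d 1 0 x₁) = d.f 0 (z + B.d 1 0 x₂) := by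
        rw [map_sub, ← hzx, f_d_eq, map_add, map_add, f_d_eq]
        abel
      obtain ⟨e, he, -⟩ := exact _ _ _ hs
      exact h₀.cone_eq_zero_iff_zero.2 ⟨e, x₁, by rw [he]; abel⟩
    · obtain ⟨z₀, y₀, h₀, hz, hzy⟩ := cone_exists_cycle_succ t
      have h₁ := h₀.map (coneMap b c w)
      rw [coneMap_apply, ht] at h₁
      obtain ⟨z, x, hz', hx⟩ := h₁.cone_eq_zero_iff.1 rfl
      obtain ⟨x₁, x₂, rfl⟩ := surj _ x
      have hs : c.f _ (y₀ - A.d _ _ x₁) = d.f _ (z + B.d _ _ x₂) := by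
        rw [map_sub, ← hx, f_d_eq, map_add, map_add, f_d_eq]
        abel
      obtain ⟨e, he, he'⟩ := exact _ _ _ hs
      -- The equation -∂e = z₀ in E is tested after `a` and after `b`.
      refine h₀.cone_eq_zero_iff.2 ⟨e, x₁, inj _ _ _ ?_ ?_, by rw [he]; abel⟩
      · rw [map_neg, f_d_eq, he, map_sub, d_d_eq, sub_zero, eq_neg_of_add_eq_zero_left hzy]
      · rw [map_neg, f_d_eq, he', map_add, d_d_eq, add_zero, hz']
  · intro t
    rcases n with _ | n
    · obtain ⟨x, h₀⟩ := cone_exists_cycle_zero t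
      obtain ⟨y, z, rfl⟩ := surj 0 x
      obtain ⟨s, hs⟩ := Represents.exists_class (cone_cycle_zero a (coneInr a 0 y))
      refine ⟨s, ?_⟩
      have h₁ := hs.map (coneMap b c w)
      rw [coneMap_inr] at h₁
      refine h₁.unique (h₀.cone_homologous_zero d z 0 ?_)
      rw [map_zero]
      abel
    · obtain ⟨z, x, h₀, hz, hzx⟩ := cone_exists_cycle_succ t
      obtain ⟨x₁, x₂, rfl⟩ := surj _ x
      -- The splitting of x turns the cycle condition into c(-∂x₁) = d(z + ∂x₂). The common preimage
      -- `e` makes (e, x₁) a cycle, and its image differs from (z, x) by the boundary of x₂.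
      have hs : c.f n (-A.d (n + 1) n x₁) = d.f n (z + B.d (n + 1) n x₂) := by
        rw [map_neg, f_d_eq, neg_eq_iff_add_eq_zero, map_add, f_d_eq, ← hzx, map_add]
        abel
      obtain ⟨e, he, he'⟩ := exact _ _ _ hs
      have hcyc : ∀ m, E.d n m e = 0 := by
        intro m
        by_cases hm : n = m + 1
        · refine inj _ _ _ ?_ ?_
          · rw [f_d_eq, he, map_neg, d_d_eq, neg_zero, map_zero]
          · rw [f_d_eq, he', map_add, hz, d_d_eq, add_zero, map_zero]
        · exact d_eq_zero_of_ne hm _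
      obtain ⟨s, hs⟩ := Represents.exists_class ((cone_cycle_succ a n e x₁).2
        ⟨hcyc, by rw [he, neg_add_cancel]⟩)
      refine ⟨s, ?_⟩
      have h₁ := hs.map (coneMap b c w)
      rw [coneMap_apply] at h₁
      refine h₁.unique (h₀.cone_homologous d x₂ 0 ?_ ?_)
      · rw [he']
        abel
      · rw [map_zero]
        abel

/-- A map of mapping cones induces isomorphisms in homology if both components do. -/
lemma homologyMap_coneMap_bijective (ha : ∀ n, Function.Bijective (homologyMap b n))
    (hb : ∀ n, Function.Bijective (homologyMap c n)) (n : ℕ) :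
    Function.Bijective (homologyMap (coneMap b c w) n) := by
  constructor
  · rw [injective_iff_map_eq_zero]
    intro t ht
    -- Five lemma, injectivity. The E-component of a class in the kernel bounds after `b`, hence
    -- bounds in E, so the class comes from an absolute cycle y of A.
    have key : ∃ y : A.X n, Represents (homotopyCofiber a) n (coneInr a n y) t ∧
        ∀ m, A.d n m y = 0 := by
      rcases n with _ | n
      · obtain ⟨y, h₀⟩ := cone_exists_cycle_zero t
        exact ⟨y, h₀, fun m => d_eq_zero_of_ne (by omega) _⟩
      · obtain ⟨z, y, h₀, hz, hzy⟩ := cone_exists_cycle_succ t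
        obtain ⟨z', hz'⟩ := Represents.exists_class hz
        have h₁ := h₀.map (coneMap b c w)
        rw [coneMap_apply, ht] at h₁
        obtain ⟨s, x, hs, hx⟩ := h₁.cone_eq_zero_iff.1 rfl
        have : z' = 0 := by
          apply (ha n).1
          rw [map_zero]
          exact (hz'.map b).eq_zero_iff.2 ⟨-s, by rw [map_neg, hs]⟩
        obtain ⟨e, he⟩ := hz'.eq_zero_iff.1 this
        refine ⟨y + a.f _ e, ?_, fun m => ?_⟩
        · have := h₀.cone_homologous a (-e) 0 (z₂ := 0) (y₂ := y + a.f _ e) ?_ ?_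
          · rwa [map_zero, zero_add] at this
          · rw [map_neg, he, zero_sub]
          · rw [map_zero, map_neg]
            abel
        · by_cases hm : m = n
          · subst hm
            rw [map_add, ← f_d_eq, he, add_comm, hzy]
          · exact d_eq_zero_of_ne (by omega) _
    obtain ⟨y, h₀, hy⟩ := key
    obtain ⟨y', hy'⟩ := Represents.exists_class hy
    have h₁ := h₀.map (coneMap b c w)
    rw [coneMap_inr, ht] at h₁
    -- The vanishing in the cone of `d` says that c y is homologous to d z for a cycle z of B.
    have key : ∃ (z : B.X n) (x : C.X (n + 1)), (∀ m, B.d n m z = 0) ∧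
        d.f n z + C.d (n + 1) n x = c.f n y := by
      rcases n with _ | n
      · obtain ⟨z, x, h⟩ := h₁.cone_eq_zero_iff_zero.1 rfl
        exact ⟨z, x, fun m => d_eq_zero_of_ne (by omega) _, h⟩
      · rw [← zero_add (coneInr d (n + 1) _), ← map_zero (coneInl d n)] at h₁
        obtain ⟨z, x, h, h'⟩ := h₁.cone_eq_zero_iff.1 rfl
        refine ⟨z, x, fun m => ?_, h'⟩
        by_cases hm : m = n
        · subst hm
          exact neg_eq_zero.1 h
        · exact d_eq_zero_of_ne (by omega) _
    obtain ⟨z, x, hz, hzx⟩ := key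
    obtain ⟨z', hz'⟩ := Represents.exists_class hz
    -- The class of z is lifted to E. Injectivity of the map induced by `c` shows that y is
    -- homologous to the image of this lift, and hence zero in the cone of `a`.
    obtain ⟨e', he'⟩ := (ha n).2 z'
    obtain ⟨e, he⟩ := Represents.exists_cycle e'
    have hy₁ : y' = homologyMap a n e' := by
      apply (hb n).1
      have h₂ := (he.map a).map c
      have h₃ := hz'.map d
      rw [← he', ← ModuleCat.comp_apply, ← homologyMap_comp, w, homologyMap_comp,
        ModuleCat.comp_apply] at h₃
      refine (hy'.map c).unique (h₃.homologous (-x) ?_)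
      rw [← hzx, map_neg]
      abel
    have h₂ := hy'.sub (he.map a)
    rw [← hy₁, sub_self] at h₂
    obtain ⟨v, hv⟩ := h₂.eq_zero_iff.1 rfl
    rcases n with _ | n
    · exact h₀.cone_eq_zero_iff_zero.2 ⟨e, v, by rw [hv]; abel⟩
    · rw [← zero_add (coneInr a (n + 1) _), ← map_zero (coneInl a n)] at h₀
      exact h₀.cone_eq_zero_iff.2 ⟨e, v, by rw [he.d_eq_zero, neg_zero], by rw [hv]; abel⟩
  · intro t
    -- Classes that come from C lift because the map induced by `c` is surjective. The general case
    -- is reduced to this one by correcting the B-component.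
    have lift_inr : ∀ (t : (homotopyCofiber d).homology n) (x : C.X n),
        Represents (homotopyCofiber d) n (coneInr d n x) t → (∀ m, C.d n m x = 0) →
        ∃ s, homologyMap (coneMap b c w) n s = t := by
      intro t x h₀ hx
      obtain ⟨x', hx'⟩ := Represents.exists_class hx
      obtain ⟨y', rfl⟩ := (hb n).2 x'
      refine ⟨homologyMap (homotopyCofiber.inr a) n y', ?_⟩
      obtain ⟨y, hy⟩ := Represents.exists_cycle y'
      have h₁ := (hy.inr a).map (coneMap b c w)
      rw [coneMap_inr] at h₁
      obtain ⟨v, hv⟩ := ((hy.map c).sub hx').eq_zero_iff.1 (sub_self _)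
      refine (h₁.homologous (coneInr d (n + 1) v) ?_).unique h₀
      rw [cone_d_inr, hv, map_sub]
    rcases n with _ | n
    · obtain ⟨x, h₀⟩ := cone_exists_cycle_zero t
      exact lift_inr t x h₀ fun m => d_eq_zero_of_ne (by omega) _
    · obtain ⟨z, x, h₀, hz, hzx⟩ := cone_exists_cycle_succ t
      obtain ⟨z', hz'⟩ := Represents.exists_class hz
      obtain ⟨e', rfl⟩ := (ha n).2 z'
      obtain ⟨e, he⟩ := Represents.exists_cycle e'
      -- The lift to E of the class of z becomes zero in C, because d z bounds there, and so it is
      -- already zero in A. A bounding chain v completes it to the cycle (e, -v) of the cone of `a`.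
      have hae : homologyMap a n e' = 0 := by
        apply (hb n).1
        rw [map_zero, ← ModuleCat.comp_apply, ← homologyMap_comp, ← w, homologyMap_comp,
          ModuleCat.comp_apply]
        refine (hz'.map d).eq_zero_iff.2 ⟨-x, ?_⟩
        rw [map_neg, eq_neg_of_add_eq_zero_left hzx]
      obtain ⟨v, hv⟩ := (he.map a).eq_zero_iff.1 hae
      obtain ⟨s, hs⟩ := Represents.exists_class ((cone_cycle_succ a n e (-v)).2
        ⟨he.d_eq_zero, by rw [map_neg, hv, add_neg_cancel]⟩)
      have h₁ := hs.map (coneMap b c w)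
      rw [coneMap_apply] at h₁
      obtain ⟨z₁, hz₁⟩ := ((he.map b).sub hz').eq_zero_iff.1 (sub_self _)
      have h₂ := h₁.cone_homologous d (-z₁) 0 (z₂ := z) (y₂ := c.f _ (-v) + d.f _ z₁)
        (by rw [map_neg, hz₁]; abel) (by rw [map_zero, map_neg (d.f _).hom]; abel)
      -- Both representatives now have the B-component z, so the difference comes from C.
      have h₃ := h₀.sub h₂
      rw [cone_sub, sub_self, map_zero, zero_add] at h₃
      obtain ⟨s', hs'⟩ := lift_inr _ _ h₃ (fun m => by
        by_cases hm : m = n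
        · subst hm
          rw [map_sub, map_add, ← f_d_eq, ← f_d_eq, map_neg, hv, hz₁, map_neg, map_sub,
            eq_neg_of_add_eq_zero_right hzx]
          have := congrArg (fun g => (g.f m).hom e) w
          have this : d.f m (b.f m e) = c.f m (a.f m e) := this
          rw [this]
          abel
        · exact d_eq_zero_of_ne (by omega) _)
      exact ⟨s' + s, by rw [map_add, hs', sub_add_cancel]⟩

end Comparison

/-! ## Elementary chains -/

section Elementary

variable {k : Type u} [CommRing k] {G H H' : Type u} [Group G] [Group H] [Group H']

/-- The chain `[g₁ | ⋯ | g_n] ⊗ (y ⊗ a)` of `C_*(H; k[Y] ⊗ A)`. -/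
def elemChain (f : H →* G) (Y : Type u) [MulAction H Y] (A : Rep.{u} k G) (n : ℕ) (g : Fin n → H)
    (y : Y) : A.V →ₗ[k] (permChains f Y A).X n :=
  Finsupp.lsingle g ∘ₗ Finsupp.lsingle (M := A.V) y

lemma permChains_hom_ext {f : H →* G} {Y : Type u} [MulAction H Y] {A : Rep.{u} k G} {n : ℕ}
    {M : Type*} [AddCommGroup M] [Module k M] {φ ψ : (permChains f Y A).X n →ₗ[k] M}
    (h : ∀ g y a, φ (elemChain f Y A n g y a) = ψ (elemChain f Y A n g y a)) : φ = ψ :=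
  Finsupp.lhom_ext' fun g => Finsupp.lhom_ext' fun y => LinearMap.ext fun a => h g y a

lemma permChains_induction {f : H →* G} {Y : Type u} [MulAction H Y] {A : Rep.{u} k G} {n : ℕ}
    {p : (permChains f Y A).X n → Prop} (c : (permChains f Y A).X n) (h0 : p 0)
    (hadd : ∀ c c', p c → p c' → p (c + c')) (h : ∀ g y a, p (elemChain f Y A n g y a)) : p c := by
  refine Finsupp.induction_linear (motive := p) c h0 (fun c c' => hadd c c') fun g v => ?_
  refine Finsupp.induction_linear (motive := fun v => p (Finsupp.single g v)) v ?_ ?_ ?_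
  · exact (Finsupp.single_zero (M := Y →₀ A.V) g).symm ▸ h0
  · intro v w hv hw
    rw [Finsupp.single_add]
    exact hadd _ _ hv hw
  · exact fun y a => h g y a

/-- The linear map on the chains of degree `n` with given values on elementary chains. -/
def permChainsLift {f : H →* G} {Y : Type u} [MulAction H Y] {A : Rep.{u} k G} {n : ℕ}
    {M : Type*} [AddCommGroup M] [Module k M] (φ : (Fin n → H) → Y → A.V →ₗ[k] M) :
    (permChains f Y A).X n →ₗ[k] M :=
  Finsupp.lsum k fun g => Finsupp.lsum k fun y => φ g y

lemma permChainsLift_elemChain {f : H →* G} {Y : Type u} [MulAction H Y] {A : Rep.{u} k G} {n : ℕ}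
    {M : Type*} [AddCommGroup M] [Module k M] (φ : (Fin n → H) → Y → A.V →ₗ[k] M) (g : Fin n → H)
    (y : Y) (a : A.V) :
    permChainsLift (f := f) (A := A) φ (elemChain f Y A n g y a) = φ g y a :=
  (Finsupp.lsum_single k _ g _).trans (Finsupp.lsum_single k _ y a)

lemma permChains_d_elemChain (f : H →* G) (Y : Type u) [MulAction H Y] (A : Rep.{u} k G) (n : ℕ)
    (g : Fin (n + 1) → H) (y : Y) (a : A.V) :
    (permChains f Y A).d (n + 1) n (elemChain f Y A (n + 1) g y a) =
      elemChain f Y A n (fun i => g i.succ) ((g 0)⁻¹ • y) (A.ρ (f (g 0))⁻¹ a) +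
        ∑ j : Fin (n + 1), (-1 : k) ^ ((j : ℕ) + 1) •
          elemChain f Y A n (Fin.contractNth j (· * ·) g) y a := by
  have h := groupHomology.inhomogeneousChains.d_single (A := Rep.of (permRep f Y A)) n g
    (Finsupp.single y a)
  rw [Rep.of_ρ, permRep_single, map_inv] at h
  rw [groupHomology.inhomogeneousChains.d_def]
  exact h

lemma permChainsMap_elemChain (f : H →* G) (f' : H' →* G) (h : H →* H') (hf : f'.comp h = f)
    {Y Y' : Type u} [MulAction H Y] [MulAction H' Y'] (q : Y → Y')
    (hq : ∀ (x : H) (y : Y), q (x • y) = h x • q y) (A : Rep.{u} k G) (n : ℕ) (g : Fin n → H)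
    (y : Y) (a : A.V) :
    (permChainsMap f f' h hf q hq A).f n (elemChain f Y A n g y a) =
      elemChain f' Y' A n (h ∘ g) (q y) a := by
  refine (groupHomology.chainsMap_f_single h _ n g _).trans ?_
  change Finsupp.single _ (Finsupp.mapDomain q (Finsupp.single y a)) = _
  rw [Finsupp.mapDomain_single]
  rfl

end Elementary

/-! ## Free coefficients -/

section Free

variable {k : Type u} [CommRing k] {G H H' : Type u} [Group G] [Group H] [Group H']

/-- The representation `k[G] ⊗ A` with the diagonal action. -/
def freeCover (A : Rep.{u} k G) : Rep.{u} k G := Rep.of (permRep (MonoidHom.id G) G A)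

/-- The element `x ⊗ a` of `k[G] ⊗ A`. -/
def freeSingle (A : Rep.{u} k G) (x : G) : A.V →ₗ[k] (freeCover A).V :=
  Finsupp.lsingle (M := A.V) x

/-- The linear map on `k[G] ⊗ A` with given values on the elements `x ⊗ a`. -/
def freeLift (A : Rep.{u} k G) {M : Type*} [AddCommGroup M] [Module k M] (φ : G → A.V →ₗ[k] M) :
    (freeCover A).V →ₗ[k] M :=
  Finsupp.lsum k φ

lemma freeLift_single (A : Rep.{u} k G) {M : Type*} [AddCommGroup M] [Module k M]
    (φ : G → A.V →ₗ[k] M) (x : G) (a : A.V) : freeLift A φ (freeSingle A x a) = φ x a :=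
  Finsupp.lsum_single k _ x a

lemma freeCover_induction {A : Rep.{u} k G} {p : (freeCover A).V → Prop} (v : (freeCover A).V)
    (h0 : p 0) (hadd : ∀ v w, p v → p w → p (v + w)) (h : ∀ x a, p (freeSingle A x a)) : p v :=
  Finsupp.induction_linear (motive := p) v h0 (fun v w => hadd v w) h

lemma freeCover_ρ_single (A : Rep.{u} k G) (g x : G) (a : A.V) :
    (freeCover A).ρ g (freeSingle A x a) = freeSingle A (g * x) (A.ρ g a) :=
  permRep_single (MonoidHom.id G) G A g x a

/-- A map `r : G → H` with `r (f h * x) = h * r x`. -/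
lemma exists_equivariant_retraction (f : H →* G) (hf : Function.Injective f) :
    ∃ r : G → H, ∀ h x, r (f h * x) = h * r x := by
  -- An element times the inverse of the chosen representative of its right coset lies in the image
  -- of H. The representative is unchanged under left multiplication by this image, and so the
  -- resulting map is equivariant.
  have hs (x : G) : ∃ h : H, f h = x * (Quotient.out (s := QuotientGroup.rightRel f.range)
      (Quotient.mk _ x))⁻¹ :=
    QuotientGroup.rightRel_apply.1 (Quotient.mk_out (s := QuotientGroup.rightRel f.range) x)
  choose r hr using hs
  refine ⟨r, fun h x => hf ?_⟩
  have : (Quotient.mk (QuotientGroup.rightRel f.range) (f h * x)) = Quotient.mk _ x :=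
    Quotient.sound (QuotientGroup.rightRel_apply.2 ⟨h⁻¹, by simp⟩)
  rw [hr, this, map_mul, hr, mul_assoc]

lemma contractNth_zero_cons (n : ℕ) (x : H) (g : Fin (n + 1) → H) :
    Fin.contractNth 0 (· * ·) (Fin.cons x g : Fin (n + 2) → H) =
      (Fin.cons (x * g 0) fun i => g i.succ : Fin (n + 1) → H) := by
  ext i
  refine Fin.cases ?_ (fun i => ?_) i
  · rw [Fin.contractNth_apply_of_eq _ _ _ _ rfl]
    rfl
  · rw [Fin.contractNth_apply_of_gt _ _ _ _ (by simp)]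
    rfl

lemma contractNth_succ_cons (n : ℕ) (x : H) (g : Fin (n + 1) → H) (j : Fin (n + 1)) :
    Fin.contractNth j.succ (· * ·) (Fin.cons x g : Fin (n + 2) → H) =
      (Fin.cons x (Fin.contractNth j (· * ·) g) : Fin (n + 1) → H) := by
  ext i
  refine Fin.cases ?_ (fun i => ?_) i
  · rw [Fin.contractNth_apply_of_lt _ _ _ _ (by simp)]
    rfl
  · rw [Fin.cons_succ]
    rcases lt_trichotomy (i : ℕ) j with h | h | h
    · rw [Fin.contractNth_apply_of_lt _ _ _ _ (by simpa using h),
        Fin.contractNth_apply_of_lt _ _ _ _ h]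
      rfl
    · rw [Fin.contractNth_apply_of_eq _ _ _ _ (by simpa using h),
        Fin.contractNth_apply_of_eq _ _ _ _ h]
      rfl
    · rw [Fin.contractNth_apply_of_gt _ _ _ _ (by simpa using h),
        Fin.contractNth_apply_of_gt _ _ _ _ h]
      rfl

/-- The extra degeneracy of `C_*(H; k[Y] ⊗ k[G] ⊗ A)`. -/
def extraDegeneracy (f : H →* G) (Y : Type u) [MulAction H Y] (A : Rep.{u} k G) (r : G → H)
    (n : ℕ) :
    (permChains f Y (freeCover A)).X n →ₗ[k] (permChains f Y (freeCover A)).X (n + 1) :=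
  permChainsLift fun g y => freeLift A fun x =>
    elemChain f Y (freeCover A) (n + 1) (Fin.cons (r x)⁻¹ g) ((r x)⁻¹ • y) ∘ₗ
      (freeCover A).ρ (f (r x)⁻¹) ∘ₗ freeSingle A x

lemma extraDegeneracy_elemChain (f : H →* G) (Y : Type u) [MulAction H Y] (A : Rep.{u} k G)
    (r : G → H) (n : ℕ) (g : Fin n → H) (y : Y) (x : G) (a : A.V) :
    extraDegeneracy f Y A r n (elemChain f Y (freeCover A) n g y (freeSingle A x a)) =
      elemChain f Y (freeCover A) (n + 1) (Fin.cons (r x)⁻¹ g) ((r x)⁻¹ • y)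
        ((freeCover A).ρ (f (r x)⁻¹) (freeSingle A x a)) := by
  rw [extraDegeneracy, permChainsLift_elemChain, freeLift_single]
  rfl

/-- On the summand of x the degeneracy translates by r(x)⁻¹ and prepends r(x)⁻¹. The outer face of
the new chain undoes both and returns the old chain. The face merging the first two entries cancels
the degeneracy of the outer face, and each later face cancels the degeneracy of the preceding face
of the old chain. -/
lemma extraDegeneracy_homotopy (f : H →* G) (Y : Type u) [MulAction H Y] (A : Rep.{u} k G)
    (r : G → H) (hr : ∀ h x, r (f h * x) = h * r x) (n : ℕ)
    (c : (permChains f Y (freeCover A)).X (n + 1)) :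
    (permChains f Y (freeCover A)).d (n + 2) (n + 1) (extraDegeneracy f Y A r (n + 1) c) +
      extraDegeneracy f Y A r n ((permChains f Y (freeCover A)).d (n + 1) n c) = c := by
  refine permChains_induction (p := fun c => (permChains f Y (freeCover A)).d (n + 2) (n + 1)
    (extraDegeneracy f Y A r (n + 1) c) + extraDegeneracy f Y A r n
      ((permChains f Y (freeCover A)).d (n + 1) n c) = c) c ?_ (fun c c' hc hc' => ?_)
    fun g y v => ?_
  · rw [map_zero, map_zero, map_zero, map_zero, add_zero]
  · rw [map_add, map_add, map_add, map_add, add_add_add_comm, hc, hc']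
  refine freeCover_induction (p := fun v => (permChains f Y (freeCover A)).d (n + 2) (n + 1)
    (extraDegeneracy f Y A r (n + 1) (elemChain f Y (freeCover A) (n + 1) g y v)) +
      extraDegeneracy f Y A r n ((permChains f Y (freeCover A)).d (n + 1) n
        (elemChain f Y (freeCover A) (n + 1) g y v)) = elemChain f Y (freeCover A) (n + 1) g y v)
    v ?_ (fun v v' hv hv' => ?_) fun x a => ?_
  · rw [map_zero, map_zero, map_zero, map_zero, map_zero, add_zero]
  · rw [map_add, map_add, map_add, map_add, map_add, add_add_add_comm, hv, hv']
  rw [extraDegeneracy_elemChain, permChains_d_elemChain, permChains_d_elemChain, Fin.sum_univ_succ,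
    map_add, map_sum, freeCover_ρ_single, freeCover_ρ_single, freeCover_ρ_single,
    extraDegeneracy_elemChain, freeCover_ρ_single]
  -- Equivariance of r is used only here. It matches the prepended entries before and after the
  -- outer face.
  have e : r ((f (g 0))⁻¹ * x) = (g 0)⁻¹ * r x := by rw [← map_inv, hr]
  have h₁ : elemChain f Y (freeCover A) (n + 1)
      (fun i => (Fin.cons (r x)⁻¹ g : Fin (n + 2) → H) i.succ)
      (((Fin.cons (r x)⁻¹ g : Fin (n + 2) → H) 0)⁻¹ • (r x)⁻¹ • y)
      (freeSingle A ((f ((Fin.cons (r x)⁻¹ g : Fin (n + 2) → H) 0))⁻¹ * (f (r x)⁻¹ * x))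
        (A.ρ (f ((Fin.cons (r x)⁻¹ g : Fin (n + 2) → H) 0))⁻¹ (A.ρ (f (r x)⁻¹) a))) =
      elemChain f Y (freeCover A) (n + 1) g y (freeSingle A x a) := by
    simp only [Fin.cons_zero, Fin.cons_succ, inv_inv, smul_inv_smul, map_inv, mul_inv_cancel_left,
      Representation.self_inv_apply]
  have h₂ : elemChain f Y (freeCover A) (n + 1)
      (Fin.contractNth 0 (· * ·) (Fin.cons (r x)⁻¹ g : Fin (n + 2) → H)) ((r x)⁻¹ • y)
      (freeSingle A (f (r x)⁻¹ * x) (A.ρ (f (r x)⁻¹) a)) =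
      elemChain f Y (freeCover A) (n + 1)
        (Fin.cons (r ((f (g 0))⁻¹ * x))⁻¹ fun i => g i.succ)
        ((r ((f (g 0))⁻¹ * x))⁻¹ • (g 0)⁻¹ • y)
        (freeSingle A (f (r ((f (g 0))⁻¹ * x))⁻¹ * ((f (g 0))⁻¹ * x))
          (A.ρ (f (r ((f (g 0))⁻¹ * x))⁻¹) (A.ρ (f (g 0))⁻¹ a))) := by
    rw [e, contractNth_zero_cons, mul_inv_rev, inv_inv, smul_smul, mul_inv_cancel_right, map_mul,
      mul_assoc, mul_inv_cancel_left, map_mul, Module.End.mul_apply,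
      Representation.self_inv_apply]
  rw [h₁, h₂, Fin.val_zero, zero_add, pow_one, neg_smul, one_smul]
  have h₃ : ∀ j : Fin (n + 1), (-1 : k) ^ ((j.succ : ℕ) + 1) •
      elemChain f Y (freeCover A) (n + 1)
        (Fin.contractNth j.succ (· * ·) (Fin.cons (r x)⁻¹ g : Fin (n + 2) → H)) ((r x)⁻¹ • y)
        (freeSingle A (f (r x)⁻¹ * x) (A.ρ (f (r x)⁻¹) a)) =
      - extraDegeneracy f Y A r n ((-1 : k) ^ ((j : ℕ) + 1) •
        elemChain f Y (freeCover A) n (Fin.contractNth j (· * ·) g) y (freeSingle A x a)) := by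
    intro j
    rw [map_smul, extraDegeneracy_elemChain, freeCover_ρ_single, contractNth_succ_cons,
      Fin.val_succ, pow_succ _ ((j : ℕ) + 1), mul_neg, mul_one, neg_smul]
  rw [Finset.sum_congr rfl fun j _ => h₃ j, Finset.sum_neg_distrib]
  generalize elemChain f Y (freeCover A) (n + 1)
        (Fin.cons (r ((f (g 0))⁻¹ * x))⁻¹ fun i => g i.succ) _ _ = t
  generalize ∑ j : Fin (n + 1), extraDegeneracy f Y A r n _ = t'
  abel

/-- Over the image of H, the module k[G] ⊗ A is induced from the trivial group, and the extra
degeneracy is an explicit contraction. It says nothing about degree zero, which Shapiro's lemma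
treats separately. -/
lemma homology_freeCover_eq_zero (f : H →* G) (hf : Function.Injective f) (Y : Type u)
    [MulAction H Y] (A : Rep.{u} k G) (n : ℕ)
    (x : (permChains f Y (freeCover A)).homology (n + 1)) : x = 0 := by
  obtain ⟨r, hr⟩ := exists_equivariant_retraction f hf
  obtain ⟨c, hc⟩ := Represents.exists_cycle x
  refine hc.eq_zero_iff.2 ⟨extraDegeneracy f Y A r (n + 1) c, ?_⟩
  have := extraDegeneracy_homotopy f Y A r hr n c
  rwa [hc.d_eq_zero, map_zero, add_zero] at this

end Free

/-! ## Shapiro's lemma -/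

section Shapiro

variable {k : Type u} [CommRing k] {G H H' : Type u} [Group G] [Group H] [Group H']

open HomologicalComplex

/-- The map `q : Y → Y'`, equivariant over `h : H →* H'`, exhibits the `H'`-set `Y'` as
`H' ×_H Y`. -/
structure IsInduced (h : H →* H') {Y Y' : Type u} [MulAction H Y] [MulAction H' Y']
    (q : Y → Y') : Prop where
  orbit : ∀ y', ∃ (x : H') (y : Y), x • q y = y'
  stabilizer : ∀ (x : H') (y₁ y₂ : Y), x • q y₁ = q y₂ → ∃ a, h a = x ∧ a • y₁ = y₂

/-! ### Chains of degree zero modulo boundaries -/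

section DegreeZero

variable (f : H →* G) {Y : Type u} [MulAction H Y] (A : Rep.{u} k G)

/-- The chain `y ⊗ a` of degree zero. -/
def elemChainZero (y : Y) : A.V →ₗ[k] (permChains f Y A).X 0 := elemChain f Y A 0 default y

lemma elemChain_zero_eq (g : Fin 0 → H) (y : Y) (a : A.V) :
    elemChain f Y A 0 g y a = elemChainZero f A y a := by
  rw [elemChainZero, Subsingleton.elim g default]

lemma permChains_d_one (x : H) (y : Y) (a : A.V) :
    (permChains f Y A).d 1 0 (elemChain f Y A 1 (fun _ => x) y a) =
      elemChainZero f A (x⁻¹ • y) (A.ρ (f x)⁻¹ a) - elemChainZero f A y a := by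
  rw [permChains_d_elemChain, Fin.sum_univ_one, elemChain_zero_eq, elemChain_zero_eq,
    Fin.val_zero, zero_add, pow_one, neg_smul, one_smul, sub_eq_add_neg]

/-- The chains of degree zero modulo boundaries. -/
abbrev ZeroChainClasses (f : H →* G) (Y : Type u) [MulAction H Y] (A : Rep.{u} k G) : Type u :=
  (permChains f Y A).X 0 ⧸ LinearMap.range ((permChains f Y A).d 1 0).hom

/-- The class of a chain of degree zero modulo boundaries. -/
def zeroChainClass (f : H →* G) (Y : Type u) [MulAction H Y] (A : Rep.{u} k G) :
    (permChains f Y A).X 0 →ₗ[k] ZeroChainClasses f Y A :=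
  Submodule.mkQ _

lemma zeroChainClass_eq_zero_iff (c : (permChains f Y A).X 0) :
    zeroChainClass f Y A c = 0 ↔ ∃ b, (permChains f Y A).d 1 0 b = c :=
  Submodule.Quotient.mk_eq_zero _

lemma zeroChainClass_smul (x : H) (y : Y) (a : A.V) :
    zeroChainClass f Y A (elemChainZero f A (x • y) (A.ρ (f x) a)) =
      zeroChainClass f Y A (elemChainZero f A y a) := by
  rw [← sub_eq_zero, ← map_sub, zeroChainClass_eq_zero_iff]
  refine ⟨elemChain f Y A 1 (fun _ => x⁻¹) y a, ?_⟩
  have := permChains_d_one f A x⁻¹ y a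
  rwa [inv_inv, map_inv f, inv_inv] at this

end DegreeZero

variable {f : H →* G} {f' : H' →* G} {h : H →* H'} (hf : f'.comp h = f)
  {Y Y' : Type u} [MulAction H Y] [MulAction H' Y'] {q : Y → Y'}
  (hq : ∀ (x : H) (y : Y), q (x • y) = h x • q y) (hi : IsInduced h q) (A : Rep.{u} k G)

include hi

/-- A generator y' ⊗ a with y' = x • q y is homologous, by the one-chain [x], to the image of y ⊗
x⁻¹a. -/
lemma permChainsMap_surjective_zero :
    Function.Surjective (homologyMap (permChainsMap f f' h hf q hq A) 0) := by
  have key (c' : (permChains f' Y' A).X 0) : ∃ (c : (permChains f Y A).X 0)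
      (b : (permChains f' Y' A).X 1), (permChainsMap f f' h hf q hq A).f 0 c - c' =
        (permChains f' Y' A).d 1 0 b := by
    refine permChains_induction (p := fun c' => ∃ (c : (permChains f Y A).X 0)
      (b : (permChains f' Y' A).X 1), (permChainsMap f f' h hf q hq A).f 0 c - c' =
        (permChains f' Y' A).d 1 0 b) c' ⟨0, 0, by rw [map_zero, map_zero, sub_zero]⟩ ?_ ?_
    · rintro c₁ c₂ ⟨d₁, b₁, h₁⟩ ⟨d₂, b₂, h₂⟩
      exact ⟨d₁ + d₂, b₁ + b₂, by rw [map_add, map_add, ← h₁, ← h₂]; abel⟩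
    · intro g y' a
      obtain ⟨x, y, rfl⟩ := hi.orbit y'
      refine ⟨elemChainZero f A y (A.ρ (f' x)⁻¹ a), elemChain f' Y' A 1 (fun _ => x) (x • q y) a, ?_⟩
      rw [permChains_d_one, inv_smul_smul, elemChain_zero_eq, elemChainZero,
        permChainsMap_elemChain, elemChain_zero_eq]
  intro t
  obtain ⟨c', hc'⟩ := Represents.exists_cycle t
  obtain ⟨c, b, hcb⟩ := key c'
  obtain ⟨s, hs⟩ := Represents.exists_class (fun m => d_eq_zero_of_ne (by omega) c)
  exact ⟨s, ((hs.map (permChainsMap f f' h hf q hq A)).homologous b hcb).unique hc'⟩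

/-- There is an inverse modulo boundaries, which sends y' ⊗ a with y' = x • q y to the class of y ⊗
x⁻¹a. -/
lemma permChainsMap_injective_zero :
    Function.Injective (homologyMap (permChainsMap f f' h hf q hq A) 0) := by
  choose x y hxy using hi.orbit
  let Ψ : (permChains f' Y' A).X 0 →ₗ[k] ZeroChainClasses f Y A :=
    permChainsLift (f := f') (A := A) fun _ y' =>
      zeroChainClass f Y A ∘ₗ elemChainZero f A (y y') ∘ₗ A.ρ (f' (x y'))⁻¹
  have hΨ (y' : Y') (a : A.V) : Ψ (elemChainZero f' A y' a) =
      zeroChainClass f Y A (elemChainZero f A (y y') (A.ρ (f' (x y'))⁻¹ a)) :=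
    permChainsLift_elemChain _ _ _ _
  clear_value Ψ
  -- Two presentations of the same point differ by an element of H, by the condition on stabilizers,
  -- and translation by H does not change the class. This independence gives both the vanishing on
  -- boundaries and the inverse property.
  have indep (x₁ x₂ : H') (y₁ y₂ : Y) (a : A.V) (e : x₁ • q y₁ = x₂ • q y₂) :
      zeroChainClass f Y A (elemChainZero f A y₁ (A.ρ (f' x₁)⁻¹ a)) =
        zeroChainClass f Y A (elemChainZero f A y₂ (A.ρ (f' x₂)⁻¹ a)) := by
    obtain ⟨b, hb, rfl⟩ := hi.stabilizer (x₂⁻¹ * x₁) y₁ y₂ (by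
      rw [mul_smul, e, inv_smul_smul])
    have hfb : f b * (f' x₁)⁻¹ = (f' x₂)⁻¹ := by
      rw [← hf, MonoidHom.comp_apply, hb, map_mul, map_inv, mul_inv_cancel_right]
    rw [← zeroChainClass_smul f A b, ← Module.End.mul_apply, ← map_mul, hfb]
  have hΨd (b : (permChains f' Y' A).X 1) : Ψ ((permChains f' Y' A).d 1 0 b) = 0 := by
    refine permChains_induction (p := fun b => Ψ ((permChains f' Y' A).d 1 0 b) = 0) b
      (by rw [map_zero, map_zero]) (fun b b' hb hb' => by rw [map_add, map_add, hb, hb', add_zero])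
      fun g y' a => ?_
    obtain ⟨g, rfl⟩ : ∃ z, g = fun _ => z := ⟨g 0, by ext i; rw [Subsingleton.elim i 0]⟩
    rw [permChains_d_one, map_sub, hΨ, hΨ, sub_eq_zero, ← Module.End.mul_apply, ← map_mul A.ρ,
      ← mul_inv_rev, ← map_mul f']
    refine indep _ _ _ _ _ ?_
    rw [mul_smul, hxy, smul_inv_smul, hxy]
  have hΨf (c : (permChains f Y A).X 0) :
      Ψ ((permChainsMap f f' h hf q hq A).f 0 c) = zeroChainClass f Y A c := by
    refine permChains_induction
      (p := fun c => Ψ ((permChainsMap f f' h hf q hq A).f 0 c) = zeroChainClass f Y A c) c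
      (by rw [map_zero, map_zero, map_zero])
      (fun b b' hb hb' => by rw [map_add, map_add, map_add, hb, hb']) fun g y' a => ?_
    rw [permChainsMap_elemChain, elemChain_zero_eq, elemChain_zero_eq, hΨ,
      indep _ 1 _ y' a (by rw [hxy, one_smul]), map_one, inv_one, map_one]
    rfl
  rw [injective_iff_map_eq_zero]
  intro t ht
  obtain ⟨c, hc⟩ := Represents.exists_cycle t
  have h₁ := hc.map (permChainsMap f f' h hf q hq A)
  rw [ht] at h₁
  obtain ⟨b, hb⟩ := h₁.eq_zero_iff.1 rfl
  have : zeroChainClass f Y A c = 0 := by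
    rw [← hΨf, ← hb, hΨd]
  exact hc.eq_zero_iff.2 ((zeroChainClass_eq_zero_iff f A c).1 this)

/-- In positive degrees both sides vanish for these coefficients. This is the input for dimension
shifting. -/
lemma isIso_permChainsMap_freeCover (hf₁ : Function.Injective f) (hf₂ : Function.Injective f')
    (n : ℕ) : IsIso (homologyMap (permChainsMap f f' h hf q hq (freeCover A)) n) := by
  rw [ConcreteCategory.isIso_iff_bijective]
  rcases n with _ | n
  · exact ⟨permChainsMap_injective_zero hf hq hi _, permChainsMap_surjective_zero hf hq hi _⟩
  · constructor
    · intro x y _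
      rw [homology_freeCover_eq_zero f hf₁ Y A n x, homology_freeCover_eq_zero f hf₁ Y A n y]
    · exact fun x => ⟨0, by rw [map_zero, homology_freeCover_eq_zero f' hf₂ Y' A n x]⟩

omit hi

/-! ### Change of coefficients -/

/-- The chain map induced by a morphism of coefficients. -/
def coefChainsMap (f : H →* G) (Y : Type u) [MulAction H Y] {A B : Rep.{u} k G} (φ : A ⟶ B) :
    permChains f Y A ⟶ permChains f Y B :=
  groupHomology.chainsMap (A := Rep.of (permRep f Y A)) (B := Rep.of (permRep f Y B))
    (MonoidHom.id H) (Rep.ofHom ⟨Finsupp.mapRange.linearMap φ.hom.toLinearMap, by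
      intro x
      refine Finsupp.lhom_ext fun y a => ?_
      have := Rep.hom_comm_apply φ (f x) a
      simp [permRep_single, this]⟩)

lemma coefChainsMap_f (f : H →* G) (Y : Type u) [MulAction H Y] {A B : Rep.{u} k G} (φ : A ⟶ B)
    (n : ℕ) : ((coefChainsMap f Y φ).f n).hom =
      Finsupp.mapRange.linearMap (Finsupp.mapRange.linearMap φ.hom.toLinearMap) :=
  groupHomology.chainsMap_id_f_hom_eq_mapRange n _

lemma coefChainsMap_elemChain (f : H →* G) (Y : Type u) [MulAction H Y] {A B : Rep.{u} k G}
    (φ : A ⟶ B) (n : ℕ) (g : Fin n → H) (y : Y) (a : A.V) :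
    (coefChainsMap f Y φ).f n (elemChain f Y A n g y a) = elemChain f Y B n g y (φ.hom a) := by
  refine (LinearMap.congr_fun (coefChainsMap_f f Y φ n) _).trans ?_
  simp [elemChain]

/-- The surjection `k[G] ⊗ A → A`. -/
def freeCoverπ (A : Rep.{u} k G) : freeCover A ⟶ A :=
  Rep.ofHom (ρ := (freeCover A).ρ) (σ := A.ρ) ⟨freeLift A fun _ => LinearMap.id, by
    intro g
    refine Finsupp.lhom_ext fun x a => ?_
    change freeLift A _ ((freeCover A).ρ g (freeSingle A x a)) =
      A.ρ g (freeLift A _ (freeSingle A x a))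
    rw [freeCover_ρ_single, freeLift_single, freeLift_single]
    rfl⟩

lemma freeCoverπ_surjective (A : Rep.{u} k G) : Function.Surjective (freeCoverπ A).hom :=
  fun a => ⟨freeSingle A 1 a, freeLift_single A _ 1 a⟩

/-- The kernel of the surjection `k[G] ⊗ A → A`. -/
def freeCoverKer (A : Rep.{u} k G) : Rep.{u} k G :=
  Rep.of ((freeCover A).ρ.subrepresentation (LinearMap.ker (freeCoverπ A).hom.toLinearMap) (by
    intro g v hv
    have := Rep.hom_comm_apply (freeCoverπ A) g v
    have hv : (freeCoverπ A).hom v = 0 := hv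
    rw [hv, map_zero] at this
    exact this))

/-- The inclusion of the kernel of `k[G] ⊗ A → A`. -/
def freeCoverι (A : Rep.{u} k G) : freeCoverKer A ⟶ freeCover A :=
  Rep.ofHom (ρ := (freeCoverKer A).ρ) (σ := (freeCover A).ρ)
    ⟨(LinearMap.ker (freeCoverπ A).hom.toLinearMap).subtype, fun _ => rfl⟩

/-- The short exact sequence of complexes induced by `0 → K → k[G] ⊗ A → A → 0`. -/
def coefShortComplex (f : H →* G) (Y : Type u) [MulAction H Y] (A : Rep.{u} k G) :
    ShortComplex (ChainComplex (ModuleCat.{u} k) ℕ) :=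
  ShortComplex.mk (coefChainsMap f Y (freeCoverι A)) (coefChainsMap f Y (freeCoverπ A)) (by
    ext n : 1
    refine ModuleCat.hom_ext (permChains_hom_ext fun g y a => ?_)
    change (coefChainsMap f Y (freeCoverπ A)).f n ((coefChainsMap f Y (freeCoverι A)).f n _) = 0
    rw [coefChainsMap_elemChain, coefChainsMap_elemChain]
    have : (freeCoverπ A).hom ((freeCoverι A).hom a) = 0 := a.2
    rw [this, map_zero])

/-- In every degree the complex consists of finitely supported functions on (Fin n → H) with values
in finitely supported functions Y → A. Forming finitely supported functions is exact, and it is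
applied twice. -/
lemma coefShortComplex_shortExact (f : H →* G) (Y : Type u) [MulAction H Y] (A : Rep.{u} k G) :
    (coefShortComplex f Y A).ShortExact := by
  refine HomologicalComplex.shortExact_of_degreewise_shortExact _ fun n => ?_
  have e₁ : ((coefShortComplex f Y A).map (HomologicalComplex.eval _ _ n)).f.hom =
    Finsupp.mapRange.linearMap (Finsupp.mapRange.linearMap (freeCoverι A).hom.toLinearMap) :=
    coefChainsMap_f f Y (freeCoverι A) n
  have e₂ : ((coefShortComplex f Y A).map (HomologicalComplex.eval _ _ n)).g.hom =
    Finsupp.mapRange.linearMap (Finsupp.mapRange.linearMap (freeCoverπ A).hom.toLinearMap) :=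
    coefChainsMap_f f Y (freeCoverπ A) n
  have hι : Function.Injective (freeCoverι A).hom.toLinearMap := Subtype.val_injective
  have hι' := LinearMap.ker_eq_bot.2 hι
  have hx : LinearMap.range (freeCoverι A).hom.toLinearMap =
      LinearMap.ker (freeCoverπ A).hom.toLinearMap := Submodule.range_subtype _
  refine { exact := ?_, mono_f := ?_, epi_g := ?_ }
  · rw [ShortComplex.moduleCat_exact_iff_range_eq_ker, e₁, e₂]
    have h₁ : LinearMap.ker (Finsupp.mapRange.linearMap (α := Y)
        (freeCoverι A).hom.toLinearMap) = ⊥ :=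
      LinearMap.ker_eq_bot.2 (Finsupp.mapRange_injective _ (map_zero _) hι)
    have h₂ : LinearMap.range (Finsupp.mapRange.linearMap (α := Y)
        (freeCoverι A).hom.toLinearMap) =
        LinearMap.ker (Finsupp.mapRange.linearMap (α := Y) (freeCoverπ A).hom.toLinearMap) := by
      rw [Finsupp.range_mapRange_linearMap _ hι', Finsupp.ker_mapRange, hx]
    have h₃ := Finsupp.range_mapRange_linearMap _ h₁ (Fin n → H)
    have h₄ := Finsupp.ker_mapRange (Finsupp.mapRange.linearMap (α := Y)
      (freeCoverπ A).hom.toLinearMap) (Fin n → H)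
    rw [h₂] at h₃
    exact h₃.trans h₄.symm
  · rw [ModuleCat.mono_iff_injective]
    change Function.Injective (ModuleCat.Hom.hom _)
    rw [e₁]
    exact Finsupp.mapRange_injective _ (map_zero _)
      (Finsupp.mapRange_injective _ (map_zero _) hι)
  · rw [ModuleCat.epi_iff_surjective]
    change Function.Surjective (ModuleCat.Hom.hom _)
    rw [e₂]
    exact Finsupp.mapRange_surjective _ (map_zero _) (Finsupp.mapRange_surjective _ (map_zero _)
      (freeCoverπ_surjective A))

lemma coefChainsMap_permChainsMap {A B : Rep.{u} k G} (φ : A ⟶ B) :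
    permChainsMap f f' h hf q hq A ≫ coefChainsMap f' Y' φ =
      coefChainsMap f Y φ ≫ permChainsMap f f' h hf q hq B := by
  ext n : 1
  refine ModuleCat.hom_ext (permChains_hom_ext fun g y a => ?_)
  change (coefChainsMap f' Y' φ).f n ((permChainsMap f f' h hf q hq A).f n _) =
    (permChainsMap f f' h hf q hq B).f n ((coefChainsMap f Y φ).f n _)
  rw [coefChainsMap_elemChain, permChainsMap_elemChain, permChainsMap_elemChain,
    coefChainsMap_elemChain]

/-- The map of the short exact sequences of coefficients. -/
def coefShortComplexMap : coefShortComplex f Y A ⟶ coefShortComplex f' Y' A where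
  τ₁ := permChainsMap f f' h hf q hq (freeCoverKer A)
  τ₂ := permChainsMap f f' h hf q hq (freeCover A)
  τ₃ := permChainsMap f f' h hf q hq A
  comm₁₂ := coefChainsMap_permChainsMap hf hq _
  comm₂₃ := coefChainsMap_permChainsMap hf hq _

include hi in
/-- Shapiro's lemma for sets with a group action. -/
theorem permChainsMap_bijective (hf₁ : Function.Injective f) (hf₂ : Function.Injective f')
    (n : ℕ) : Function.Bijective (homologyMap (permChainsMap f f' h hf q hq A) n) := by
  rw [← ConcreteCategory.isIso_iff_bijective]
  have free := fun (A : Rep.{u} k G) (n : ℕ) =>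
    isIso_permChainsMap_freeCover hf hq hi A hf₁ hf₂ n
  induction n generalizing A with
  | zero =>
    rw [ConcreteCategory.isIso_iff_bijective]
    exact ⟨permChainsMap_injective_zero hf hq hi _, permChainsMap_surjective_zero hf hq hi _⟩
  | succ n ih =>
    -- Dimension shifting lowers the degree for the kernel coefficients, but bijectivity in degree
    -- `n + 1` also requires surjectivity for the kernel in the same degree. Surjectivity is
    -- therefore proved first, for all coefficients at once; for it the induction hypothesis in
    -- degree `n` suffices.
    have epi (A : Rep.{u} k G) :
        Epi (homologyMap (permChainsMap f f' h hf q hq A) (n + 1)) := by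
      refine HomologySequence.epi_homologyMap_τ₃ (coefShortComplexMap hf hq A)
        (coefShortComplex_shortExact f Y A) (coefShortComplex_shortExact f' Y' A) (n + 1) ?_ ?_ ?_
      · have := free A (n + 1)
        exact inferInstanceAs (Epi (homologyMap (permChainsMap f f' h hf q hq (freeCover A)) _))
      · rintro j hj
        obtain rfl : j = n := by simpa using hj
        have := ih (freeCoverKer A)
        exact inferInstanceAs (Epi (homologyMap (permChainsMap f f' h hf q hq (freeCoverKer A)) _))
      · rintro j -
        have := free A j
        exact inferInstanceAs (Mono (homologyMap (permChainsMap f f' h hf q hq (freeCover A)) _))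
    refine HomologySequence.isIso_homologyMap_τ₃ (coefShortComplexMap hf hq A)
        (coefShortComplex_shortExact f Y A) (coefShortComplex_shortExact f' Y' A) (n + 1) ?_ ?_ ?_ ?_
    · exact epi _
    · exact free A (n + 1)
    · rintro j hj
      obtain rfl : j = n := by simpa using hj
      exact ih _
    · rintro j -
      have := free A j
      exact inferInstanceAs (Mono (homologyMap (permChainsMap f f' h hf q hq (freeCover A)) _))

end Shapiro

/-! ## Maps in relative homology -/

section Cones

variable {k : Type u} [CommRing k]

open HomologicalComplex

lemma coneMap_comp {F F' F'' E E' E'' : ChainComplex (ModuleCat.{u} k) ℕ} {φ : F ⟶ E}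
    {φ' : F' ⟶ E'} {φ'' : F'' ⟶ E''} {a : F ⟶ F'} {b : E ⟶ E'} (w : a ≫ φ' = φ ≫ b)
    {a' : F' ⟶ F''} {b' : E' ⟶ E''} (w' : a' ≫ φ'' = φ' ≫ b') {a'' : F ⟶ F''} {b'' : E ⟶ E''}
    (w'' : a'' ≫ φ'' = φ ≫ b'') (ha : a ≫ a' = a'') (hb : b ≫ b' = b'') :
    coneMap a b w ≫ coneMap a' b' w' = coneMap a'' b'' w'' := by
  subst ha hb
  exact (homotopyCofiber.mapArrowHom_comp φ φ' φ'' (fun j => ⟨j + 1, rfl⟩) (Arrow.homMk a b w)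
    (Arrow.homMk a' b' w')).symm

end Cones

section RelativeMaps

variable {k : Type u} [CommRing k] {G H H' H'' : Type u} [Group G] [Group H] [Group H'] [Group H'']

open HomologicalComplex

lemma permChainsMap_comp {f : H →* G} {f' : H' →* G} {f'' : H'' →* G} {h : H →* H'}
    {h' : H' →* H''} {h'' : H →* H''} (hf : f'.comp h = f) (hf' : f''.comp h' = f')
    (hf'' : f''.comp h'' = f) (hh : h'.comp h = h'') {Y Y' Y'' : Type u} [MulAction H Y]
    [MulAction H' Y'] [MulAction H'' Y''] {q : Y → Y'} {q' : Y' → Y''} {q'' : Y → Y''}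
    (hq : ∀ (x : H) (y : Y), q (x • y) = h x • q y)
    (hq' : ∀ (x : H') (y : Y'), q' (x • y) = h' x • q' y)
    (hq'' : ∀ (x : H) (y : Y), q'' (x • y) = h'' x • q'' y) (hqq : ∀ y, q' (q y) = q'' y)
    (A : Rep.{u} k G) :
    permChainsMap f f' h hf q hq A ≫ permChainsMap f' f'' h' hf' q' hq' A =
      permChainsMap f f'' h'' hf'' q'' hq'' A := by
  ext n : 1
  refine ModuleCat.hom_ext (permChains_hom_ext fun g y a => ?_)
  change (permChainsMap f' f'' h' hf' q' hq' A).f n ((permChainsMap f f' h hf q hq A).f n _) =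
    (permChainsMap f f'' h'' hf'' q'' hq'' A).f n _
  rw [permChainsMap_elemChain, permChainsMap_elemChain, permChainsMap_elemChain, hqq, ← hh]
  rfl

lemma permChainsMap_congr {f : H →* G} {f' : H' →* G} {h : H →* H'} {hf : f'.comp h = f}
    {Y Y' : Type u} [MulAction H Y] [MulAction H' Y'] {q q' : Y → Y'} (e : q = q')
    (hq : ∀ (x : H) (y : Y), q (x • y) = h x • q y)
    (hq' : ∀ (x : H) (y : Y), q' (x • y) = h x • q' y) (A : Rep.{u} k G) :
    permChainsMap f f' h hf q hq A = permChainsMap f f' h hf q' hq' A := by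
  subst e
  rfl

/-- This supplies the hypotheses on `a`, `b`, `c` in the exact sequence of a triple. -/
lemma permChainsMap_id_apply {f : H →* G} {Y : Type u} [MulAction H Y] {q : Y → Y}
    (hq : ∀ (x : H) (y : Y), q (x • y) = MonoidHom.id H x • q y) (hqid : ∀ y, q y = y)
    (A : Rep.{u} k G) (n : ℕ) (c : (permChains f Y A).X n) :
    (permChainsMap f f (MonoidHom.id H) rfl q hq A).f n c = c := by
  refine permChains_induction (p := fun c =>
    (permChainsMap f f (MonoidHom.id H) rfl q hq A).f n c = c) c (map_zero _)
    (fun c c' hc hc' => by rw [map_add, hc, hc']) fun g y a => ?_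
  rw [permChainsMap_elemChain, hqid]
  rfl

lemma permChainsMap_id_f (f : H →* G) {Y Y' : Type u} [MulAction H Y] [MulAction H Y'] {q : Y → Y'}
    (hq : ∀ (x : H) (y : Y), q (x • y) = MonoidHom.id H x • q y) (A : Rep.{u} k G) (n : ℕ) :
    ((permChainsMap f f (MonoidHom.id H) rfl q hq A).f n).hom =
      Finsupp.mapRange.linearMap (Finsupp.lmapDomain A.V k q) :=
  groupHomology.chainsMap_id_f_hom_eq_mapRange n _

lemma relHomologyMap_comp_apply {f : H →* G} {f' : H' →* G} {f'' : H'' →* G} {h : H →* H'}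
    {h' : H' →* H''} {h'' : H →* H''} (hf : f'.comp h = f) (hf' : f''.comp h' = f')
    (hf'' : f''.comp h'' = f) (hh : h'.comp h = h'') {P : ActionPair H} {P' : ActionPair H'}
    {P'' : ActionPair H''} (q : ActionPair.Hom h P P') (q' : ActionPair.Hom h' P' P'')
    (q'' : ActionPair.Hom h'' P P'') (hX : ∀ x, q'.mapX (q.mapX x) = q''.mapX x)
    (hY : ∀ y, q'.mapY (q.mapY y) = q''.mapY y) (A : Rep.{u} k G) (n : ℕ)
    (x : relHomology f P A n) :
    relHomologyMap f' f'' hf' q' A n (relHomologyMap f f' hf q A n x) =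
      relHomologyMap f f'' hf'' q'' A n x := by
  have hcomp : relChainsMap f f' hf q A ≫ relChainsMap f' f'' hf' q' A =
      relChainsMap f f'' hf'' q'' A :=
    coneMap_comp (relChainsMap_comm f f' hf q A) (relChainsMap_comm f' f'' hf' q' A)
      (relChainsMap_comm f f'' hf'' q'' A)
      (permChainsMap_comp hf hf' hf'' hh q.mapY_smul q'.mapY_smul q''.mapY_smul hY A)
      (permChainsMap_comp hf hf' hf'' hh q.mapX_smul q'.mapX_smul q''.mapX_smul hX A)
  have := homologyMap_comp (relChainsMap f f' hf q A) (relChainsMap f' f'' hf' q' A) n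
  rw [hcomp] at this
  exact (congrArg (fun φ => φ.hom x) this).symm

/-- A morphism of pairs whose components are induced sets gives isomorphisms in relative
homology. -/
theorem relHomologyMap_bijective_of_isInduced {f : H →* G} {f' : H' →* G} {h : H →* H'}
    (hf : f'.comp h = f) (hf₁ : Function.Injective f) (hf₂ : Function.Injective f')
    {P : ActionPair H} {P' : ActionPair H'} (q : ActionPair.Hom h P P')
    (hX : IsInduced h q.mapX) (hY : IsInduced h q.mapY) (A : Rep.{u} k G) (n : ℕ) :
    Function.Bijective (relHomologyMap f f' hf q A n) :=
  homologyMap_coneMap_bijective (relChainsMap_comm f f' hf q A)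
    (permChainsMap_bijective hf q.mapY_smul hY A hf₁ hf₂)
    (permChainsMap_bijective hf q.mapX_smul hX A hf₁ hf₂) n

/-- Chains of degree n are finitely supported families, indexed by (Fin n → H), of elements of M[Y].
So a square of sets gives, in every degree, a square of this form. -/
lemma IsBicartesian.finsupp {ι E A B C : Type*} [AddCommGroup E] [AddCommGroup A] [AddCommGroup B]
    [AddCommGroup C] {a : E →+ A} {b : E →+ B} {c : A →+ C} {d : B →+ C}
    (h : IsBicartesian a b c d) :
    IsBicartesian (Finsupp.mapRange.addMonoidHom (ι := ι) a) (Finsupp.mapRange.addMonoidHom b)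
      (Finsupp.mapRange.addMonoidHom c) (Finsupp.mapRange.addMonoidHom d) where
  comm x := by
    ext i
    simp [h.comm]
  inj x ha hb := by
    ext i
    exact h.inj _ (by simpa using DFunLike.congr_fun ha i) (by simpa using DFunLike.congr_fun hb i)
  exact y z hyz := by
    classical
    have hi (i : ι) : ∃ x, a x = y i ∧ b x = z i :=
      h.exact _ _ (by simpa using DFunLike.congr_fun hyz i)
    choose x hxa hxb using hi
    -- The pointwise lifts have finite support because lifts are unique: where y and z vanish, the
    -- lift is killed by both maps.
    refine ⟨Finsupp.onFinset (y.support ∪ z.support) x fun i hi => ?_, ?_, ?_⟩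
    · by_contra hi'
      simp only [Finset.mem_union, Finsupp.mem_support_iff, not_or, not_not] at hi'
      exact hi (h.inj _ ((hxa i).trans hi'.1) ((hxb i).trans hi'.2))
    · ext i
      simp [hxa]
    · ext i
      simp [hxb]
  surj w := by
    classical
    induction w using Finsupp.induction_linear with
    | zero => exact ⟨0, 0, by simp⟩
    | add w w' hw hw' =>
      obtain ⟨y, z, rfl⟩ := hw
      obtain ⟨y', z', rfl⟩ := hw'
      exact ⟨y + y', z + z', by rw [map_add, map_add]; abel⟩
    | single i w =>
      obtain ⟨y, z, rfl⟩ := h.surj w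
      exact ⟨Finsupp.single i y, Finsupp.single i z, by simp⟩

/-- A commutative square of sets is `M`-bicartesian if it becomes bicartesian on passing to the
groups of finite formal sums with coefficients in `M`. -/
def IsSetBicartesian (M : Type*) [AddCommGroup M] {E A B C : Type*} (a : E → A) (b : E → B)
    (c : A → C) (d : B → C) : Prop :=
  IsBicartesian (Finsupp.mapDomain.addMonoidHom (M := M) a) (Finsupp.mapDomain.addMonoidHom b)
    (Finsupp.mapDomain.addMonoidHom c) (Finsupp.mapDomain.addMonoidHom d)

/-- A morphism of pairs of `H`-sets that is a bicartesian square gives isomorphisms in relative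
homology. -/
theorem relHomologyMap_bijective_of_isSetBicartesian (f : H →* G) {P P' : ActionPair H}
    (q : ActionPair.Hom (MonoidHom.id H) P P') (A : Rep.{u} k G)
    (hq : IsSetBicartesian A.V P.proj q.mapY q.mapX P'.proj) (n : ℕ) :
    Function.Bijective (relHomologyMap f f rfl q A n) := by
  refine homologyMap_coneMap_bijective_of_isBicartesian (relChainsMap_comm f f rfl q A)
    (fun n => ?_) n
  -- The four maps of chains are coefficientwise, since the group homomorphism is the identity; the
  -- square is bicartesian degree by degree.
  have h := hq.finsupp (ι := Fin n → H)
  unfold pairChainsMap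
  rw [permChainsMap_id_f, permChainsMap_id_f, permChainsMap_id_f, permChainsMap_id_f]
  exact h

/-! ### The triple of a pair of families -/

section Families

variable (f : H →* G) {I J : Type u} {S : I → Subgroup H} {T : J → Subgroup H}
  (q : FamilyHom (MonoidHom.id H) T S) (A : Rep.{u} k G)

/-- The morphism `(⨆ H / S_i, ⨆ H / T_j) → (pt, ⨆ H / T_j)`. -/
def familyPairTop : ActionPair.Hom (MonoidHom.id H) (familyPair q) (groupPair T) where
  mapX _ := PUnit.unit
  mapY := id
  mapX_smul _ _ := rfl
  mapY_smul _ _ := rfl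
  comm _ := rfl

/-- The boundary map `H_{n+1}(H, S) → H_n(S, T)` of the triple `(H, S, T)`. -/
def familyBoundary (n : ℕ) :
    pairHomology f S A (n + 1) ⟶ relHomology f (familyPair q) A n :=
  tripleBoundary f (groupPair S) (familyPair q) id (fun _ _ => rfl) A n

lemma familyTriple_comm₁ :
    permChainsMap f f (MonoidHom.id H) rfl (familyPairTop q).mapY (familyPairTop q).mapY_smul A ≫
      pairChainsMap f (groupPair T) A =
    pairChainsMap f (familyPair q) A ≫ pairChainsMap f (groupPair S) A :=
  relChainsMap_comm f f rfl (familyPairTop q) A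

lemma familyTriple_comm₂ :
    pairChainsMap f (familyPair q) A ≫ pairChainsMap f (groupPair S) A =
      pairChainsMap f (groupPair T) A ≫
        permChainsMap f f (MonoidHom.id H) rfl q.toPairHom.mapX q.toPairHom.mapX_smul A :=
  relChainsMap_comm f f rfl q.toPairHom A

lemma familyTriple_exact_middle (n : ℕ) :
    Function.Exact (relHomologyMap f f rfl (familyPairTop q) A n)
      (relHomologyMap f f rfl q.toPairHom A n) :=
  triple_exact_middle
    (permChainsMap_id_apply (familyPairTop q).mapY_smul (fun _ => rfl) A)
    (permChainsMap_id_apply q.toPairHom.mapX_smul (fun _ => rfl) A)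
    (familyTriple_comm₁ f q A) (familyTriple_comm₂ f q A) n

lemma familyTriple_exact_right (n : ℕ) :
    Function.Exact (relHomologyMap f f rfl q.toPairHom A (n + 1)) (familyBoundary f q A n) :=
  triple_exact_right
    (permChainsMap_id_apply q.toPairHom.mapX_smul (fun _ => rfl) A)
    (permChainsMap_id_apply (fun _ _ => rfl) (fun _ => rfl) A) (familyTriple_comm₂ f q A) n

lemma familyTriple_exact_left (n : ℕ) :
    Function.Exact (familyBoundary f q A n) (relHomologyMap f f rfl (familyPairTop q) A n) :=
  triple_exact_left
    (permChainsMap_id_apply (familyPairTop q).mapY_smul (fun _ => rfl) A)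
    (permChainsMap_id_apply q.toPairHom.mapX_smul (fun _ => rfl) A)
    (permChainsMap_id_apply (fun _ _ => rfl) (fun _ => rfl) A)
    (familyTriple_comm₁ f q A) (familyTriple_comm₂ f q A) n

lemma familyTriple_surjective_zero :
    Function.Surjective (relHomologyMap f f rfl q.toPairHom A 0) :=
  triple_surjective_zero
    (permChainsMap_id_apply q.toPairHom.mapX_smul (fun _ => rfl) A) (familyTriple_comm₂ f q A)

lemma familyBoundary_naturality {f' : H' →* G} {h : H →* H'} (hf : f'.comp h = f) {I' J' : Type u}
    {S' : I' → Subgroup H'} {T' : J' → Subgroup H'} (q' : FamilyHom (MonoidHom.id H') T' S')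
    (φ : ActionPair.Hom h (familyPair q) (familyPair q'))
    (ψ : ActionPair.Hom h (groupPair S) (groupPair S')) (e : φ.mapX = ψ.mapY) (n : ℕ)
    (t : pairHomology f S A (n + 1)) :
    relHomologyMap f f' hf φ A n (familyBoundary f q A n t) =
      familyBoundary f' q' A n (relHomologyMap f f' hf ψ A (n + 1) t) := by
  have w := relChainsMap_comm f f' hf φ A
  have e' : permChainsMap f f' h hf φ.mapX φ.mapX_smul A =
      permChainsMap f f' h hf ψ.mapY ψ.mapY_smul A := permChainsMap_congr e _ _ A
  exact coneTripleBoundary_naturality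
    (permChainsMap_id_apply (q := id) (fun _ _ => rfl) (fun _ => rfl) A)
    (permChainsMap_id_apply (q := id) (fun _ _ => rfl) (fun _ => rfl) A)
    w (relChainsMap_comm f f' hf ψ A) e' n t

end Families

end RelativeMaps

/-! ## Bicartesian squares -/

namespace IsBicartesian

variable {E A B C A' C' : Type*} [AddCommGroup E] [AddCommGroup A] [AddCommGroup B]
  [AddCommGroup C] [AddCommGroup A'] [AddCommGroup C'] {a : E →+ A} {b : E →+ B} {c : A →+ C}
  {d : B →+ C} {a' : A →+ A'} {c' : A' →+ C'} {d' : C →+ C'}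

lemma transpose (h : IsBicartesian a b c d) : IsBicartesian b a d c where
  comm x := (h.comm x).symm
  inj x hb ha := h.inj x ha hb
  exact z y hzy := by
    obtain ⟨x, hx, hx'⟩ := h.exact y z hzy.symm
    exact ⟨x, hx', hx⟩
  surj w := by
    obtain ⟨y, z, rfl⟩ := h.surj w
    exact ⟨z, y, add_comm _ _⟩

/-- Lift first along the second square, then along the first. -/
lemma paste (h : IsBicartesian a b c d) (h' : IsBicartesian a' c c' d') :
    IsBicartesian (a'.comp a) b c' (d'.comp d) where
  comm x := by
    rw [AddMonoidHom.comp_apply, AddMonoidHom.comp_apply, h'.comm, h.comm]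
  inj x ha hb := h.inj x (h'.inj _ ha (by rw [h.comm, hb, map_zero])) hb
  exact y z hyz := by
    obtain ⟨x, rfl, hx⟩ := h'.exact y (d z) hyz
    obtain ⟨e, rfl, rfl⟩ := h.exact x z hx
    exact ⟨e, rfl, rfl⟩
  surj w := by
    obtain ⟨y, z, rfl⟩ := h'.surj w
    obtain ⟨x, t, rfl⟩ := h.surj z
    refine ⟨y + a' x, t, ?_⟩
    rw [map_add, map_add, h'.comm, AddMonoidHom.comp_apply, add_assoc]

/-- Given compatible y in A' and z in C, write z = c x + d w. Then y - a'x and w are compatible for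
the outer rectangle, and a common preimage e corrects x to x + a e. This produces new squares
without further knowledge of the groups. -/
lemma cancel (h : IsBicartesian a b c d) (h' : IsBicartesian (a'.comp a) b c' (d'.comp d))
    (comm : ∀ x, c' (a' x) = d' (c x)) : IsBicartesian a' c c' d' where
  comm := comm
  inj x ha hc := by
    obtain ⟨e, rfl, he⟩ := h.exact x 0 (by rw [hc, map_zero])
    rw [h'.inj e ha he, map_zero]
  exact y z hyz := by
    obtain ⟨x, w, rfl⟩ := h.surj z
    obtain ⟨e, he, rfl⟩ := h'.exact (y - a' x) w (by
      rw [map_sub, hyz, map_add, comm, add_sub_cancel_left, AddMonoidHom.comp_apply])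
    refine ⟨x + a e, ?_, ?_⟩
    · rw [map_add, show a' (a e) = y - a' x from he, add_sub_cancel]
    · rw [map_add, h.comm]
  surj w := by
    obtain ⟨y, z, rfl⟩ := h'.surj w
    exact ⟨y, d z, rfl⟩

end IsBicartesian

namespace IsSetBicartesian

variable {M : Type u} [AddCommGroup M] {E A B C A' C' : Type u} {a : E → A} {b : E → B} {c : A → C}
  {d : B → C} {a' : A → A'} {c' : A' → C'} {d' : C → C'} {a'' : E → A'} {d'' : B → C'}

lemma transpose (h : IsSetBicartesian M a b c d) : IsSetBicartesian M b a d c :=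
  IsBicartesian.transpose h

lemma paste (h : IsSetBicartesian M a b c d) (h' : IsSetBicartesian M a' c c' d')
    (ha : ∀ x, a' (a x) = a'' x) (hd : ∀ x, d' (d x) = d'' x) :
    IsSetBicartesian M a'' b c' d'' := by
  have := IsBicartesian.paste h h'
  rwa [← Finsupp.mapDomain.addMonoidHom_comp, ← Finsupp.mapDomain.addMonoidHom_comp,
    show a' ∘ a = a'' from funext ha, show d' ∘ d = d'' from funext hd] at this

lemma cancel (h : IsSetBicartesian M a b c d) (h' : IsSetBicartesian M a'' b c' d'')
    (ha : ∀ x, a' (a x) = a'' x) (hd : ∀ x, d' (d x) = d'' x) (comm : ∀ x, c' (a' x) = d' (c x)) :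
    IsSetBicartesian M a' c c' d' := by
  obtain rfl : a' ∘ a = a'' := funext ha
  obtain rfl : d' ∘ d = d'' := funext hd
  unfold IsSetBicartesian at h'
  rw [Finsupp.mapDomain.addMonoidHom_comp, Finsupp.mapDomain.addMonoidHom_comp] at h'
  refine IsBicartesian.cancel h h' fun x => ?_
  simp only [Finsupp.mapDomain.addMonoidHom_apply, ← Finsupp.mapDomain_comp]
  rw [show c' ∘ a' = d' ∘ c from funext comm]

lemma eq_zero (h : IsSetBicartesian M a b c d) (x : E →₀ M) (ha : x.mapDomain a = 0)
    (hb : x.mapDomain b = 0) : x = 0 :=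
  h.inj x ha hb

/-- A pushout square of sets is bicartesian if it is injective on finite formal sums. -/
lemma of_pushout (comm : ∀ x, c (a x) = d (b x))
    (inj : ∀ x : E →₀ M, x.mapDomain a = 0 → x.mapDomain b = 0 → x = 0)
    (pushout : ∀ (N : Type u) (α : A → N) (β : B → N), (∀ x, α (a x) = β (b x)) →
      ∃ γ : C → N, (∀ y, γ (c y) = α y) ∧ ∀ z, γ (d z) = β z)
    (surj : ∀ w, (∃ y, c y = w) ∨ ∃ z, d z = w) : IsSetBicartesian M a b c d where
  comm x := by
    simp only [Finsupp.mapDomain.addMonoidHom_apply, ← Finsupp.mapDomain_comp]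
    rw [show c ∘ a = d ∘ b from funext comm]
  inj := inj
  exact y z hyz := by
    -- The pushout property is tested on N = Hom(M, Q), with Q the cokernel of (a, -b) : M[E] → M[A]
    -- ⊕ M[B]. The tautological maps A → N and B → N agree on E, hence extend to C and give a
    -- homomorphism M[C] → Q. If y and z have the same image in M[C], then (y, 0) and (0, z) agree
    -- in Q, which is the required preimage.
    let δ : (E →₀ M) →+ (A →₀ M) × (B →₀ M) :=
      (Finsupp.mapDomain.addMonoidHom a).prod
        (-(Finsupp.mapDomain.addMonoidHom b : (E →₀ M) →+ (B →₀ M)))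
    let π : (A →₀ M) × (B →₀ M) →+ ((A →₀ M) × (B →₀ M)) ⧸ δ.range := QuotientAddGroup.mk' _
    let α : A → (M →+ ((A →₀ M) × (B →₀ M)) ⧸ δ.range) := fun y =>
      π.comp ((AddMonoidHom.inl _ _).comp (Finsupp.singleAddHom y))
    let β : B → (M →+ ((A →₀ M) × (B →₀ M)) ⧸ δ.range) := fun z =>
      π.comp ((AddMonoidHom.inr _ _).comp (Finsupp.singleAddHom z))
    have hαβ (x : E) : α (a x) = β (b x) := by
      ext m
      change π (Finsupp.single (a x) m, 0) = π (0, Finsupp.single (b x) m)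
      rw [← sub_eq_zero, ← map_sub]
      refine (QuotientAddGroup.eq_zero_iff _).2 ⟨Finsupp.single x m, ?_⟩
      ext <;> simp [δ]
    obtain ⟨γ, hγα, hγβ⟩ := pushout _ α β hαβ
    have h₁ (y : A →₀ M) : Finsupp.liftAddHom γ (y.mapDomain c) = π (y, 0) := by
      induction y using Finsupp.induction_linear with
      | zero =>
        rw [Finsupp.mapDomain_zero, map_zero]
        exact (map_zero π).symm
      | add y y' hy hy' =>
        rw [Finsupp.mapDomain_add, map_add, hy, hy', ← map_add, Prod.mk_add_mk, add_zero]
      | single y m =>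
        rw [Finsupp.mapDomain_single, Finsupp.liftAddHom_apply_single, hγα]
        rfl
    have h₂ (z : B →₀ M) : Finsupp.liftAddHom γ (z.mapDomain d) = π (0, z) := by
      induction z using Finsupp.induction_linear with
      | zero =>
        rw [Finsupp.mapDomain_zero, map_zero]
        exact (map_zero π).symm
      | add y y' hy hy' =>
        rw [Finsupp.mapDomain_add, map_add, hy, hy', ← map_add, Prod.mk_add_mk, add_zero]
      | single y m =>
        rw [Finsupp.mapDomain_single, Finsupp.liftAddHom_apply_single, hγβ]
        rfl
    have h₃ : π (y, 0) = π (0, z) := by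
      rw [← h₁, ← h₂]
      exact congrArg _ hyz
    rw [← sub_eq_zero, ← map_sub] at h₃
    obtain ⟨e, he⟩ := (QuotientAddGroup.eq_zero_iff _).1 h₃
    refine ⟨e, ?_, ?_⟩
    · simpa [δ] using congrArg Prod.fst he
    · simpa [δ] using congrArg Prod.snd he
  surj w := by
    induction w using Finsupp.induction_linear with
    | zero => exact ⟨0, 0, by simp⟩
    | add w w' hw hw' =>
      obtain ⟨y, z, rfl⟩ := hw
      obtain ⟨y', z', rfl⟩ := hw'
      exact ⟨y + y', z + z', by rw [map_add, map_add]; abel⟩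
    | single w m =>
      obtain ⟨y, rfl⟩ | ⟨z, rfl⟩ := surj w
      · exact ⟨Finsupp.single y m, 0, by simp⟩
      · exact ⟨0, Finsupp.single z m, by simp⟩

/-- Adding the same summand to both sides of a map of sets gives a bicartesian square. -/
lemma of_sum {S E' B' : Type u} {f : E → B} {f' : E' → B'} {iE : E → E'} {jE : S → E'} {iB : B → B'}
    {jB : S → B'} (hE : Function.Bijective (Sum.elim iE jE))
    (hB : Function.Bijective (Sum.elim iB jB)) (hi : ∀ e, f' (iE e) = iB (f e))
    (hj : ∀ s, f' (jE s) = jB s) : IsSetBicartesian M iE f f' iB := by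
  refine of_pushout hi (fun x hx _ => ?_) (fun N α β h => ?_) (fun w => ?_)
  · have hinj : Function.Injective iE := fun x y h => by
      simpa using hE.1 (a₁ := Sum.inl x) (a₂ := Sum.inl y) h
    exact Finsupp.mapDomain_injective hinj (hx.trans Finsupp.mapDomain_zero.symm)
  · let e := Equiv.ofBijective _ hB
    have he₁ (z : B) : e.symm (iB z) = Sum.inl z := e.symm_apply_eq.2 rfl
    have he₂ (s : S) : e.symm (jB s) = Sum.inr s := e.symm_apply_eq.2 rfl
    refine ⟨fun w => Sum.elim β (α ∘ jE) (e.symm w), fun y => ?_, fun z => ?_⟩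
    · obtain ⟨x | s, rfl⟩ := hE.2 y
      · simp [hi, he₁, h]
      · simp [hj, he₂]
    · simp [he₁]
  · obtain ⟨z | s, rfl⟩ := hB.2 w
    · exact Or.inr ⟨z, rfl⟩
    · exact Or.inl ⟨jE s, by simp [hj]⟩

/-- The square of `of_sum`, pasted with the desired square, is the given one, so cancellation
applies. -/
lemma add_left (h : IsSetBicartesian M a b c d) {S E' B' : Type u} {iE : E → E'} {jE : S → E'}
    {iB : B → B'} {jB : S → B'} (hE : Function.Bijective (Sum.elim iE jE))
    (hB : Function.Bijective (Sum.elim iB jB)) {f : E' → A} {g : E' → B'} {l : B' → C}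
    (hf : ∀ e, f (iE e) = a e) (hgi : ∀ e, g (iE e) = iB (b e)) (hgj : ∀ s, g (jE s) = jB s)
    (hli : ∀ z, l (iB z) = d z) (hlj : ∀ s, l (jB s) = c (f (jE s)))
    (hcomm : ∀ e, c (a e) = d (b e)) : IsSetBicartesian M f g c l := by
  refine (of_sum hE hB hgi hgj).cancel h hf hli fun x => ?_
  obtain ⟨e | s, rfl⟩ := hE.2 x
  · change c (f (iE e)) = l (g (iE e))
    rw [hf, hgi, hli, hcomm]
  · exact (hlj s).symm.trans (congrArg l (hgj s).symm)

/-- The given square is pasted with the one of `of_sum` that adds the common summand to both B and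
C. -/
lemma add_right (h : IsSetBicartesian M a b c d) {S B' C' : Type u} {iB : B → B'} {jB : S → B'}
    {iC : C → C'} {jC : S → C'} (hB : Function.Bijective (Sum.elim iB jB))
    (hC : Function.Bijective (Sum.elim iC jC)) {g : E → B'} {m : A → C'} {l : B' → C'}
    (hg : ∀ e, iB (b e) = g e) (hm : ∀ y, iC (c y) = m y) (hli : ∀ z, l (iB z) = iC (d z))
    (hlj : ∀ s, l (jB s) = jC s) : IsSetBicartesian M a g m l :=
  (h.transpose.paste (of_sum hB hC hli hlj) hg hm).transpose

end IsSetBicartesian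

/-! ### Injectivity on formal sums from integral retractions -/

section Retraction

variable {M E A B : Type*} [AddCommGroup M]

/-- The homomorphism `M[A] → M[E]` given by a map `A → ℤ[E]`. -/
def finsuppExtend (φ : A → (E →₀ ℤ)) : (A →₀ M) →+ (E →₀ M) :=
  Finsupp.liftAddHom fun y => AddMonoidHom.mk'
    (fun m => Finsupp.mapRange.addMonoidHom (zmultiplesHom M m) (φ y)) (fun m m' => by
      ext e
      simp)

lemma finsuppExtend_single (φ : A → (E →₀ ℤ)) (y : A) (m : M) :
    finsuppExtend φ (Finsupp.single y m) =
      Finsupp.mapRange.addMonoidHom (zmultiplesHom M m) (φ y) :=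
  Finsupp.liftAddHom_apply_single _ _ _

/-- Extended to coefficients in M, the pair (φ, -ψ) is a left inverse of M[E] → M[A] ⊕ M[B]. The
functions φ and ψ will be orbit maps of fixed points of affine actions. -/
lemma eq_zero_of_mapDomain_eq_zero {a : E → A} {b : E → B} (φ : A → (E →₀ ℤ)) (ψ : B → (E →₀ ℤ))
    (h : ∀ e, φ (a e) - ψ (b e) = Finsupp.single e 1) (x : E →₀ M) (ha : x.mapDomain a = 0)
    (hb : x.mapDomain b = 0) : x = 0 := by
  have key : ∀ x : E →₀ M,
      finsuppExtend φ (x.mapDomain a) - finsuppExtend ψ (x.mapDomain b) = x := by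
    intro x
    induction x using Finsupp.induction_linear with
    | zero => simp
    | add y y' hy hy' =>
      conv_rhs => rw [← hy, ← hy']
      rw [Finsupp.mapDomain_add, Finsupp.mapDomain_add, map_add, map_add]
      abel
    | single e m =>
      rw [Finsupp.mapDomain_single, Finsupp.mapDomain_single, finsuppExtend_single,
        finsuppExtend_single, ← map_sub, h]
      simp
  rw [← key x, ha, hb, map_zero, map_zero, sub_zero]

lemma mapDomain_eq_zero_of_comp {C : Type*} {a : E → A} {c : A → C} {c' : E → C}
    (h : ∀ e, c (a e) = c' e) {x : E →₀ M} (hx : x.mapDomain a = 0) : x.mapDomain c' = 0 := by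
  rw [← show c ∘ a = c' from funext h, Finsupp.mapDomain_comp, hx, Finsupp.mapDomain_zero]

end Retraction

/-! ### Squares of coset spaces -/

section Cosets

variable {G : Type u} [Group G] {H K L : Subgroup G}

/-- The projection `G / H → G / K` for `H ≤ K`. -/
abbrev cosetMap (h : H ≤ K) : G ⧸ H → G ⧸ K := Subgroup.quotientMapOfLE h

/-- The elements whose right multiplication leaves x ↦ α(xK) unchanged form a subgroup. It contains
K, and it contains L because the same function is also x ↦ β(xL). So the function descends to the
cosets of the join. -/
lemma cosetMap_pushout (hK : H ≤ K) (hL : H ≤ L) {N : Type*} (α : G ⧸ K → N) (β : G ⧸ L → N)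
    (h : ∀ x, α (cosetMap hK x) = β (cosetMap hL x)) :
    ∃ γ : G ⧸ (K ⊔ L) → N, (∀ y, γ (cosetMap le_sup_left y) = α y) ∧
      ∀ z, γ (cosetMap le_sup_right z) = β z := by
  have hx (x : G) : α (x : G ⧸ K) = β (x : G ⧸ L) := h (x : G ⧸ H)
  let stab : Subgroup G :=
    { carrier := {g | ∀ x : G, α ((x * g : G) : G ⧸ K) = α (x : G ⧸ K)}
      one_mem' := fun x => by rw [mul_one]
      mul_mem' := fun {g g'} hg hg' x => by rw [← mul_assoc, hg', hg]
      inv_mem' := fun {g} hg x => by rw [← hg (x * g⁻¹), inv_mul_cancel_right] }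
  have hstab : K ⊔ L ≤ stab := by
    refine sup_le (fun g hg x => ?_) (fun g hg x => ?_)
    · rw [QuotientGroup.mk_mul_of_mem x hg]
    · rw [hx, hx, QuotientGroup.mk_mul_of_mem x hg]
  refine ⟨fun w => Quotient.liftOn' w (fun x : G => α (x : G ⧸ K)) fun x y hxy => ?_, ?_, ?_⟩
  · have := hstab (QuotientGroup.leftRel_apply.1 hxy) x
    rw [mul_inv_cancel_left] at this
    exact this.symm
  · intro y
    induction y using QuotientGroup.induction_on with
    | H y => rfl
  · intro z
    induction z using QuotientGroup.induction_on with
    | H z => exact hx z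

variable {M : Type u} [AddCommGroup M]

/-- For cosets of a join the pushout property is automatic; only injectivity carries information
about the group. -/
lemma cosetMap_isSetBicartesian {N : Subgroup G} (hK : H ≤ K) (hL : H ≤ L) (hKN : K ≤ N)
    (hLN : L ≤ N) (hN : K ⊔ L = N)
    (inj : ∀ x : G ⧸ H →₀ M, x.mapDomain (cosetMap hK) = 0 → x.mapDomain (cosetMap hL) = 0 →
      x = 0) :
    IsSetBicartesian M (cosetMap hK) (cosetMap hL) (cosetMap hKN) (cosetMap hLN) := by
  subst hN
  refine IsSetBicartesian.of_pushout (fun x => ?_) inj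
    (fun N α β h => cosetMap_pushout hK hL α β h) (fun w => Or.inl ?_)
  · induction x using QuotientGroup.induction_on with
    | H x => rfl
  · induction w using QuotientGroup.induction_on with
    | H w => exact ⟨(w : G ⧸ K), rfl⟩

lemma cosetMap_isSetBicartesian_punit (hK : H ≤ K) (hL : H ≤ L) (hKL : K ⊔ L = ⊤)
    (inj : ∀ x : G ⧸ H →₀ M, x.mapDomain (cosetMap hK) = 0 → x.mapDomain (cosetMap hL) = 0 →
      x = 0) :
    IsSetBicartesian M (cosetMap hK) (cosetMap hL) (fun _ => PUnit.unit.{u + 1})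
      (fun _ => PUnit.unit) := by
  refine IsSetBicartesian.of_pushout (fun _ => rfl) inj (fun N α β h => ?_)
    (fun w => Or.inl ⟨((1 : G) : G ⧸ K), rfl⟩)
  obtain ⟨γ, h₁, h₂⟩ := cosetMap_pushout hK hL α β h
  have : Subsingleton (G ⧸ (K ⊔ L)) := by
    rw [hKL]
    exact QuotientGroup.subsingleton_quotient_top
  refine ⟨fun _ => γ ((1 : G) : G ⧸ (K ⊔ L)), fun y => ?_, fun z => ?_⟩
  · rw [← h₁]
    exact congrArg γ (Subsingleton.elim _ _)
  · rw [← h₂]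
    exact congrArg γ (Subsingleton.elim _ _)

end Cosets

/-! ## Affine actions -/

section Affine

variable {G : Type*} [Group G] {Y Z : Type*} [MulAction G Y]

/-- The action of `G` on `ℤ[Y]`. -/
def finsuppPerm (G Y : Type*) [Group G] [MulAction G Y] : G →* Equiv.Perm (Y →₀ ℤ) :=
  MonoidHom.toHomPerm
    { toFun := fun g => Finsupp.mapDomain (fun y : Y => g • y)
      map_one' := by
        funext z
        simp only [one_smul]
        exact Finsupp.mapDomain_id
      map_mul' := fun g g' => by
        funext z
        simp only [mul_smul]
        exact Finsupp.mapDomain_comp }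

lemma finsuppPerm_single (g : G) (y : Y) (n : ℤ) :
    finsuppPerm G Y g (Finsupp.single y n) = Finsupp.single (g • y) n :=
  Finsupp.mapDomain_single

lemma finsuppPerm_zero (g : G) : finsuppPerm G Y g 0 = 0 :=
  Finsupp.mapDomain_zero (f := fun y : Y => g • y)

lemma finsuppPerm_add (g : G) (z z' : Y →₀ ℤ) :
    finsuppPerm G Y g (z + z') = finsuppPerm G Y g z + finsuppPerm G Y g z' :=
  Finsupp.mapDomain_add

lemma finsuppPerm_neg (g : G) (z : Y →₀ ℤ) :
    finsuppPerm G Y g (-z) = -finsuppPerm G Y g z :=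
  eq_neg_of_add_eq_zero_left (by rw [← finsuppPerm_add, neg_add_cancel, finsuppPerm_zero])

lemma finsuppPerm_sub (g : G) (z z' : Y →₀ ℤ) :
    finsuppPerm G Y g (z - z') = finsuppPerm G Y g z - finsuppPerm G Y g z' := by
  rw [sub_eq_add_neg, sub_eq_add_neg, finsuppPerm_add, finsuppPerm_neg]

lemma finsuppPerm_mul (g g' : G) (z : Y →₀ ℤ) :
    finsuppPerm G Y (g * g') z = finsuppPerm G Y g (finsuppPerm G Y g' z) := by
  rw [map_mul]
  rfl

/-- The map `G / K → Z`, `x K ↦ ρ x p`, for a point `p` fixed by `K`. -/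
def orbitMap (ρ : G → Z → Z) (K : Subgroup G) (p : Z)
    (hp : ∀ x, ∀ a ∈ K, ρ (x * a) p = ρ x p) (y : G ⧸ K) : Z :=
  Quotient.liftOn' y (fun x => ρ x p) fun x y h => by
    have := hp x _ (QuotientGroup.leftRel_apply.1 h)
    rwa [mul_inv_cancel_left, eq_comm] at this

end Affine

/-! ## Paths and functions on coset spaces -/

namespace SubgroupGraph

/-- A system of functions, one for each vertex, that is right invariant under the vertex groups and
compatible along the edges, is transported along paths. This is the analogue for graphs of groups of
the stabilizer argument in `cosetMap_pushout`. -/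
lemma eq_of_isPath {G G' : Type u} [Group G] [Group G'] (Δ : SubgroupGraph G) (f : G →* G')
    {N : Type*} (θ : Δ.V → G' → N) (hv : ∀ v, ∀ a ∈ Δ.vSub v, ∀ x, θ v (x * f a) = θ v x)
    (he : ∀ e x, θ (Δ.src e) (x * f (Δ.srcElt e)) = θ (Δ.tgt e) (x * f (Δ.tgtElt e)))
    {u v : Δ.toGraph.V} {y : Δ.toGraph.Universal} (h : Δ.toGraph.IsPath u v y) (x : G') :
    θ v (x * f (Δ.toGroup y)) = θ u x := by
  have he' (e : Δ.E) (x : G') :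
      θ (Δ.tgt e) (x * f ((Δ.srcElt e)⁻¹ * Δ.tgtElt e)) = θ (Δ.src e) x := by
    rw [map_mul, ← mul_assoc, ← he, mul_assoc, ← map_mul, inv_mul_cancel, map_one, mul_one]
  induction h generalizing x with
  | vert v a =>
    have := Δ.toGroup_vert v a
    rw [this]
    exact hv v a a.2 x
  | edge e =>
    have := Δ.toGroup_edge e
    rw [this]
    exact he' e x
  | edgeInv e =>
    have := Δ.toGroup_edge e
    rw [map_inv, this, map_inv]
    have := he' e (x * (f ((Δ.srcElt e)⁻¹ * Δ.tgtElt e))⁻¹)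
    rwa [inv_mul_cancel_right, eq_comm] at this
  | trans _ _ h₁ h₂ => rw [map_mul, map_mul, ← mul_assoc, h₂, h₁]

end SubgroupGraph

/-! ## The square of an amalgamated free product -/

namespace GluingData

variable (X : GluingData.{u})

lemma emb_injective (i : Bool) : Function.Injective (X.emb i) := fun _ _ h =>
  (X.φ i).injective (Subtype.ext h)

lemma incl_injective (i : Bool) : Function.Injective (X.incl i) :=
  Monoid.PushoutI.of_injective X.emb_injective i

lemma inclU_injective : Function.Injective X.inclU :=
  Monoid.PushoutI.base_injective X.emb_injective

lemma inclU_range_le (i : Bool) : X.inclU.range ≤ (X.incl i).range := by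
  rintro _ ⟨u, rfl⟩
  exact ⟨X.emb i u, X.incl_emb i u⟩

/-- The free abelian group on `G / U`. -/
abbrev ZU : Type u := X.Total ⧸ X.inclU.range →₀ ℤ

/-- Let G_1 act linearly on ℤ[G/U], and let G_2 act by the linear action conjugated by a
translation, so that it fixes -[U] instead of 0. The two actions agree on U because U fixes the
coset [U], and so they define an affine action of the amalgam, again with the permutation action as
linear part. -/
lemma exists_affine : ∃ ρ : X.Total →* Equiv.Perm X.ZU,
    (∀ g, ρ (X.incl false g) 0 = 0) ∧
    (∀ g, ρ (X.incl true g) (-Finsupp.single ((1 : X.Total) : X.Total ⧸ X.inclU.range) 1) =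
      -Finsupp.single ((1 : X.Total) : X.Total ⧸ X.inclU.range) 1) ∧
    ∀ g z z', ρ g z - ρ g z' = finsuppPerm X.Total _ g (z - z') := by
  let s : X.ZU := Finsupp.single ((1 : X.Total) : X.Total ⧸ X.inclU.range) 1
  let π := finsuppPerm X.Total (X.Total ⧸ X.inclU.range)
  let f : ∀ i, X.G i →* Equiv.Perm X.ZU := fun i => match i with
    | false => π.comp (X.incl false)
    | true => (MulAut.conj (Equiv.addLeft (-s))).toMonoidHom.comp (π.comp (X.incl true))
  have hf₂ (g : X.G true) (z : X.ZU) : f true g z = -s + π (X.incl true g) (s + z) := by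
    change -s + π (X.incl true g) ((Equiv.addLeft (-s))⁻¹ z) = _
    congr 2
    rw [Equiv.Perm.inv_eq_iff_eq]
    exact (neg_add_cancel_left s z).symm
  have hs (u : X.U) : π (X.inclU u) s = s := by
    refine (finsuppPerm_single _ _ _).trans ?_
    congr 1
    refine QuotientGroup.eq.2 ?_
    simp
  have hf (i : Bool) : (f i).comp (X.emb i) = π.comp X.inclU := by
    ext u z : 2
    cases i
    · change π (X.incl false (X.emb false u)) z = π (X.inclU u) z
      rw [X.incl_emb]
    · rw [MonoidHom.comp_apply, hf₂, X.incl_emb, finsuppPerm_add, hs, neg_add_cancel_left]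
      rfl
  have h₁ (g : X.G false) : Monoid.PushoutI.lift f _ hf (X.incl false g) =
    π (X.incl false g) := Monoid.PushoutI.lift_of f _ hf g
  have h₂ (g : X.G true) : Monoid.PushoutI.lift f _ hf (X.incl true g) = f true g :=
    Monoid.PushoutI.lift_of f _ hf g
  refine ⟨Monoid.PushoutI.lift f _ hf, fun g => ?_, fun g => ?_, fun g => ?_⟩
  · rw [h₁]
    exact finsuppPerm_zero _
  · rw [h₂, hf₂]
    change -s + π _ (s + -s) = -s
    rw [add_neg_cancel, finsuppPerm_zero, add_zero]
  · induction g using Monoid.PushoutI.induction_on with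
    | of i g =>
      intro z z'
      cases i
      · rw [h₁]
        exact (finsuppPerm_sub _ z z').symm
      · rw [h₂, hf₂, hf₂, finsuppPerm_add, finsuppPerm_add, finsuppPerm_sub]
        abel
    | base u =>
      intro z z'
      rw [Monoid.PushoutI.lift_base]
      exact (finsuppPerm_sub _ z z').symm
    | mul x y hx hy =>
      intro z z'
      rw [map_mul, Equiv.Perm.mul_apply, Equiv.Perm.mul_apply, hx, hy, finsuppPerm_mul]

variable {M : Type u} [AddCommGroup M]

/-- The retraction sends xG_1 to ρ(x)0 and xG_2 to ρ(x)(-[U]). The difference of these points is the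
linear part of x applied to [U], which is [xU]. -/
lemma eq_zero_of_mapDomain_range (x : X.Total ⧸ X.inclU.range →₀ M)
    (h₁ : x.mapDomain (cosetMap (X.inclU_range_le false)) = 0)
    (h₂ : x.mapDomain (cosetMap (X.inclU_range_le true)) = 0) : x = 0 := by
  obtain ⟨ρ, hρ₁, hρ₂, hρ⟩ := X.exists_affine
  refine eq_zero_of_mapDomain_eq_zero
    (orbitMap (fun x z => ρ x z) _ 0 ?_)
    (orbitMap (fun x z => ρ x z) _
      (-Finsupp.single ((1 : X.Total) : X.Total ⧸ X.inclU.range) 1) ?_) ?_ x h₁ h₂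
  · rintro x _ ⟨g, rfl⟩
    rw [map_mul, Equiv.Perm.mul_apply, hρ₁]
  · rintro x _ ⟨g, rfl⟩
    rw [map_mul, Equiv.Perm.mul_apply, hρ₂]
  · intro e
    induction e using QuotientGroup.induction_on with
    | H g =>
      refine (hρ g _ _).trans ?_
      rw [zero_sub, neg_neg, finsuppPerm_single]
      congr 1
      exact congrArg (fun x : X.Total => (x : X.Total ⧸ X.inclU.range)) (mul_one g)

lemma range_sup_range (i : Bool) : (X.incl i).range ⊔ (X.incl (!i)).range = ⊤ := by
  rw [eq_top_iff]
  intro g _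
  induction g using Monoid.PushoutI.induction_on with
  | of j g =>
    by_cases h : j = i
    · subst h
      exact Subgroup.mem_sup_left ⟨g, rfl⟩
    · obtain rfl : j = !i := by cases i <;> cases j <;> simp_all
      exact Subgroup.mem_sup_right ⟨g, rfl⟩
  | base u => exact Subgroup.mem_sup_left (X.inclU_range_le i ⟨u, rfl⟩)
  | mul x y hx hy => exact mul_mem (hx trivial) (hy trivial)

/-- The square `G / U → G / G_i`, `G / G_{i'} → pt`. -/
lemma isSetBicartesian_amalgam (i : Bool) :
    IsSetBicartesian M (cosetMap (X.inclU_range_le i)) (cosetMap (X.inclU_range_le !i))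
      (fun _ => PUnit.unit.{u + 1}) (fun _ => PUnit.unit) :=
  cosetMap_isSetBicartesian_punit _ _ (X.range_sup_range i) fun x h₁ h₂ => by
    cases i
    · exact X.eq_zero_of_mapDomain_range x h₁ h₂
    · exact X.eq_zero_of_mapDomain_range x h₂ h₁

end GluingData

/-! ## The square of a star of subgroups -/

/-- The projection `⨆ G / S_j → G / K` for subgroups `S_j ≤ K`. -/
def cosetSetMap {G J : Type u} [Group G] {S : J → Subgroup G} {K : Subgroup G}
    (h : ∀ j, S j ≤ K) (y : CosetSet S) : G ⧸ K :=
  cosetMap (h y.1) y.2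

namespace AmalgamSubgroup

variable {G G' : Type u} [Group G] [Group G'] {J : Type u} (D : AmalgamSubgroup G J) (h : G →* G')
  {P' : J → Subgroup G'} (hP : ∀ j, P' j = (D.P j).map h) {U' : Subgroup G'} (hU : U' = D.U.map h)

/-- The map `⨆ G' / P_j → ⨆ G' / W_k`, `x P_j ↦ x t_j W_{κ j}`. -/
def edgeHom : FamilyHom (MonoidHom.id G') P' (fun k => (D.W k).map h) where
  idx := D.κ
  c j := h (D.t j)
  mem := by
    intro j _ hs
    rw [hP] at hs
    obtain ⟨p, hp, rfl⟩ := hs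
    exact ⟨_, D.conj_mem j p hp, by simp⟩

include hP hU in
lemma edge_le (j : J) : P' j ≤ U' := by
  rw [hP, hU]
  exact Subgroup.map_mono (D.P_le j)

include hU in
lemma center_le : U' ≤ D.total.map h := by
  rw [hU]
  exact Subgroup.map_mono D.U_le

lemma leaf_le (k : D.K) : (D.W k).map h ≤ D.total.map h :=
  Subgroup.map_mono (D.W_le k)

-- The vertex groups act linearly, and the edge j acts by t_j followed by translation by the coset
-- [P_j]. The relations of the universal group hold because P_j fixes [P_j]. Thus every vertex group
-- fixes 0, and the edge j carries 0 to [P_j].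
include hP in
lemma exists_affine : ∃ ρ : D.graph.toGraph.Universal →* Equiv.Perm (CosetSet P' →₀ ℤ),
    (∀ v a, ρ (D.graph.toGraph.vert v a) 0 = 0) ∧
    (∀ j, ρ (D.graph.toGraph.edge j) 0 = Finsupp.single ⟨j, ((1 : G') : G' ⧸ P' j)⟩ 1) ∧
    ∀ {u v y}, D.graph.toGraph.IsPath u v y → ∀ z z', ρ y z - ρ y z' =
      finsuppPerm G' _ (h (D.graph.toGroup y)) (z - z') := by
  let π := finsuppPerm G' (CosetSet P')
  let s : J → (CosetSet P' →₀ ℤ) := fun j => Finsupp.single ⟨j, ((1 : G') : G' ⧸ P' j)⟩ 1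
  have hs (j : J) (b : G) (hb : b ∈ D.P j) : π (h b) (s j) = s j := by
    refine (finsuppPerm_single _ _ _).trans ?_
    congr 1
    refine congrArg (Sigma.mk j) (QuotientGroup.eq.2 ?_)
    change (h b * 1)⁻¹ * 1 ∈ P' j
    rw [mul_one, mul_one, inv_mem_iff, hP]
    exact ⟨b, hb, rfl⟩
  let α : ∀ v, D.graph.toGraph.vGrp v →* Equiv.Perm (CosetSet P' →₀ ℤ) := fun v =>
    (π.comp h).comp (D.graph.vSub v).subtype
  let ε : D.graph.toGraph.E → Equiv.Perm (CosetSet P' →₀ ℤ) := fun j =>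
    Equiv.addLeft (s j) * π (h (D.t j))
  have hα (v a z) : α v a z = π (h a.1) z := rfl
  have hε (j z) : ε j z = s j + π (h (D.t j)) z := rfl
  have rel (j : D.graph.toGraph.E) (b : D.graph.toGraph.eGrp j) :
      ε j * α _ (D.graph.toGraph.tgtHom j b) * (ε j)⁻¹ = α _ (D.graph.toGraph.srcHom j b) := by
    rw [mul_inv_eq_iff_eq_mul]
    ext1 z
    change s j + π (h (D.t j)) (π (h ((D.t j)⁻¹ * b.1 * D.t j)) z) =
      π (h ((1 : G)⁻¹ * b.1 * 1)) (s j + π (h (D.t j)) z)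
    rw [inv_one, one_mul, mul_one, finsuppPerm_add, hs j b.1 b.2, ← finsuppPerm_mul,
      ← finsuppPerm_mul, ← map_mul, ← map_mul, mul_assoc, mul_inv_cancel_left]
  have hvert (v a) : D.graph.toGraph.lift α ε rel (D.graph.toGraph.vert v a) = α v a :=
    D.graph.toGraph.lift_vert α ε rel v a
  have hedge (j) : D.graph.toGraph.lift α ε rel (D.graph.toGraph.edge j) = ε j :=
    D.graph.toGraph.lift_edge α ε rel j
  refine ⟨D.graph.toGraph.lift α ε rel, fun v a => ?_, fun j => ?_, fun {u v y} hy => ?_⟩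
  · rw [hvert]
    exact finsuppPerm_zero _
  · rw [hedge, hε, finsuppPerm_zero, add_zero]
  · have edge (j : D.graph.toGraph.E) (z z') : ε j z - ε j z' =
        π (h (D.graph.toGroup (D.graph.toGraph.edge j))) (z - z') := by
      have := D.graph.toGroup_edge j
      rw [this, hε, hε, add_sub_add_left_eq_sub, finsuppPerm_sub]
      change _ = π (h ((1 : G)⁻¹ * D.t j)) z - π (h ((1 : G)⁻¹ * D.t j)) z'
      rw [inv_one, one_mul]
    induction hy with
    | vert v a =>
      intro z z'
      have := D.graph.toGroup_vert v a
      rw [this, hvert]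
      exact (finsuppPerm_sub _ z z').symm
    | edge j =>
      intro z z'
      rw [hedge]
      exact edge j z z'
    | edgeInv j =>
      intro z z'
      rw [map_inv, hedge, map_inv, map_inv, map_inv]
      have := edge j ((ε j).symm z) ((ε j).symm z')
      rw [(ε j).apply_symm_apply, (ε j).apply_symm_apply] at this
      rw [this]
      exact (Equiv.symm_apply_apply _ _).symm
    | trans _ _ h₁ h₂ =>
      intro z z'
      rw [map_mul, Equiv.Perm.mul_apply, Equiv.Perm.mul_apply, h₁, h₂, map_mul, map_mul,
        finsuppPerm_mul]

include hP in
/-- The affine action of `U *_{∂U} W` on the free abelian group on `⨆ G' / P_j`, extended to `G'`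
along a transversal. -/
lemma exists_affine_extension (hh : Function.Injective h) :
    ∃ ρ : G' → (CosetSet P' →₀ ℤ) → (CosetSet P' →₀ ℤ),
      (∀ x z z', ρ x z - ρ x z' = finsuppPerm G' _ x (z - z')) ∧
      (∀ x, ∀ a ∈ D.U, ρ (x * h a) 0 = ρ x 0) ∧
      (∀ x k, ∀ a ∈ D.W k, ρ (x * h a) (Finsupp.single ⟨D.root k, ((1 : G') : G' ⧸ _)⟩ 1) =
        ρ x (Finsupp.single ⟨D.root k, ((1 : G') : G' ⧸ _)⟩ 1)) ∧
      ∀ x j, ρ (x * h (D.t j)) (Finsupp.single ⟨D.root (D.κ j), ((1 : G') : G' ⧸ _)⟩ 1) =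
        ρ x (Finsupp.single ⟨j, ((1 : G') : G' ⧸ _)⟩ 1) := by
  obtain ⟨σ, hσv, hσe, hσ⟩ := D.exists_affine h hP
  have hr (x : G') : ((Quotient.out (x : G' ⧸ D.total.map h))⁻¹ * x) ∈ D.total.map h :=
    QuotientGroup.eq.1 (QuotientGroup.out_eq' (x : G' ⧸ D.total.map h))
  have hl (x : G') : ∃ y, D.graph.toGraph.IsPath (none : Option D.K) (none : Option D.K) y ∧
      h (D.graph.toGroup y) = (Quotient.out (x : G' ⧸ D.total.map h))⁻¹ * x := by
    obtain ⟨_, ⟨y, hy, rfl⟩, hy'⟩ := hr x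
    exact ⟨y, hy, hy'⟩
  choose l hl hlx using hl
  -- By `faithful` the lift of an element of the subgroup to the fundamental group is unique. So
  -- right multiplication by such an element leaves the coset representative fixed and multiplies
  -- the lift `l` by a loop.
  have key (x : G') {y} (hy : D.graph.toGraph.IsPath (none : Option D.K) (none : Option D.K) y) :
      finsuppPerm G' (CosetSet P') (Quotient.out
        ((x * h (D.graph.toGroup y) : G') : G' ⧸ D.total.map h)) =
        finsuppPerm G' (CosetSet P') (Quotient.out (x : G' ⧸ D.total.map h)) ∧
      l (x * h (D.graph.toGroup y)) = l x * y := by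
    have hx : ((x * h (D.graph.toGroup y) : G') : G' ⧸ D.total.map h) = x :=
      QuotientGroup.mk_mul_of_mem x ⟨_, ⟨y, hy, rfl⟩, rfl⟩
    refine ⟨by rw [hx], D.faithful (hl _) ((hl x).trans hy) (hh ?_)⟩
    rw [hlx, hx, map_mul, map_mul, hlx, mul_assoc]
  have hpath (x : G') {y} (hy : D.graph.toGraph.IsPath (none : Option D.K) (none : Option D.K) y)
      (x' : G') (hx' : x' = x * h (D.graph.toGroup y)) (z : CosetSet P' →₀ ℤ) :
      finsuppPerm G' (CosetSet P') (Quotient.out (x' : G' ⧸ D.total.map h)) (σ (l x') z) =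
      finsuppPerm G' (CosetSet P') (Quotient.out (x : G' ⧸ D.total.map h)) (σ (l x) (σ y z)) := by
    rw [hx', (key x hy).1, (key x hy).2, map_mul, Equiv.Perm.mul_apply]
  -- The edges of the maximal tree lead from the centre to the leaves. They map to 1 in G, and so a
  -- loop may run through them at no cost.
  have e1 (k : D.K) : D.graph.toGraph.IsPath (none : Option D.K) (some k)
      (D.graph.toGraph.edge (D.root k)) := by
    have := GraphOfGroups.IsPath.edge (Γ := D.graph.toGraph) (D.root k)
    have ht : D.graph.toGraph.tgt (D.root k) = some k := congrArg some (D.κ_root k)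
    rwa [ht] at this
  have e1g (k : D.K) : D.graph.toGroup (D.graph.toGraph.edge (D.root k)) = 1 := by
    refine (D.graph.toGroup_edge (D.root k)).trans ?_
    change (1 : G)⁻¹ * D.t (D.root k) = 1
    rw [D.t_root, inv_one, one_mul]
  have hinv (p : Equiv.Perm (CosetSet P' →₀ ℤ)) (z) : p⁻¹ (p z) = z := p.symm_apply_apply z
  -- The element x acts by the affine action of its lift `l x`, followed by the linear action of its
  -- coset representative.
  refine ⟨fun x z => finsuppPerm G' (CosetSet P') (Quotient.out (x : G' ⧸ D.total.map h))
    (σ (l x) z), fun x z z' => ?_, fun x a ha => ?_, fun x k a ha => ?_, fun x j => ?_⟩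
  · rw [← finsuppPerm_sub, hσ (hl x), hlx, ← finsuppPerm_mul, mul_inv_cancel_left]
  · obtain ⟨w, rfl⟩ : ∃ w : D.graph.vSub (none : Option D.K), (w : G) = a := ⟨⟨a, ha⟩, rfl⟩
    have hg := D.graph.toGroup_vert (none : Option D.K) w
    refine (hpath x (GraphOfGroups.IsPath.vert (Γ := D.graph.toGraph) (none : Option D.K) w) _
      (by rw [hg]) 0).trans ?_
    rw [hσv]
  · obtain ⟨w, rfl⟩ : ∃ w : D.graph.vSub (some k : Option D.K), (w : G) = a := ⟨⟨a, ha⟩, rfl⟩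
    have hg := D.graph.toGroup_vert (some k : Option D.K) w
    -- The point [P_{root k}] is the image of 0 under the edge `root k`. An element of W_k,
    -- conjugated to the centre along this edge, fixes this point because it fixes 0 at the leaf.
    have hy := ((e1 k).trans (GraphOfGroups.IsPath.vert (Γ := D.graph.toGraph)
      (some k : Option D.K) w)).trans (e1 k).inv
    refine (hpath x hy _ ?_ _).trans ?_
    · rw [map_mul, map_mul, map_inv, map_mul, e1g, hg, one_mul, inv_one, map_one, mul_one]
    · rw [map_mul, map_mul, map_inv, ← hσe, Equiv.Perm.mul_apply, Equiv.Perm.mul_apply, hinv, hσv]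
  · have hy := (GraphOfGroups.IsPath.edge (Γ := D.graph.toGraph) j).trans (e1 (D.κ j)).inv
    refine (hpath x hy _ ?_ _).trans ?_
    · have := D.graph.toGroup_edge j
      rw [map_mul, map_inv, e1g, inv_one, mul_one, this]
      change _ = x * h ((1 : G)⁻¹ * D.t j)
      rw [inv_one, one_mul]
    · rw [map_mul, map_inv, ← hσe, Equiv.Perm.mul_apply, hinv, hσe]

variable {M : Type u} [AddCommGroup M]

/-- The retraction sends xU to ρ(x)0 and xW_k to ρ(x)[P_{root k}]. At the edge xP_j the second is
evaluated on x t_j W_{κ j} and gives ρ(x)[P_j], so the difference is [xP_j]. -/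
lemma eq_zero_of_mapDomain (hh : Function.Injective h) (x : CosetSet P' →₀ M)
    (h₁ : x.mapDomain (cosetSetMap (D.edge_le h hP hU)) = 0)
    (h₂ : x.mapDomain (D.edgeHom h hP).map = 0) : x = 0 := by
  obtain ⟨ρ, hρ, hρU, hρW, hρt⟩ := D.exists_affine_extension h hP hh
  refine eq_zero_of_mapDomain_eq_zero (b := cosetSetMap (D.edge_le h hP hU))
    (fun y : CosetSet (fun k => (D.W k).map h) => orbitMap ρ _
      (Finsupp.single ⟨D.root y.1, ((1 : G') : G' ⧸ _)⟩ 1) ?_ y.2)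
    (orbitMap ρ U' 0 ?_) ?_ x h₂ h₁
  · rintro x _ ⟨a, ha, rfl⟩
    exact hρW x y.1 a ha
  · intro x a ha
    rw [hU] at ha
    obtain ⟨a, ha, rfl⟩ := ha
    exact hρU x a ha
  · rintro ⟨j, x⟩
    induction x using QuotientGroup.induction_on with
    | H x =>
      refine (congrArg (· - ρ x 0) (hρt x j)).trans ?_
      rw [hρ, sub_zero, finsuppPerm_single]
      congr 1
      exact congrArg (fun x : G' => (⟨j, (x : G' ⧸ P' j)⟩ : CosetSet P')) (mul_one x)

/-- The square `⨆ G' / P_j → G' / U`, `⨆ G' / W_k → G' / (U *_{∂U} W)`. -/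
lemma isSetBicartesian_star (hh : Function.Injective h) :
    IsSetBicartesian M (cosetSetMap (D.edge_le h hP hU)) (D.edgeHom h hP).map
      (cosetMap (D.center_le h hU)) (cosetSetMap (D.leaf_le h)) := by
  refine IsSetBicartesian.of_pushout ?_ (D.eq_zero_of_mapDomain h hP hU hh) ?_ ?_
  · rintro ⟨j, x⟩
    induction x using QuotientGroup.induction_on with
    | H x => exact (QuotientGroup.mk_mul_of_mem x (Subgroup.mem_map_of_mem h (D.t_mem j))).symm
  · intro N α β hαβ
    -- The functions α and β become one system on the vertices. Transport along loops at the centre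
    -- shows that α is right invariant under the image of the fundamental group.
    let θ : D.graph.V → G' → N := fun v => match v with
      | none => fun x => α (x : G' ⧸ U')
      | some k => fun x => β ⟨k, (x : G' ⧸ (D.W k).map h)⟩
    have hθ : ∀ {u v : D.graph.toGraph.V} {y}, D.graph.toGraph.IsPath u v y → ∀ x,
        θ v (x * h (D.graph.toGroup y)) = θ u x := by
      refine D.graph.eq_of_isPath h θ (fun v a ha x => ?_) fun e x => ?_
      · match v with
        | none =>
          refine congrArg α (QuotientGroup.mk_mul_of_mem x ?_)
          rw [hU]
          exact ⟨a, ha, rfl⟩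
        | some k =>
          exact congrArg (fun x => β ⟨k, x⟩) (QuotientGroup.mk_mul_of_mem x ⟨a, ha, rfl⟩)
      · change α ((x * h 1 : G') : G' ⧸ U') = _
        rw [map_one, mul_one]
        exact hαβ ⟨e, (x : G' ⧸ P' e)⟩
    refine ⟨fun w => Quotient.liftOn' w (θ (none : Option D.K)) fun x y hxy => ?_, ?_, ?_⟩
    · obtain ⟨_, ⟨p, hp, rfl⟩, hxy⟩ := QuotientGroup.leftRel_apply.1 hxy
      have := hθ hp x
      rwa [hxy, mul_inv_cancel_left, eq_comm] at this
    · intro y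
      induction y using QuotientGroup.induction_on with
      | H y => rfl
    · rintro ⟨k, z⟩
      induction z using QuotientGroup.induction_on with
      | H z =>
        -- Along the tree edge of k the conjugating element is 1, and so β on the leaf k is
        -- determined by α at the same element.
        have := hαβ ⟨D.root k, (z : G' ⧸ P' (D.root k))⟩
        have e : (⟨D.κ (D.root k), ((z * h (D.t (D.root k)) : G') : G' ⧸ _)⟩ :
            CosetSet (fun k => (D.W k).map h)) = ⟨k, (z : G' ⧸ _)⟩ := by
          rw [D.κ_root, D.t_root, map_one, mul_one]
        exact this.trans (congrArg β e)
  · intro w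
    induction w using QuotientGroup.induction_on with
    | H w => exact Or.inl ⟨(w : G' ⧸ U'), rfl⟩

end AmalgamSubgroup

/-! ## The squares of a gluing -/

namespace GluingData

variable (X : GluingData.{u}) {M : Type u} [AddCommGroup M]

/-- The family `∂U`, as a family of subgroups of `G`. -/
def bdUTotal (j : X.J) : Subgroup X.Total := (X.bdU j).map X.inclU

/-- The subgroup `U_i *_{∂U_i} W_i` of `G`. -/
def total (i : Bool) : Subgroup X.Total := (X.D i).total.map (X.incl i)

/-- The family `W_i`, as a family of subgroups of `G`. -/
def leaf (i : Bool) (c : (X.D i).K) : Subgroup X.Total := ((X.D i).W c).map (X.incl i)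

/-- The subgroup of `G` generated by the `U_i *_{∂U_i} W_i`. -/
def center : Subgroup X.Total := X.total false ⊔ X.total true

lemma total_sup (i : Bool) : X.total i ⊔ X.total (!i) = X.center := by
  cases i
  · rfl
  · exact sup_comm _ _

lemma total_le_center (i : Bool) : X.total i ≤ X.center := by
  rw [← X.total_sup i]
  exact le_sup_left

lemma total_le_range (i : Bool) : X.total i ≤ (X.incl i).range := by
  rintro _ ⟨g, -, rfl⟩
  exact ⟨g, rfl⟩

lemma total_le_far (i : Bool) : X.total i ≤ X.far i := le_sup_left

lemma range_le_far (i : Bool) : (X.incl (!i)).range ≤ X.far i := le_sup_right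

lemma total_le_far' (i : Bool) : X.total (!i) ≤ X.far i :=
  (X.total_le_range _).trans (X.range_le_far i)

lemma center_le_far (i : Bool) : X.center ≤ X.far i := by
  rw [← X.total_sup i]
  exact sup_le (X.total_le_far i) ((X.total_le_range _).trans (X.range_le_far i))

lemma bdUTotal_eq (i : Bool) (j : X.J) : X.bdUTotal j = ((X.D i).P j).map (X.incl i) := by
  ext g
  constructor
  · rintro ⟨u, hu, rfl⟩
    exact ⟨X.emb i u, (X.φ_bdU i j u).2 hu, X.incl_emb i u⟩
  · rintro ⟨g, hg, rfl⟩
    obtain ⟨u, hu⟩ := (X.φ i).surjective ⟨g, (X.D i).P_le j hg⟩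
    have hu' : X.emb i u = g := congrArg Subtype.val hu
    refine ⟨u, (X.φ_bdU i j u).1 ?_, ?_⟩
    · change X.emb i u ∈ (X.D i).P j
      rwa [hu']
    · rw [← hu', X.incl_emb]

lemma inclU_range_eq (i : Bool) : X.inclU.range = (X.D i).U.map (X.incl i) := by
  ext g
  constructor
  · rintro ⟨u, rfl⟩
    exact ⟨X.emb i u, (X.φ i u).2, X.incl_emb i u⟩
  · rintro ⟨g, hg, rfl⟩
    obtain ⟨u, hu⟩ := (X.φ i).surjective ⟨g, hg⟩
    have hu' : X.emb i u = g := congrArg Subtype.val hu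
    exact ⟨u, by rw [← hu', X.incl_emb]⟩

lemma bdUTotal_le (j : X.J) : X.bdUTotal j ≤ X.inclU.range := by
  rintro _ ⟨u, -, rfl⟩
  exact ⟨u, rfl⟩

lemma inclU_range_le_total (i : Bool) : X.inclU.range ≤ X.total i :=
  (X.D i).center_le (X.incl i) (X.inclU_range_eq i)

lemma leaf_le_total (i : Bool) (c : (X.D i).K) : X.leaf i c ≤ X.total i :=
  (X.D i).leaf_le (X.incl i) c

/-- The map `∂U → W_i` of families of subgroups of `G`. -/
def edgeHom (i : Bool) : FamilyHom (MonoidHom.id X.Total) X.bdUTotal (X.leaf i) :=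
  (X.D i).edgeHom (X.incl i) (X.bdUTotal_eq i)

/-- The square `P → G / U`, `⨆ G / W_i → G / T_i`. -/
lemma isSetBicartesian_star (i : Bool) :
    IsSetBicartesian M (cosetSetMap X.bdUTotal_le) (X.edgeHom i).map
      (cosetMap (X.inclU_range_le_total i)) (cosetSetMap (X.leaf_le_total i)) :=
  (X.D i).isSetBicartesian_star (X.incl i) (X.bdUTotal_eq i) (X.inclU_range_eq i)
    (X.incl_injective i)

lemma cosetMap_comp {G : Type*} [Group G] {H K L : Subgroup G} (hHK : H ≤ K) (hKL : K ≤ L)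
    (hHL : H ≤ L) (x : G ⧸ H) : cosetMap hKL (cosetMap hHK x) = cosetMap hHL x := by
  induction x using QuotientGroup.induction_on with
  | H x => rfl

/-- The square `G / U → G / T_i`, `G / G_{i'} → G / F_i`. -/
lemma isSetBicartesian_far (i : Bool) :
    IsSetBicartesian M (cosetMap (X.inclU_range_le_total i)) (cosetMap (X.inclU_range_le !i))
      (cosetMap (X.total_le_far i)) (cosetMap (X.range_le_far i)) := by
  refine cosetMap_isSetBicartesian _ _ _ _ rfl fun x h₁ h₂ => ?_
  -- An element that vanishes in M[G/T_i] vanishes in M[G/G_i], so injectivity is inherited from the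
  -- amalgam.
  exact (X.isSetBicartesian_amalgam i).eq_zero x
    (mapDomain_eq_zero_of_comp (fun e => cosetMap_comp _ (X.total_le_range i) _ e) h₁) h₂

/-- The square `G / U → G / T_i`, `G / T_{i'} → G / ⟨T_1, T_2⟩`. -/
lemma isSetBicartesian_center (i : Bool) :
    IsSetBicartesian M (cosetMap (X.inclU_range_le_total i)) (cosetMap (X.inclU_range_le_total !i))
      (cosetMap (X.total_le_center i)) (cosetMap (X.total_le_center !i)) := by
  refine cosetMap_isSetBicartesian _ _ _ _ (X.total_sup i) fun x h₁ h₂ => ?_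
  exact (X.isSetBicartesian_amalgam i).eq_zero x
    (mapDomain_eq_zero_of_comp (fun e => cosetMap_comp _ (X.total_le_range i) _ e) h₁)
    (mapDomain_eq_zero_of_comp (fun e => cosetMap_comp _ (X.total_le_range !i) _ e) h₂)

/-- The square `G / T_i → G / G_i`, `G / F_i → pt`. -/
lemma isSetBicartesian_exc (i : Bool) :
    IsSetBicartesian M (cosetMap (X.total_le_range i)) (cosetMap (X.total_le_far i))
      (fun _ => PUnit.unit.{u + 1}) (fun _ => PUnit.unit) :=
  -- The square beginning at G/U, followed by the desired square, is the square of the amalgam.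
  (X.isSetBicartesian_far i).cancel (X.isSetBicartesian_amalgam i) (cosetMap_comp _ _ _)
    (fun _ => rfl) fun _ => rfl

/-- The square `G / T_{i'} → G / G_{i'}`, `G / ⟨T_1, T_2⟩ → G / F_i`. -/
lemma isSetBicartesian_centerFar (i : Bool) :
    IsSetBicartesian M (cosetMap (X.total_le_range !i)) (cosetMap (X.total_le_center !i))
      (cosetMap (X.range_le_far i)) (cosetMap (X.center_le_far i)) :=
  -- Here the outer rectangle is G/U → G/G_{i'}, G/T_i → G/F_i.
  (X.isSetBicartesian_center i).transpose.cancel (X.isSetBicartesian_far i).transpose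
    (cosetMap_comp _ _ _) (cosetMap_comp _ _ _) fun x =>
      (cosetMap_comp _ _ (X.total_le_far' i) x).trans (cosetMap_comp _ _ _ x).symm

/-! ### Walls -/

lemma exists_path_baseVertex (v : X.wallGraph.V) : ∃ x, X.wallGraph.toGraph.IsPath v
    (X.baseVertex (Quotient.mk _ v)) x := by
  obtain ⟨x, hx⟩ := Quotient.mk_out (s := X.wallGraph.toGraph.componentSetoid) v
  exact ⟨x⁻¹, hx.inv⟩

/-- The point of `⨆ G / D_c` given by an element of `G` and a vertex of the graph. -/
def wallPoint (v : X.wallGraph.V) (x : X.Total) : CosetSet X.wall :=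
  ⟨Quotient.mk _ v, ((x * X.wallGraph.toGroup (X.exists_path_baseVertex v).choose : X.Total) :
    X.Total ⧸ X.wall (Quotient.mk _ v))⟩

/-- Two paths to the base vertex differ by a loop there, and the image of this loop lies in D_c. -/
lemma wallPoint_eq {v : X.wallGraph.V} {c : X.wallGraph.toGraph.Component}
    (hc : (Quotient.mk _ v : X.wallGraph.toGraph.Component) = c) {y : X.wallGraph.toGraph.Universal}
    (hy : X.wallGraph.toGraph.IsPath v (X.baseVertex c) y) (x : X.Total) :
    X.wallPoint v x = ⟨c, ((x * X.wallGraph.toGroup y : X.Total) : X.Total ⧸ X.wall c)⟩ := by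
  subst hc
  refine congrArg (Sigma.mk (Quotient.mk _ v)) (QuotientGroup.eq.2 ?_)
  refine ⟨_, (X.exists_path_baseVertex v).choose_spec.inv.trans hy, ?_⟩
  rw [map_mul, map_inv]
  group

/-- The path can be continued to the base vertex, and the point does not depend on the path chosen.
-/
lemma wallPoint_mul {v w : X.wallGraph.V} {y : X.wallGraph.toGraph.Universal}
    (hy : X.wallGraph.toGraph.IsPath v w y) (x : X.Total) :
    X.wallPoint w (x * X.wallGraph.toGroup y) = X.wallPoint v x := by
  have hc : (Quotient.mk _ v : X.wallGraph.toGraph.Component) = Quotient.mk _ w :=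
    Quotient.sound ⟨y, hy⟩
  rw [X.wallPoint_eq hc (hy.trans (X.exists_path_baseVertex w).choose_spec), map_mul, ← mul_assoc]
  rfl

/-- The map `⨆ G / W_i → ⨆ G / D_c`. -/
def leafHom (i : Bool) : FamilyHom (MonoidHom.id X.Total) (X.leaf i) X.wall where
  idx c := Quotient.mk _ ⟨i, c⟩
  c c := X.wallGraph.toGroup (X.exists_path_baseVertex ⟨i, c⟩).choose
  mem c w hw := by
    have h := (X.exists_path_baseVertex ⟨i, c⟩).choose_spec
    set x := (X.exists_path_baseVertex ⟨i, c⟩).choose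
    refine ⟨x⁻¹ * X.wallGraph.toGraph.vert ⟨i, c⟩ ⟨w, hw⟩ * x,
      (h.inv.trans (GraphOfGroups.IsPath.vert _ _)).trans h, ?_⟩
    rw [map_mul, map_mul, map_inv]
    have := X.wallGraph.toGroup_vert ⟨i, c⟩ ⟨w, hw⟩
    erw [this]

/-- The map `⨆ G / ∂U_j → ⨆ G / D_c`. -/
def wallMap (y : CosetSet X.bdUTotal) : CosetSet X.wall :=
  (X.leafHom false).map ((X.edgeHom false).map y)

/-- The two sides are the points belonging to the two ends of the edge j, and the edge itself is the
connecting path. -/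
lemma leafHom_edgeHom_true (j : X.J) (x : X.Total) :
    (X.leafHom true).map ((X.edgeHom true).map ⟨j, (x : X.Total ⧸ X.bdUTotal j)⟩) =
      (X.leafHom false).map ((X.edgeHom false).map ⟨j, (x : X.Total ⧸ X.bdUTotal j)⟩) := by
  change X.wallPoint ⟨true, _⟩ (x * X.wallGraph.tgtElt j) =
    X.wallPoint ⟨false, _⟩ (x * X.wallGraph.srcElt j)
  have := X.wallPoint_mul (GraphOfGroups.IsPath.edge (Γ := X.wallGraph.toGraph) j)
    (x * X.wallGraph.srcElt j)
  have e := X.wallGraph.toGroup_edge j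
  rw [e, ← mul_assoc, mul_inv_cancel_right] at this
  exact this

lemma leafHom_edgeHom (i : Bool) (y : CosetSet X.bdUTotal) :
    (X.leafHom i).map ((X.edgeHom i).map y) = X.wallMap y := by
  obtain ⟨j, x⟩ := y
  induction x using QuotientGroup.induction_on with
  | H x =>
    cases i
    · rfl
    · exact X.leafHom_edgeHom_true j x

lemma path_mem_center {u v : X.wallGraph.V} {x : X.wallGraph.toGraph.Universal}
    (h : X.wallGraph.toGraph.IsPath u v x) : X.wallGraph.toGroup x ∈ X.center := by
  refine X.wallGraph.toGroup_mem X.center ?_ ?_ h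
  · intro v
    exact (X.leaf_le_total v.1 v.2).trans (X.total_le_center v.1)
  · intro j
    exact mul_mem
      (inv_mem (X.total_le_center false (Subgroup.mem_map_of_mem _ ((X.D false).t_mem j))))
      (X.total_le_center true (Subgroup.mem_map_of_mem _ ((X.D true).t_mem j)))

lemma wall_le_center (c : X.wallGraph.toGraph.Component) : X.wall c ≤ X.center := by
  rintro _ ⟨x, hx, rfl⟩
  exact X.path_mem_center hx

lemma cosetSetMap_leafHom (i : Bool) (y : CosetSet (X.leaf i)) :
    cosetSetMap X.wall_le_center ((X.leafHom i).map y) =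
      cosetMap (X.total_le_center i) (cosetSetMap (X.leaf_le_total i) y) := by
  obtain ⟨c, x⟩ := y
  induction x using QuotientGroup.induction_on with
  | H x =>
    exact QuotientGroup.mk_mul_of_mem x
      (X.path_mem_center (X.exists_path_baseVertex ⟨i, c⟩).choose_spec)

lemma cosetSetMap_edgeHom (i : Bool) (y : CosetSet X.bdUTotal) :
    cosetSetMap (X.leaf_le_total i) ((X.edgeHom i).map y) =
      cosetMap (X.inclU_range_le_total i) (cosetSetMap X.bdUTotal_le y) := by
  obtain ⟨j, x⟩ := y
  induction x using QuotientGroup.induction_on with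
  | H x => exact QuotientGroup.mk_mul_of_mem x (Subgroup.mem_map_of_mem _ ((X.D i).t_mem j))

lemma wallPoint_surjective (w : CosetSet X.wall) : ∃ v x, X.wallPoint v x = w := by
  obtain ⟨c, x⟩ := w
  induction x using QuotientGroup.induction_on with
  | H x =>
    induction c using Quotient.inductionOn with
    | h v =>
      refine ⟨v, x * (X.wallGraph.toGroup (X.exists_path_baseVertex v).choose)⁻¹, ?_⟩
      rw [wallPoint, inv_mul_cancel_right]

/-- The square `P → ⨆ G / W_1`, `⨆ G / W_2 → ⨆ G / D_c`. -/
lemma isSetBicartesian_wall :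
    IsSetBicartesian M (X.edgeHom false).map (X.edgeHom true).map (X.leafHom false).map
      (X.leafHom true).map := by
  refine IsSetBicartesian.of_pushout ?_ ?_ ?_ ?_
  · intro y
    rw [leafHom_edgeHom, leafHom_edgeHom]
  · intro x h₁ h₂
    have hx (i : Bool) (h : x.mapDomain (X.edgeHom i).map = 0) :
        (x.mapDomain (cosetSetMap X.bdUTotal_le)).mapDomain
          (cosetMap (X.inclU_range_le_total i)) = 0 := by
      rw [← Finsupp.mapDomain_comp]
      exact mapDomain_eq_zero_of_comp (X.cosetSetMap_edgeHom i) h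
    -- The image in M[G/U] vanishes in M[G/T_1] and in M[G/T_2], hence is zero. Together with the
    -- vanishing in M[⨆ G/W_1], the square of one star then gives x = 0.
    exact (X.isSetBicartesian_star false).eq_zero x
      ((X.isSetBicartesian_center false).eq_zero _ (hx false h₁) (hx true h₂)) h₁
  · intro N α β h
    -- The same transport argument as for the star, one component at a time: evaluation at the base
    -- vertex is invariant under D_c.
    let θ : X.wallGraph.V → X.Total → N := fun v => match v with
      | ⟨false, c⟩ => fun x => α ⟨c, (x : X.Total ⧸ X.leaf false c)⟩
      | ⟨true, c⟩ => fun x => β ⟨c, (x : X.Total ⧸ X.leaf true c)⟩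
    have hθ : ∀ {u v : X.wallGraph.toGraph.V} {y}, X.wallGraph.toGraph.IsPath u v y → ∀ x,
        θ v (x * X.wallGraph.toGroup y) = θ u x := by
      refine X.wallGraph.eq_of_isPath (MonoidHom.id X.Total) θ (fun v a ha x => ?_) fun e x => ?_
      · match v with
        | ⟨false, c⟩ => exact congrArg (fun x => α ⟨c, x⟩) (QuotientGroup.mk_mul_of_mem x ha)
        | ⟨true, c⟩ => exact congrArg (fun x => β ⟨c, x⟩) (QuotientGroup.mk_mul_of_mem x ha)
      · exact h ⟨e, (x : X.Total ⧸ X.bdUTotal e)⟩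
    let γ : CosetSet X.wall → N := fun w =>
      Quotient.liftOn' w.2 (θ (X.baseVertex w.1)) fun x y hxy => by
        obtain ⟨p, hp, hxy⟩ := QuotientGroup.leftRel_apply.1 hxy
        have := hθ hp x
        rwa [hxy, mul_inv_cancel_left, eq_comm] at this
    have hγ (v x) : γ (X.wallPoint v x) = θ v x :=
      hθ (X.exists_path_baseVertex v).choose_spec x
    refine ⟨γ, ?_, ?_⟩
    all_goals
      rintro ⟨c, x⟩
      induction x using QuotientGroup.induction_on with
      | H x => exact hγ _ x
  · intro w
    obtain ⟨⟨i, c⟩, x, rfl⟩ := X.wallPoint_surjective w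
    cases i
    · exact Or.inl ⟨⟨c, (x : X.Total ⧸ X.leaf false c)⟩, rfl⟩
    · exact Or.inr ⟨⟨c, (x : X.Total ⧸ X.leaf true c)⟩, rfl⟩

/-- The square `P → G / U`, `⨆ G / D_c → G / ⟨T_1, T_2⟩`. -/
lemma isSetBicartesian_wallCenter :
    IsSetBicartesian M (cosetSetMap X.bdUTotal_le) X.wallMap
      (cosetMap ((X.inclU_range_le_total true).trans (X.total_le_center true)))
      (cosetSetMap X.wall_le_center) := by
  -- This is the rectangle ⨆ G/∂U_j → G/T_2, ⨆ G/W_1 → G/C.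
  have h₁ := (X.isSetBicartesian_star (M := M) false).paste (X.isSetBicartesian_center true)
    (a'' := fun y => cosetSetMap (X.leaf_le_total true) ((X.edgeHom true).map y))
    (d'' := fun y => cosetSetMap X.wall_le_center ((X.leafHom false).map y))
    (fun y => (X.cosetSetMap_edgeHom true y).symm) (fun y => (X.cosetSetMap_leafHom false y).symm)
  -- Cancelling the square of walls from the rectangle leaves ⨆ G/W_2 → G/T_2, ⨆ G/D_c → G/C.
  -- Pasting this with the star of G_2 gives the result.
  have h₂ := X.isSetBicartesian_wall.transpose.cancel h₁ (fun _ => rfl) (fun _ => rfl)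
    fun y => (X.cosetSetMap_leafHom true y).symm
  exact ((X.isSetBicartesian_star true).transpose.paste h₂.transpose (X.leafHom_edgeHom true)
    (cosetMap_comp _ _ _)).transpose

end GluingData

/-! ## Induced pairs -/

/-- The composite of two morphisms of pairs. -/
def ActionPair.Hom.comp {H H' H'' : Type u} [Group H] [Group H'] [Group H''] {h : H →* H'}
    {h' : H' →* H''} {h'' : H →* H''} {P : ActionPair H} {P' : ActionPair H'} {P'' : ActionPair H''}
    (q' : ActionPair.Hom h' P' P'') (q : ActionPair.Hom h P P') (hh : h'.comp h = h'') :
    ActionPair.Hom h'' P P'' where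
  mapX := q'.mapX ∘ q.mapX
  mapY := q'.mapY ∘ q.mapY
  mapX_smul a x := by
    subst hh
    exact (congrArg q'.mapX (q.mapX_smul a x)).trans (q'.mapX_smul _ _)
  mapY_smul a x := by
    subst hh
    exact (congrArg q'.mapY (q.mapY_smul a x)).trans (q'.mapY_smul _ _)
  comm y := (q'.comm _).trans (congrArg q'.mapX (q.comm y))

lemma relHomologyMap_bijective_of_comp {k : Type u} [CommRing k] {G H H' H'' : Type u} [Group G]
    [Group H] [Group H'] [Group H''] {f : H →* G} {f' : H' →* G} {f'' : H'' →* G} {h : H →* H'}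
    {h' : H' →* H''} {h'' : H →* H''} (hf : f'.comp h = f) (hf' : f''.comp h' = f')
    (hf'' : f''.comp h'' = f) (hh : h'.comp h = h'') {P : ActionPair H} {P' : ActionPair H'}
    {P'' : ActionPair H''} (q : ActionPair.Hom h P P') (q' : ActionPair.Hom h' P' P'')
    (q'' : ActionPair.Hom h'' P P'') (hX : ∀ x, q'.mapX (q.mapX x) = q''.mapX x)
    (hY : ∀ y, q'.mapY (q.mapY y) = q''.mapY y) (A : Rep.{u} k G) (n : ℕ)
    (b : Function.Bijective (relHomologyMap f f' hf q A n))
    (b' : Function.Bijective (relHomologyMap f' f'' hf' q' A n)) :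
    Function.Bijective (relHomologyMap f f'' hf'' q'' A n) := by
  have := b'.comp b
  have e : relHomologyMap f' f'' hf' q' A n ∘ relHomologyMap f f' hf q A n =
      relHomologyMap f f'' hf'' q'' A n := funext fun x =>
    relHomologyMap_comp_apply hf hf' hf'' hh q q' q'' hX hY A n x
  rwa [e] at this

section Induced

variable {G G' : Type u} [Group G] [Group G'] {I J : Type u}

lemma FamilyHom.map_mk_of_idx_eq {h : G →* G'} {S : I → Subgroup G} {S' : J → Subgroup G'}
    (q : FamilyHom h S S') {i : I} {j : J} (hi : q.idx i = j) (hc : q.c i = 1) (x : G) :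
    q.map ⟨i, (x : G ⧸ S i)⟩ = ⟨j, (h x : G' ⧸ S' j)⟩ := by
  subst hi
  rw [FamilyHom.map_mk, hc, mul_one]

/-- The map of a family of subgroups to the family of their images. -/
def imageHom (h : G →* G') (S : I → Subgroup G) : FamilyHom h S (fun i => (S i).map h) where
  idx := id
  c _ := 1
  mem i s hs := by
    rw [inv_one, one_mul, mul_one]
    exact Subgroup.mem_map_of_mem h hs

lemma imageHom_map (h : G →* G') (S : I → Subgroup G) (i : I) (x : G) :
    (imageHom h S).map ⟨i, (x : G ⧸ S i)⟩ = ⟨i, (h x : G' ⧸ (S i).map h)⟩ :=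
  (imageHom h S).map_mk_of_idx_eq rfl rfl x

/-- The set G'/h(S_i) is G' ×_G G/S_i. Injectivity of h is not needed, because the condition on
stabilizers asks only for some preimage. -/
lemma imageHom_isInduced {h : G →* G'} (S : I → Subgroup G) :
    IsInduced h (imageHom h S).map where
  orbit := by
    rintro ⟨i, x⟩
    induction x using QuotientGroup.induction_on with
    | H x =>
      refine ⟨x, ⟨i, ((1 : G) : G ⧸ S i)⟩, ?_⟩
      rw [imageHom_map, map_one]
      exact congrArg (fun x : G' => (⟨i, (x : G' ⧸ (S i).map h)⟩ :
        CosetSet (fun i => (S i).map h))) (mul_one x)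
  stabilizer := by
    rintro x ⟨i, y⟩ ⟨j, z⟩ h'
    induction y using QuotientGroup.induction_on with
    | H y =>
    induction z using QuotientGroup.induction_on with
    | H z =>
      rw [imageHom_map, imageHom_map] at h'
      obtain rfl : i = j := congrArg Sigma.fst h'
      have h' : ((x * h y : G') : G' ⧸ (S i).map h) = (h z : G' ⧸ (S i).map h) :=
        eq_of_heq (Sigma.mk.inj h').2
      obtain ⟨s, hs, hs'⟩ := QuotientGroup.eq.1 h'
      -- Equality of the cosets gives s in S_i with h s = (x h(y))⁻¹ h(z), and solving for x gives
      -- this witness.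
      refine ⟨z * s⁻¹ * y⁻¹, ?_, ?_⟩
      · rw [map_mul, map_mul, map_inv, map_inv, hs']
        group
      · refine congrArg (Sigma.mk i) ?_
        change ((z * s⁻¹ * y⁻¹ * y : G) : G ⧸ S i) = z
        rw [inv_mul_cancel_right]
        exact QuotientGroup.mk_mul_of_mem z (inv_mem hs)

lemma map_le_range' (h : G →* G') (S : Subgroup G) : S.map h ≤ h.range := by
  rintro _ ⟨g, -, rfl⟩
  exact ⟨g, rfl⟩

/-- The pair of `G'`-sets induced by a group pair `(G, S)` along `h : G →* G'`. -/
def imagePair (h : G →* G') (S : I → Subgroup G) : ActionPair G' where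
  X := G' ⧸ h.range
  Y := CosetSet (fun i => (S i).map h)
  proj := cosetSetMap fun i => map_le_range' h (S i)
  proj_smul := by
    rintro x ⟨i, y⟩
    induction y using QuotientGroup.induction_on with
    | H y => rfl

/-- The morphism from a group pair to the induced pair. -/
def toImagePair (h : G →* G') (S : I → Subgroup G) :
    ActionPair.Hom h (groupPair S) (imagePair h S) where
  mapX _ := ((1 : G') : G' ⧸ h.range)
  mapY := (imageHom h S).map
  mapX_smul a _ := QuotientGroup.eq.2 (by
    change (1 : G')⁻¹ * (h a * 1) ∈ h.range
    rw [inv_one, one_mul, mul_one]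
    exact ⟨a, rfl⟩)
  mapY_smul := FamilyHom.map_smul _
  comm := by
    rintro ⟨i, y⟩
    induction y using QuotientGroup.induction_on with
    | H y =>
      rw [imageHom_map]
      refine QuotientGroup.eq.2 ?_
      rw [mul_one]
      exact inv_mem ⟨y, rfl⟩

lemma toImagePair_isInduced (h : G →* G') (S : I → Subgroup G) :
    IsInduced h (toImagePair h S).mapX where
  orbit y' := by
    induction y' using QuotientGroup.induction_on with
    | H x => exact ⟨x, PUnit.unit, congrArg (fun x : G' => (x : G' ⧸ h.range)) (mul_one x)⟩
  stabilizer x y₁ y₂ hx := by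
    have hx : ((x * 1 : G') : G' ⧸ h.range) = ((1 : G') : G' ⧸ h.range) := hx
    obtain ⟨a, ha⟩ := QuotientGroup.eq.1 hx.symm
    exact ⟨a, by rw [ha]; group, rfl⟩

/-- The image of a morphism between families of subgroups of `G` under `h : G →* G'`. -/
def FamilyHom.image (h : G →* G') {S : I → Subgroup G} {T : J → Subgroup G}
    (q : FamilyHom (MonoidHom.id G) T S) :
    FamilyHom (MonoidHom.id G') (fun j => (T j).map h) (fun i => (S i).map h) where
  idx := q.idx
  c j := h (q.c j)
  mem := by
    rintro j _ ⟨t, ht, rfl⟩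
    exact ⟨_, q.mem j t ht, by simp⟩

/-- The morphism from a pair of families to the pair of the images. -/
def FamilyHom.toImage (h : G →* G') {S : I → Subgroup G} {T : J → Subgroup G}
    (q : FamilyHom (MonoidHom.id G) T S) :
    ActionPair.Hom h (familyPair q) (familyPair (q.image h)) where
  mapX := (imageHom h S).map
  mapY := (imageHom h T).map
  mapX_smul := FamilyHom.map_smul _
  mapY_smul := FamilyHom.map_smul _
  comm := by
    rintro ⟨j, y⟩
    induction y using QuotientGroup.induction_on with
    | H y =>
      change (q.image h).map ((imageHom h T).map ⟨j, (y : G ⧸ T j)⟩) =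
        (imageHom h S).map (q.map ⟨j, (y : G ⧸ T j)⟩)
      rw [imageHom_map, FamilyHom.map_mk, FamilyHom.map_mk, imageHom_map, MonoidHom.id_apply,
        MonoidHom.id_apply, map_mul]
      rfl

variable {k : Type u} [CommRing k] {L : Type u} [Group L]

lemma toImagePair_bijective {f : G →* L} {f' : G' →* L} {h : G →* G'} (hf : f'.comp h = f)
    (hf₁ : Function.Injective f) (hf₂ : Function.Injective f') (S : I → Subgroup G)
    (A : Rep.{u} k L) (n : ℕ) : Function.Bijective (relHomologyMap f f' hf (toImagePair h S) A n) :=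
  relHomologyMap_bijective_of_isInduced hf hf₁ hf₂ _ (toImagePair_isInduced h S)
    (imageHom_isInduced S) A n

lemma toImage_bijective {f : G →* L} {f' : G' →* L} {h : G →* G'} (hf : f'.comp h = f)
    (hf₁ : Function.Injective f) (hf₂ : Function.Injective f') {S : I → Subgroup G}
    {T : J → Subgroup G} (q : FamilyHom (MonoidHom.id G) T S) (A : Rep.{u} k L) (n : ℕ) :
    Function.Bijective (relHomologyMap f f' hf (q.toImage h) A n) :=
  relHomologyMap_bijective_of_isInduced hf hf₁ hf₂ _ (imageHom_isInduced S)
    (imageHom_isInduced T) A n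

end Induced

/-! ### Decompositions of coset sets -/

section Decomposition

variable {G : Type u} [Group G] {I : Type u} {S : I → Subgroup G}

/-- The inclusion of the coset sets of a part of a family. -/
def cosetEmb {J : Type u} (S : I → Subgroup G) (ι : J → I) (y : CosetSet (fun j => S (ι j))) :
    CosetSet S :=
  ⟨ι y.1, y.2⟩

/-- The inclusion of the coset set of a member of a family. -/
def cosetAt (S : I → Subgroup G) (i : I) (x : G ⧸ S i) : CosetSet S := ⟨i, x⟩

lemma cosetAt_injective (i : I) : Function.Injective (cosetAt S i) :=
  fun _ _ h => eq_of_heq (Sigma.mk.inj h).2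

lemma cosetEmb_injective {J : Type u} {ι : J → I} (hι : Function.Injective ι) :
    Function.Injective (cosetEmb S ι) := by
  rintro ⟨i, x⟩ ⟨j, y⟩ h
  obtain rfl : i = j := hι (congrArg Sigma.fst h)
  exact congrArg (Sigma.mk i) (eq_of_heq (Sigma.mk.inj h).2)

lemma sumElim_cosetEmb_bijective {J K : Type u} {ι : J → I} {κ : K → I}
    (h : Function.Bijective (Sum.elim ι κ)) :
    Function.Bijective (Sum.elim (cosetEmb S ι) (cosetEmb S κ)) := by
  refine ⟨(cosetEmb_injective (h.1.comp Sum.inl_injective)).sumElim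
    (cosetEmb_injective (h.1.comp Sum.inr_injective)) fun y z hyz => ?_, ?_⟩
  · exact Sum.inl_ne_inr (h.1 (congrArg Sigma.fst hyz : ι y.1 = κ z.1))
  · rintro ⟨i, x⟩
    obtain ⟨j | j, rfl⟩ := h.2 i
    · exact ⟨Sum.inl ⟨j, x⟩, rfl⟩
    · exact ⟨Sum.inr ⟨j, x⟩, rfl⟩

lemma sumElim_mk_cosetEmb_bijective {J : Type u} {i₀ : I} {ι : J → I}
    (h : Function.Bijective (Sum.elim (fun _ : PUnit.{1} => i₀) ι)) :
    Function.Bijective (Sum.elim (cosetAt S i₀) (cosetEmb S ι)) := by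
  refine ⟨(cosetAt_injective i₀).sumElim
    (cosetEmb_injective (h.1.comp Sum.inr_injective)) fun y z hyz => ?_, ?_⟩
  · exact Sum.inl_ne_inr (h.1 (a₁ := Sum.inl PUnit.unit) (congrArg Sigma.fst hyz : i₀ = ι z.1))
  · rintro ⟨i, x⟩
    obtain ⟨j | j, rfl⟩ := h.2 i
    · exact ⟨Sum.inl x, rfl⟩
    · exact ⟨Sum.inr ⟨j, x⟩, rfl⟩

lemma sumElim_sumElim_cosetEmb_bijective {J K : Type u} {i₀ : I} {ι : J → I} {κ : K → I}
    (h : Function.Bijective (Sum.elim (Sum.elim (fun _ : PUnit.{1} => i₀) ι) κ)) :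
    Function.Bijective (Sum.elim (Sum.elim (cosetAt S i₀) (cosetEmb S ι))
      (cosetEmb S κ)) := by
  refine ⟨((cosetAt_injective i₀).sumElim (cosetEmb_injective
    ((h.1.comp Sum.inl_injective).comp Sum.inr_injective)) fun y z hyz => ?_).sumElim
    (cosetEmb_injective (h.1.comp Sum.inr_injective)) ?_, ?_⟩
  · exact Sum.inl_ne_inr (Sum.inl_injective (h.1 (a₁ := Sum.inl (Sum.inl PUnit.unit))
      (a₂ := Sum.inl (Sum.inr z.1)) (congrArg Sigma.fst hyz : i₀ = ι z.1)))
  · rintro (y | y) z hyz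
    · exact Sum.inl_ne_inr (h.1 (a₁ := Sum.inl (Sum.inl PUnit.unit)) (a₂ := Sum.inr z.1)
        (congrArg Sigma.fst hyz : i₀ = κ z.1))
    · exact Sum.inl_ne_inr (h.1 (a₁ := Sum.inl (Sum.inr y.1)) (a₂ := Sum.inr z.1)
        (congrArg Sigma.fst hyz : ι y.1 = κ z.1))
  · rintro ⟨i, x⟩
    obtain ⟨(j | j) | j, rfl⟩ := h.2 i
    · exact ⟨Sum.inl (Sum.inl x), rfl⟩
    · exact ⟨Sum.inl (Sum.inr ⟨j, x⟩), rfl⟩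
    · exact ⟨Sum.inr ⟨j, x⟩, rfl⟩

end Decomposition

/-! ## Maps between the pairs of a gluing -/

namespace GluingData

variable (X : GluingData.{u})

/-- The family of the `S_i` together with the subgroup generated by the `U_i *_{∂U_i} W_i`. -/
def bdCenter : (Σ i : Bool, X.I i) ⊕ PUnit.{u + 1} → Subgroup X.Total :=
  Sum.elim (fun s => (X.S s.1 s.2).map (X.incl s.1)) (fun _ => X.center)

/-- The inclusion of `∂G` in the family `bdCenter`. -/
def homCenter : FamilyHom (MonoidHom.id X.Total) X.bdG X.bdCenter where
  idx := Sum.map id (fun _ => PUnit.unit)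
  c _ := 1
  mem := by
    rintro (s | c) g hg
    · rw [inv_one, one_mul, mul_one]
      exact hg
    · rw [inv_one, one_mul, mul_one]
      exact X.wall_le_center c hg

/-- The inclusion of the family `bdCenter` in `∂G ∪ G_{i'}`. -/
def homFar (i : Bool) : FamilyHom (MonoidHom.id X.Total) X.bdCenter (X.bdFar i) where
  idx := Sum.elim (fun s => if h : s.1 = i then Sum.inl (h ▸ s.2) else Sum.inr PUnit.unit)
    (fun _ => Sum.inr PUnit.unit)
  c _ := 1
  mem := by
    rintro (⟨i', s⟩ | c) g hg
    · exact (X.homCollapse i).mem (Sum.inl ⟨i', s⟩) g hg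
    · rw [inv_one, one_mul, mul_one]
      exact X.center_le_far i hg

/-- The inclusion of `∂G_i` in the family `bdCenter`. -/
def homInj (i : Bool) : FamilyHom (X.incl i) (X.bdGi i) X.bdCenter where
  idx := Sum.map (Sigma.mk i) id
  c _ := 1
  mem := by
    rintro (s | _) g hg
    · rw [inv_one, one_mul, mul_one]
      exact Subgroup.mem_map_of_mem (X.incl i) hg
    · rw [inv_one, one_mul, mul_one]
      exact X.total_le_center i (Subgroup.mem_map_of_mem (X.incl i) hg)

lemma homFar_map_eq (i : Bool) (s : X.I i) (x : X.Total) :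
    (X.homFar i).map ⟨Sum.inl ⟨i, s⟩, (x : X.Total ⧸ X.bdCenter (Sum.inl ⟨i, s⟩))⟩ =
      ⟨Sum.inl s, (x : X.Total ⧸ X.bdFar i (Sum.inl s))⟩ := by
  have hi : (X.homFar i).idx (Sum.inl ⟨i, s⟩) = Sum.inl s := dif_pos rfl
  exact (X.homFar i).map_mk_of_idx_eq hi rfl x

lemma homFar_map_ne (i : Bool) (s : X.I !i) (x : X.Total) :
    (X.homFar i).map ⟨Sum.inl ⟨!i, s⟩, (x : X.Total ⧸ X.bdCenter (Sum.inl ⟨!i, s⟩))⟩ =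
      ⟨Sum.inr PUnit.unit, (x : X.Total ⧸ X.bdFar i (Sum.inr PUnit.unit))⟩ := by
  have hi : (X.homFar i).idx (Sum.inl ⟨!i, s⟩) = Sum.inr PUnit.unit := dif_neg (Bool.not_ne_self i)
  exact (X.homFar i).map_mk_of_idx_eq hi rfl x

lemma homFar_map_center (i : Bool) (x : X.Total) :
    (X.homFar i).map ⟨Sum.inr PUnit.unit, (x : X.Total ⧸ X.bdCenter (Sum.inr PUnit.unit))⟩ =
      ⟨Sum.inr PUnit.unit, (x : X.Total ⧸ X.bdFar i (Sum.inr PUnit.unit))⟩ :=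
  (X.homFar i).map_mk_of_idx_eq rfl rfl x

lemma homFar_homCenter (i : Bool) (y : CosetSet X.bdG) :
    (X.homFar i).map (X.homCenter.map y) = (X.homCollapse i).map y := by
  obtain ⟨j, x⟩ := y
  induction x using QuotientGroup.induction_on with
  | H x =>
    rw [X.homCenter.map_mk_of_idx_eq (j := X.homCenter.idx j) rfl rfl]
    obtain s | c := j <;> rfl

lemma homFar_homInj (i : Bool) (y : CosetSet (X.bdGi i)) :
    (X.homFar i).map ((X.homInj i).map y) = (X.homExc i).map y := by
  obtain ⟨s | _, x⟩ := y
  all_goals induction x using QuotientGroup.induction_on with | H x => ?_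
  · rw [(X.homInj i).map_mk_of_idx_eq (j := Sum.inl ⟨i, s⟩) rfl rfl, homFar_map_eq,
      (X.homExc i).map_mk_of_idx_eq (j := Sum.inl s) rfl rfl]
  · rw [(X.homInj i).map_mk_of_idx_eq (j := Sum.inr PUnit.unit) rfl rfl, homFar_map_center,
      (X.homExc i).map_mk_of_idx_eq (j := Sum.inr PUnit.unit) rfl rfl]

/-! ### The pair of the families `bdCenter` and `∂G` -/

lemma homCenter_inl (y : CosetSet (fun s => X.bdG (Sum.inl s))) :
    X.homCenter.map (cosetEmb X.bdG Sum.inl y) = cosetEmb X.bdCenter Sum.inl y := by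
  obtain ⟨s, x⟩ := y
  induction x using QuotientGroup.induction_on with
  | H x => exact X.homCenter.map_mk_of_idx_eq (j := Sum.inl s) rfl rfl x

lemma homCenter_inr (y : CosetSet X.wall) :
    X.homCenter.map (cosetEmb X.bdG Sum.inr y) =
      cosetAt X.bdCenter (Sum.inr PUnit.unit) (cosetSetMap X.wall_le_center y) := by
  obtain ⟨c, x⟩ := y
  induction x using QuotientGroup.induction_on with
  | H x => exact X.homCenter.map_mk_of_idx_eq (j := Sum.inr PUnit.unit) rfl rfl x

lemma cosetSetMap_wallMap (y : CosetSet X.bdUTotal) :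
    cosetSetMap X.wall_le_center (X.wallMap y) =
      cosetMap ((X.inclU_range_le_total true).trans (X.total_le_center true))
        (cosetSetMap X.bdUTotal_le y) := by
  rw [← X.leafHom_edgeHom true, cosetSetMap_leafHom, cosetSetMap_edgeHom]
  exact cosetMap_comp _ _ _ _

/-- The morphism from `(G / U, ⨆ G / ∂U_j)` to the pair of the families `bdCenter` and `∂G`. -/
def centerSquare : ActionPair.Hom (MonoidHom.id X.Total) (imagePair X.inclU X.bdU)
    (familyPair X.homCenter) where
  mapX := fun x : X.Total ⧸ X.inclU.range => cosetAt X.bdCenter (Sum.inr PUnit.unit)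
    (cosetMap ((X.inclU_range_le_total true).trans (X.total_le_center true)) x)
  mapY := fun y : CosetSet X.bdUTotal => cosetEmb X.bdG Sum.inr (X.wallMap y)
  mapX_smul a x := by
    induction x using QuotientGroup.induction_on with
    | H x => rfl
  mapY_smul a y := congrArg (cosetEmb X.bdG Sum.inr) (((congrArg (X.leafHom false).map
    ((X.edgeHom false).map_smul a y))).trans ((X.leafHom false).map_smul a _))
  comm y := (X.homCenter_inr (X.wallMap y)).trans (congrArg _ (X.cosetSetMap_wallMap y))

lemma bijective_elim_inr_inl {I J : Type u} :
    Function.Bijective (Sum.elim Sum.inr Sum.inl : I ⊕ J → J ⊕ I) :=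
  (Equiv.sumComm I J).bijective

lemma bijective_elim_inr_unit_inl {I : Type u} :
    Function.Bijective (Sum.elim (fun _ : PUnit.{1} => Sum.inr PUnit.unit) Sum.inl :
      PUnit.{1} ⊕ I → I ⊕ PUnit.{u + 1}) := by
  refine ⟨?_, ?_⟩
  · rintro (_ | _) (_ | _) h <;> simp_all
  · rintro (i | _)
    · exact ⟨Sum.inr i, rfl⟩
    · exact ⟨Sum.inl PUnit.unit, rfl⟩

/-- To the square of `isSetBicartesian_wallCenter` the cosets of S_1 and S_2, common to ∂G and
`bdCenter`, are added on the right. -/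
lemma centerSquare_isSetBicartesian {M : Type u} [AddCommGroup M] :
    IsSetBicartesian M (imagePair X.inclU X.bdU).proj X.centerSquare.mapY X.centerSquare.mapX
      (familyPair X.homCenter).proj := by
  change IsSetBicartesian M (cosetSetMap X.bdUTotal_le)
    (fun y => cosetEmb X.bdG Sum.inr (X.wallMap y))
    (fun x => cosetAt X.bdCenter (Sum.inr PUnit.unit)
      (cosetMap ((X.inclU_range_le_total true).trans (X.total_le_center true)) x)) X.homCenter.map
  have hB : Function.Bijective (Sum.elim (cosetEmb X.bdG Sum.inr : CosetSet X.wall → _)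
      (cosetEmb X.bdG Sum.inl)) :=
    sumElim_cosetEmb_bijective bijective_elim_inr_inl
  have hC : Function.Bijective (Sum.elim
      (cosetAt X.bdCenter (Sum.inr PUnit.unit) : X.Total ⧸ X.center → _)
      (cosetEmb X.bdCenter Sum.inl)) :=
    sumElim_mk_cosetEmb_bijective bijective_elim_inr_unit_inl
  exact X.isSetBicartesian_wallCenter.add_right hB hC (fun _ => rfl) (fun _ => rfl) X.homCenter_inr X.homCenter_inl

/-- The inclusion of `(U, ∂U)` in the pair of the families `bdCenter` and `∂G`. -/
def centerHom : ActionPair.Hom X.inclU (groupPair X.bdU) (familyPair X.homCenter) :=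
  X.centerSquare.comp (toImagePair X.inclU X.bdU) (MonoidHom.id_comp _)

/-! ### Excision for `(G_i, ∂G_i)` -/

/-- The image of the family `∂G_i` in `G`. -/
abbrev bdGiTotal (i : Bool) (s : X.I i ⊕ PUnit.{u + 1}) : Subgroup X.Total :=
  (X.bdGi i s).map (X.incl i)

/-- The inclusion of the image of `∂G_i` in `∂G ∪ G_{i'}`. -/
def homImageExc (i : Bool) : FamilyHom (MonoidHom.id X.Total) (X.bdGiTotal i) (X.bdFar i) where
  idx := id
  c _ := 1
  mem := by
    rintro s _ ⟨g, hg, rfl⟩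
    have := (X.homExc i).mem s g hg
    exact this

/-- The morphism from `(G / G_i, ⨆ G / ∂G_i)` to `(pt, ⨆ G / (∂G ∪ G_{i'}))`. -/
def excSquare (i : Bool) : ActionPair.Hom (MonoidHom.id X.Total) (imagePair (X.incl i) (X.bdGi i))
    (groupPair (X.bdFar i)) where
  mapX _ := PUnit.unit
  mapY := (X.homImageExc i).map
  mapX_smul _ _ := rfl
  mapY_smul := FamilyHom.map_smul _
  comm _ := rfl

lemma homImageExc_map (i : Bool) (s : X.I i ⊕ PUnit.{u + 1}) (x : X.Total) :
    (X.homImageExc i).map ⟨s, (x : X.Total ⧸ X.bdGiTotal i s)⟩ =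
      ⟨s, (x : X.Total ⧸ X.bdFar i s)⟩ :=
  (X.homImageExc i).map_mk_of_idx_eq rfl rfl x

/-- The cosets of S_i are common to the images of ∂G_i and to ∂G ∪ G_{i'}. They are added to the
square G/T_i → G/G_i, G/F_i → pt. -/
lemma excSquare_isSetBicartesian {M : Type u} [AddCommGroup M] (i : Bool) :
    IsSetBicartesian M (imagePair (X.incl i) (X.bdGi i)).proj (X.excSquare i).mapY
      (X.excSquare i).mapX (groupPair (X.bdFar i)).proj := by
  change IsSetBicartesian M (cosetSetMap fun s => map_le_range' (X.incl i) (X.bdGi i s))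
    (X.homImageExc i).map (fun _ => PUnit.unit.{u + 1}) (fun _ => PUnit.unit.{u + 1})
  have hE : Function.Bijective (Sum.elim
      (cosetAt (X.bdGiTotal i) (Sum.inr PUnit.unit) : X.Total ⧸ X.total i → _)
      (cosetEmb (X.bdGiTotal i) Sum.inl)) :=
    sumElim_mk_cosetEmb_bijective bijective_elim_inr_unit_inl
  have hB : Function.Bijective (Sum.elim
      (cosetAt (X.bdFar i) (Sum.inr PUnit.unit) : X.Total ⧸ X.far i → _)
      (cosetEmb (X.bdFar i) Sum.inl : CosetSet (fun s => X.bdGiTotal i (Sum.inl s)) → _)) :=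
    sumElim_mk_cosetEmb_bijective (S := X.bdFar i) bijective_elim_inr_unit_inl
  refine (X.isSetBicartesian_exc i).add_left hE hB (fun e => ?_) (fun e => ?_) ?_ (fun _ => rfl) (fun _ => rfl) (fun _ => rfl)
  · induction e using QuotientGroup.induction_on with
    | H e => rfl
  · induction e using QuotientGroup.induction_on with
    | H e => exact X.homImageExc_map i (Sum.inr PUnit.unit) e
  · rintro ⟨s, x⟩
    induction x using QuotientGroup.induction_on with
    | H x => exact X.homImageExc_map i (Sum.inl s) x

lemma homImageExc_imageHom (i : Bool) (y : CosetSet (X.bdGi i)) :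
    (X.homImageExc i).map ((imageHom (X.incl i) (X.bdGi i)).map y) = (X.homExc i).map y := by
  obtain ⟨s, x⟩ := y
  induction x using QuotientGroup.induction_on with
  | H x =>
    rw [imageHom_map]
    exact (X.homImageExc_map i s _).trans ((X.homExc i).map_mk_of_idx_eq rfl rfl x).symm

/-! ### Excision for `(∂G_i, S_i ∪ W_i)` -/

lemma homOpen_image_inl (i : Bool)
    (y : CosetSet (fun s => (X.bdGiOpen i (Sum.inl s)).map (X.incl i))) :
    ((X.homOpen i).image (X.incl i)).map
      (cosetEmb (fun s => (X.bdGiOpen i s).map (X.incl i)) Sum.inl y) =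
      cosetEmb (X.bdGiTotal i) Sum.inl y := by
  obtain ⟨s, x⟩ := y
  induction x using QuotientGroup.induction_on with
  | H x =>
    exact ((X.homOpen i).image (X.incl i)).map_mk_of_idx_eq (i := Sum.inl s) (j := Sum.inl s) rfl
      (map_one (X.incl i)) x

lemma homOpen_image_inr (i : Bool) (y : CosetSet (X.leaf i)) :
    ((X.homOpen i).image (X.incl i)).map
      (cosetEmb (fun s => (X.bdGiOpen i s).map (X.incl i)) Sum.inr y) =
      cosetAt (X.bdGiTotal i) (Sum.inr PUnit.unit) (cosetSetMap (X.leaf_le_total i) y) := by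
  obtain ⟨s, x⟩ := y
  induction x using QuotientGroup.induction_on with
  | H x =>
    exact ((X.homOpen i).image (X.incl i)).map_mk_of_idx_eq (i := Sum.inr s)
      (j := Sum.inr PUnit.unit) rfl (map_one (X.incl i)) x

/-- The morphism from `(G / U, ⨆ G / ∂U_j)` to `(⨆ G / ∂G_i, ⨆ G / (S_i ∪ W_i))`. -/
def wallSquare (i : Bool) : ActionPair.Hom (MonoidHom.id X.Total) (imagePair X.inclU X.bdU)
    (familyPair ((X.homOpen i).image (X.incl i))) where
  mapX := fun x : X.Total ⧸ X.inclU.range => cosetAt (X.bdGiTotal i) (Sum.inr PUnit.unit)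
    (cosetMap (X.inclU_range_le_total i) x)
  mapY := fun y : CosetSet X.bdUTotal =>
    cosetEmb (fun s => (X.bdGiOpen i s).map (X.incl i)) Sum.inr ((X.edgeHom i).map y)
  mapX_smul a x := by
    induction x using QuotientGroup.induction_on with
    | H x => rfl
  mapY_smul a y := congrArg (cosetEmb (fun s => (X.bdGiOpen i s).map (X.incl i)) Sum.inr)
    ((X.edgeHom i).map_smul a y)
  comm y := (X.homOpen_image_inr i ((X.edgeHom i).map y)).trans
    (congrArg _ (X.cosetSetMap_edgeHom i y))

/-- This is the square of the star, with the cosets of S_i added to both terms on the right. -/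
lemma wallSquare_isSetBicartesian {M : Type u} [AddCommGroup M] (i : Bool) :
    IsSetBicartesian M (imagePair X.inclU X.bdU).proj (X.wallSquare i).mapY (X.wallSquare i).mapX
      (familyPair ((X.homOpen i).image (X.incl i))).proj := by
  change IsSetBicartesian M (cosetSetMap X.bdUTotal_le)
    (fun y => cosetEmb (fun s => (X.bdGiOpen i s).map (X.incl i)) Sum.inr ((X.edgeHom i).map y))
    (fun x => cosetAt (X.bdGiTotal i) (Sum.inr PUnit.unit) (cosetMap (X.inclU_range_le_total i) x))
    ((X.homOpen i).image (X.incl i)).map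
  have hB : Function.Bijective (Sum.elim
      (cosetEmb (fun s => (X.bdGiOpen i s).map (X.incl i)) Sum.inr : CosetSet (X.leaf i) → _)
      (cosetEmb (fun s => (X.bdGiOpen i s).map (X.incl i)) Sum.inl)) :=
    sumElim_cosetEmb_bijective bijective_elim_inr_inl
  have hC : Function.Bijective (Sum.elim
      (cosetAt (X.bdGiTotal i) (Sum.inr PUnit.unit) : X.Total ⧸ X.total i → _)
      (cosetEmb (X.bdGiTotal i) Sum.inl)) :=
    sumElim_mk_cosetEmb_bijective bijective_elim_inr_unit_inl
  exact (X.isSetBicartesian_star i).add_right hB hC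
    (fun _ => rfl) (fun _ => rfl) (X.homOpen_image_inr i) (X.homOpen_image_inl i)

end GluingData

namespace GluingData

variable (X : GluingData.{u})

/-! ### The pair of the families `∂G ∪ G_{i'}` and `bdCenter` -/

/-- The inclusion of the image of `∂G_i` in the family `bdCenter`. -/
def homImageInj (i : Bool) : FamilyHom (MonoidHom.id X.Total) (X.bdGiTotal i) X.bdCenter where
  idx := Sum.map (Sigma.mk i) id
  c _ := 1
  mem := by
    rintro s _ ⟨g, hg, rfl⟩
    exact (X.homInj i).mem s g hg

lemma homImageInj_inl (i : Bool) (s : X.I i) (x : X.Total) :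
    (X.homImageInj i).map ⟨Sum.inl s, (x : X.Total ⧸ X.bdGiTotal i (Sum.inl s))⟩ =
      ⟨Sum.inl ⟨i, s⟩, (x : X.Total ⧸ X.bdCenter (Sum.inl ⟨i, s⟩))⟩ :=
  (X.homImageInj i).map_mk_of_idx_eq rfl rfl x

lemma homImageInj_inr (i : Bool) (x : X.Total) :
    (X.homImageInj i).map
      ⟨Sum.inr PUnit.unit, (x : X.Total ⧸ X.bdGiTotal i (Sum.inr PUnit.unit))⟩ =
      ⟨Sum.inr PUnit.unit, (x : X.Total ⧸ X.bdCenter (Sum.inr PUnit.unit))⟩ :=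
  (X.homImageInj i).map_mk_of_idx_eq rfl rfl x

lemma homImageInj_imageHom (i : Bool) (y : CosetSet (X.bdGi i)) :
    (X.homImageInj i).map ((imageHom (X.incl i) (X.bdGi i)).map y) = (X.homInj i).map y := by
  obtain ⟨s, x⟩ := y
  induction x using QuotientGroup.induction_on with
  | H x =>
    rw [imageHom_map]
    exact ((X.homImageInj i).map_mk_of_idx_eq (i := s) rfl rfl _).trans
      ((X.homInj i).map_mk_of_idx_eq rfl rfl x).symm

lemma homFar_homImageInj (i : Bool) (y : CosetSet (X.bdGiTotal !i)) :
    (X.homFar i).map ((X.homImageInj !i).map y) = cosetAt (X.bdFar i) (Sum.inr PUnit.unit)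
      (cosetMap (X.range_le_far i)
        (cosetSetMap (fun s => map_le_range' (X.incl !i) (X.bdGi (!i) s)) y)) := by
  obtain ⟨s | _, x⟩ := y
  all_goals induction x using QuotientGroup.induction_on with | H x => ?_
  · exact (congrArg _ (X.homImageInj_inl (!i) s x)).trans (X.homFar_map_ne i s x)
  · exact (congrArg _ (X.homImageInj_inr (!i) x)).trans (X.homFar_map_center i x)

/-- The morphism from `(G / G_{i'}, ⨆ G / ∂G_{i'})` to the pair of the families `∂G ∪ G_{i'}` and
`bdCenter`. -/
def farSquare (i : Bool) : ActionPair.Hom (MonoidHom.id X.Total)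
    (imagePair (X.incl !i) (X.bdGi !i)) (familyPair (X.homFar i)) where
  mapX := fun x : X.Total ⧸ (X.incl !i).range => cosetAt (X.bdFar i) (Sum.inr PUnit.unit)
    (cosetMap (X.range_le_far i) x)
  mapY := (X.homImageInj !i).map
  mapX_smul a x := by
    induction x using QuotientGroup.induction_on with
    | H x => rfl
  mapY_smul := FamilyHom.map_smul _
  comm := X.homFar_homImageInj i

lemma bijective_index (i : Bool) : Function.Bijective (Sum.elim (Sum.elim
    (fun _ : PUnit.{1} => (Sum.inr PUnit.unit : (Σ i : Bool, X.I i) ⊕ PUnit.{u + 1}))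
    (fun s : X.I i => Sum.inl ⟨i, s⟩)) (fun s : X.I !i => Sum.inl ⟨!i, s⟩)) := by
  refine ⟨?_, ?_⟩
  · rintro ((_ | s) | s) ((_ | t) | t) h
    · rfl
    · exact absurd h Sum.inr_ne_inl
    · exact absurd h Sum.inr_ne_inl
    · exact absurd h Sum.inl_ne_inr
    · rw [sigma_mk_injective (Sum.inl_injective h)]
    · exact absurd (congrArg Sigma.fst (Sum.inl_injective h)) (by simp)
    · exact absurd h Sum.inl_ne_inr
    · exact absurd (congrArg Sigma.fst (Sum.inl_injective h)) (by simp)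
    · rw [sigma_mk_injective (Sum.inl_injective h)]
  · rintro (⟨i', s⟩ | _)
    · by_cases h : i' = i
      · subst h
        exact ⟨Sum.inl (Sum.inr s), rfl⟩
      · obtain rfl : i' = !i := by cases i <;> cases i' <;> simp_all
        exact ⟨Sum.inr s, rfl⟩
    · exact ⟨Sum.inl (Sum.inl PUnit.unit), rfl⟩

/-- The cosets of S_i occur in both `bdCenter` and ∂G ∪ G_{i'} and are added on the right. Those of
S_{i'} occur in ∂G_{i'} and in `bdCenter`, are absorbed by G_{i'} and F_i, and are added on the
left. -/
lemma farSquare_isSetBicartesian {M : Type u} [AddCommGroup M] (i : Bool) :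
    IsSetBicartesian M (imagePair (X.incl !i) (X.bdGi !i)).proj (X.farSquare i).mapY
      (X.farSquare i).mapX (familyPair (X.homFar i)).proj := by
  change IsSetBicartesian M (cosetSetMap fun s => map_le_range' (X.incl !i) (X.bdGi (!i) s))
    (X.homImageInj !i).map (fun x => cosetAt (X.bdFar i) (Sum.inr PUnit.unit)
    (cosetMap (X.range_le_far i) x)) (X.homFar i).map
  let S₁ : X.I i → Subgroup X.Total := fun s => (X.S i s).map (X.incl i)
  have hB₁ : Function.Bijective (Sum.elim
      (Sum.inl : X.Total ⧸ X.center → (X.Total ⧸ X.center) ⊕ CosetSet S₁) Sum.inr) := by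
    rw [Sum.elim_inl_inr]
    exact Function.bijective_id
  have hC₁ : Function.Bijective (Sum.elim
      (cosetAt (X.bdFar i) (Sum.inr PUnit.unit) : X.Total ⧸ X.far i → _)
      (cosetEmb (X.bdFar i) Sum.inl : CosetSet S₁ → _)) :=
    sumElim_mk_cosetEmb_bijective (S := X.bdFar i) bijective_elim_inr_unit_inl
  have h := (X.isSetBicartesian_centerFar (M := M) i).add_right hB₁ hC₁
    (g := fun x => Sum.inl (cosetMap (X.total_le_center !i) x))
    (m := fun x => cosetAt (X.bdFar i) (Sum.inr PUnit.unit) (cosetMap (X.range_le_far i) x))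
    (l := Sum.elim (fun x => cosetAt (X.bdFar i) (Sum.inr PUnit.unit)
      (cosetMap (X.center_le_far i) x)) (cosetEmb (X.bdFar i) Sum.inl))
    (fun _ => rfl) (fun _ => rfl) (fun _ => rfl) (fun _ => rfl)
  have hE : Function.Bijective (Sum.elim
      (cosetAt (X.bdGiTotal !i) (Sum.inr PUnit.unit) : X.Total ⧸ X.total (!i) → _)
      (cosetEmb (X.bdGiTotal !i) Sum.inl)) :=
    sumElim_mk_cosetEmb_bijective bijective_elim_inr_unit_inl
  have hB : Function.Bijective (Sum.elim (Sum.elim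
      (cosetAt X.bdCenter (Sum.inr PUnit.unit) : X.Total ⧸ X.center → _)
      (cosetEmb X.bdCenter (fun s : X.I i => Sum.inl ⟨i, s⟩) : CosetSet S₁ → _))
      (cosetEmb X.bdCenter (fun s : X.I !i => Sum.inl ⟨!i, s⟩) :
        CosetSet (fun s => X.bdGiTotal (!i) (Sum.inl s)) → _)) :=
    sumElim_sumElim_cosetEmb_bijective (X.bijective_index i)
  refine h.add_left hE hB (fun e => ?_) (fun e => ?_) ?_ ?_ ?_ fun e => ?_
  · induction e using QuotientGroup.induction_on with
    | H e => rfl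
  · induction e using QuotientGroup.induction_on with
    | H e => exact X.homImageInj_inr (!i) e
  · rintro ⟨s, x⟩
    induction x using QuotientGroup.induction_on with
    | H x => exact X.homImageInj_inl (!i) s x
  · rintro (z | ⟨s, z⟩)
    all_goals induction z using QuotientGroup.induction_on with | H z => ?_
    · exact X.homFar_map_center i z
    · exact X.homFar_map_eq i s z
  · rintro ⟨s, x⟩
    induction x using QuotientGroup.induction_on with
    | H x => exact X.homFar_map_ne i s x
  · induction e using QuotientGroup.induction_on with
    | H e => rfl

/-- The inclusion of `(G_{i'}, ∂G_{i'})` in the pair of the families `∂G ∪ G_{i'}` and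
`bdCenter`. -/
def farHom (i : Bool) :
    ActionPair.Hom (X.incl !i) (groupPair (X.bdGi !i)) (familyPair (X.homFar i)) :=
  (X.farSquare i).comp (toImagePair (X.incl !i) (X.bdGi !i)) (MonoidHom.id_comp _)

/-! ### The inclusion of `(∂G_i, S_i ∪ W_i)` -/

/-- The inclusion of the family `S_i ∪ W_i` in `∂G`. -/
def homOpenTotal (i : Bool) : FamilyHom (X.incl i) (X.bdGiOpen i) X.bdG where
  idx := Sum.map (Sigma.mk i) (fun c => Quotient.mk _ ⟨i, c⟩)
  c := Sum.elim (fun _ => 1)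
    (fun c => X.wallGraph.toGroup (X.exists_path_baseVertex ⟨i, c⟩).choose)
  mem := by
    rintro (s | c) g hg
    · change (1 : X.Total)⁻¹ * _ * 1 ∈ _
      rw [inv_one, one_mul, mul_one]
      exact Subgroup.mem_map_of_mem (X.incl i) hg
    · exact (X.leafHom i).mem c _ (Subgroup.mem_map_of_mem (X.incl i) hg)

/-- The inclusion of `(∂G_i, S_i ∪ W_i)` in the pair of the families `bdCenter` and `∂G`. -/
def openHom (i : Bool) :
    ActionPair.Hom (X.incl i) (familyPair (X.homOpen i)) (familyPair X.homCenter) where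
  mapX := (X.homInj i).map
  mapY := (X.homOpenTotal i).map
  mapX_smul := FamilyHom.map_smul _
  mapY_smul := FamilyHom.map_smul _
  comm := by
    rintro ⟨s | c, x⟩
    all_goals induction x using QuotientGroup.induction_on with | H x => ?_
    · change X.homCenter.map ((X.homOpenTotal i).map _) = (X.homInj i).map ((X.homOpen i).map _)
      rw [(X.homOpenTotal i).map_mk_of_idx_eq (j := Sum.inl ⟨i, s⟩) rfl rfl,
        X.homCenter.map_mk_of_idx_eq (j := Sum.inl ⟨i, s⟩) rfl rfl,
        (X.homOpen i).map_mk_of_idx_eq (j := Sum.inl s) rfl rfl,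
        (X.homInj i).map_mk_of_idx_eq (j := Sum.inl ⟨i, s⟩) rfl rfl]
      rfl
    · change X.homCenter.map ((X.homOpenTotal i).map _) = (X.homInj i).map ((X.homOpen i).map _)
      rw [(X.homOpen i).map_mk_of_idx_eq (j := Sum.inr PUnit.unit) rfl rfl,
        (X.homInj i).map_mk_of_idx_eq (j := Sum.inr PUnit.unit) rfl rfl]
      refine (X.homCenter_inr (X.wallPoint ⟨i, c⟩ (X.incl i x))).trans ?_
      exact congrArg (cosetAt X.bdCenter (Sum.inr PUnit.unit))
        (QuotientGroup.mk_mul_of_mem (s := X.center) (X.incl i x)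
          (X.path_mem_center (X.exists_path_baseVertex ⟨i, c⟩).choose_spec))

lemma openHom_homWall_mapX (i : Bool) (x : (groupPair X.bdU).X) :
    (X.openHom i).mapX ((X.homWall i).mapX x) = X.centerHom.mapX x := by
  refine ((X.homInj i).map_mk_of_idx_eq (i := Sum.inr PUnit.unit) (j := Sum.inr PUnit.unit)
    rfl rfl 1).trans ?_
  rw [map_one]
  rfl

lemma openHom_homWall_mapY (i : Bool) (y : (groupPair X.bdU).Y) :
    (X.openHom i).mapY ((X.homWall i).mapY y) = X.centerHom.mapY y := by
  obtain ⟨j, x⟩ := y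
  induction x using QuotientGroup.induction_on with
  | H u =>
    have e := X.leafHom_edgeHom i
      ((imageHom X.inclU X.bdU).map ⟨j, ((u : X.U) : X.U ⧸ X.bdU j)⟩)
    refine Eq.trans ?_ (congrArg (cosetEmb X.bdG Sum.inr) e)
    change cosetEmb X.bdG Sum.inr (X.wallPoint ⟨i, _⟩ (X.incl i (X.emb i u * (X.D i).t j))) =
      cosetEmb X.bdG Sum.inr (X.wallPoint ⟨i, _⟩ ((X.inclU u * 1) * X.incl i ((X.D i).t j)))
    rw [map_mul, X.incl_emb, mul_one]
    rfl

/-- The two maps reach the base vertex along separately chosen paths; by `wallPoint_eq` the choice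
does not matter. -/
lemma centerHom_mapY (y : (groupPair X.bdU).Y) : X.centerHom.mapY y = X.homU.map y := by
  obtain ⟨j, x⟩ := y
  induction x using QuotientGroup.induction_on with
  | H u =>
    change cosetEmb X.bdG Sum.inr
      (X.wallPoint (X.wallGraph.src j) (X.inclU u * 1 * X.wallGraph.srcElt j)) = _
    rw [X.wallPoint_eq rfl (X.exists_path j).choose_spec, mul_one, mul_assoc]
    rfl

end GluingData

namespace GluingData

variable (X : GluingData.{u}) {k : Type u} [CommRing k] (A : Rep.{u} k X.Total)

/-! ### The maps of the exact sequence -/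

/-- `H_n(G, bdCenter; A)`. -/
abbrev HCenter (n : ℕ) : ModuleCat.{u} k := pairHomology (MonoidHom.id X.Total) X.bdCenter A n

/-- `H_n(bdCenter, ∂G; A)`. -/
abbrev HBd (n : ℕ) : ModuleCat.{u} k :=
  relHomology (MonoidHom.id X.Total) (familyPair X.homCenter) A n

/-- `H_n(U, ∂U; A) → H_n(bdCenter, ∂G; A)`, induced by inclusion. -/
def mapCenter (n : ℕ) : X.HU A n ⟶ X.HBd A n :=
  relHomologyMap X.inclU (MonoidHom.id X.Total) (MonoidHom.id_comp _) X.centerHom A n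

/-- `H_n(G_i, ∂G_i; A) → H_n(G, bdCenter; A)`, induced by inclusion. -/
def mapInj (i : Bool) (n : ℕ) : X.HGi A i n ⟶ X.HCenter A n :=
  relHomologyMap (X.incl i) (MonoidHom.id X.Total) (MonoidHom.id_comp _) (X.homInj i).toPairHom A n

/-- `H_n(G, bdCenter; A) → H_n(G, ∂G ∪ G_{i'}; A)`, induced by inclusion. -/
def mapFar (i : Bool) (n : ℕ) : X.HCenter A n ⟶ X.HFar A i n :=
  relHomologyMap (MonoidHom.id X.Total) (MonoidHom.id X.Total) rfl (X.homFar i).toPairHom A n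

/-- `H_n(G, ∂G; A) → H_n(G, bdCenter; A)`, induced by inclusion. -/
def mapToCenter (n : ℕ) : X.HG A n ⟶ X.HCenter A n :=
  relHomologyMap (MonoidHom.id X.Total) (MonoidHom.id X.Total) rfl X.homCenter.toPairHom A n

/-- `H_n(bdCenter, ∂G; A) → H_n(G, ∂G; A)`, induced by inclusion. -/
def mapFromBd (n : ℕ) : X.HBd A n ⟶ X.HG A n :=
  relHomologyMap (MonoidHom.id X.Total) (MonoidHom.id X.Total) rfl (familyPairTop X.homCenter) A n

/-- The boundary map `H_{n+1}(G, bdCenter; A) → H_n(bdCenter, ∂G; A)`. -/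
def centerBoundary (n : ℕ) : X.HCenter A (n + 1) ⟶ X.HBd A n :=
  familyBoundary (MonoidHom.id X.Total) X.homCenter A n

/-- `H_n(∂G_i, S_i ∪ W_i; A) → H_n(bdCenter, ∂G; A)`, induced by inclusion. -/
def mapOpen (i : Bool) (n : ℕ) : X.HWall A i n ⟶ X.HBd A n :=
  relHomologyMap (X.incl i) (MonoidHom.id X.Total) (MonoidHom.id_comp _) (X.openHom i) A n

/-! ### Excision isomorphisms and their compatibility -/

lemma id_injective : Function.Injective (MonoidHom.id X.Total) := Function.injective_id

/-- Excision is Shapiro's lemma along G_i → G followed by a bicartesian square of G-sets. The other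
excision maps below are treated in the same way. -/
theorem mapExc_bijective (i : Bool) (n : ℕ) : Function.Bijective (X.mapExc A i n) :=
  relHomologyMap_bijective_of_comp (MonoidHom.id_comp _) rfl (MonoidHom.id_comp _)
    (MonoidHom.id_comp _) (toImagePair (X.incl i) (X.bdGi i)) (X.excSquare i) (X.homExc i).toPairHom
    (fun _ => rfl) (X.homImageExc_imageHom i) A n
    (toImagePair_bijective _ (X.incl_injective i) X.id_injective _ A n)
    (relHomologyMap_bijective_of_isSetBicartesian _ _ A (X.excSquare_isSetBicartesian i) n)

lemma mapCenter_bijective (n : ℕ) : Function.Bijective (X.mapCenter A n) :=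
  relHomologyMap_bijective_of_comp (MonoidHom.id_comp _) rfl (MonoidHom.id_comp _)
    (MonoidHom.id_comp _) (toImagePair X.inclU X.bdU) X.centerSquare X.centerHom
    (fun _ => rfl) (fun _ => rfl) A n
    (toImagePair_bijective _ X.inclU_injective X.id_injective _ A n)
    (relHomologyMap_bijective_of_isSetBicartesian _ _ A X.centerSquare_isSetBicartesian n)

/-- The composite of `homWall` with the passage to induced pairs. -/
def wallImageHom (i : Bool) : ActionPair.Hom X.inclU (groupPair X.bdU)
    (familyPair ((X.homOpen i).image (X.incl i))) :=
  (X.wallSquare i).comp (toImagePair X.inclU X.bdU) (MonoidHom.id_comp _)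

lemma toImage_homWall_mapX (i : Bool) (x : (groupPair X.bdU).X) :
    ((X.homOpen i).toImage (X.incl i)).mapX ((X.homWall i).mapX x) = (X.wallImageHom i).mapX x := by
  refine (imageHom_map (X.incl i) (X.bdGi i) (Sum.inr PUnit.unit) 1).trans ?_
  rw [map_one]
  rfl

lemma toImage_homWall_mapY (i : Bool) (y : (groupPair X.bdU).Y) :
    ((X.homOpen i).toImage (X.incl i)).mapY ((X.homWall i).mapY y) = (X.wallImageHom i).mapY y := by
  obtain ⟨j, x⟩ := y
  induction x using QuotientGroup.induction_on with
  | H u =>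
    refine (imageHom_map (X.incl i) (X.bdGiOpen i) (Sum.inr ((X.D i).κ j))
      (X.emb i u * (X.D i).t j)).trans ?_
    change _ = (⟨Sum.inr ((X.D i).κ j), ((X.inclU u * 1 * X.incl i ((X.D i).t j) : X.Total) :
      X.Total ⧸ (X.bdGiOpen i (Sum.inr ((X.D i).κ j))).map (X.incl i))⟩ :
      CosetSet (fun s => (X.bdGiOpen i s).map (X.incl i)))
    rw [map_mul, X.incl_emb, mul_one]

/-- The target is a pair of G_i-sets, while the squares live over G. So the target is also induced
up to G, and the map is compared with the excision there. -/
theorem mapWall_bijective (i : Bool) (n : ℕ) : Function.Bijective (X.mapWall A i n) := by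
  have h₁ : Function.Bijective (relHomologyMap X.inclU (MonoidHom.id X.Total)
      (MonoidHom.id_comp _) (X.wallImageHom i) A n) :=
    relHomologyMap_bijective_of_comp (MonoidHom.id_comp _) rfl (MonoidHom.id_comp _)
      (MonoidHom.id_comp _) (toImagePair X.inclU X.bdU) (X.wallSquare i) (X.wallImageHom i)
      (fun _ => rfl) (fun _ => rfl) A n
      (toImagePair_bijective _ X.inclU_injective X.id_injective _ A n)
      (relHomologyMap_bijective_of_isSetBicartesian _ _ A (X.wallSquare_isSetBicartesian i) n)
  have h₂ : Function.Bijective (relHomologyMap (X.incl i) (MonoidHom.id X.Total)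
      (MonoidHom.id_comp _) ((X.homOpen i).toImage (X.incl i)) A n) :=
    toImage_bijective _ (X.incl_injective i) X.id_injective _ A n
  refine (Function.Bijective.of_comp_iff' h₂ _).1 ?_
  have e : relHomologyMap (X.incl i) (MonoidHom.id X.Total)
      (MonoidHom.id_comp _) ((X.homOpen i).toImage (X.incl i)) A n ∘ X.mapWall A i n =
      relHomologyMap X.inclU (MonoidHom.id X.Total) (MonoidHom.id_comp _) (X.wallImageHom i) A n :=
    funext fun x => relHomologyMap_comp_apply _ _ _ (MonoidHom.ext (X.incl_emb i)) _ _ _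
      (X.toImage_homWall_mapX i) (X.toImage_homWall_mapY i) A n x
  rwa [e]

lemma mapFar_mapInj (i : Bool) (n : ℕ) (x : X.HGi A i n) :
    X.mapFar A i n (X.mapInj A i n x) = X.mapExc A i n x :=
  relHomologyMap_comp_apply _ _ _ (MonoidHom.id_comp _) (X.homInj i).toPairHom
    (X.homFar i).toPairHom (X.homExc i).toPairHom (fun _ => rfl) (X.homFar_homInj i) A n x

lemma mapFar_mapToCenter (i : Bool) (n : ℕ) (x : X.HG A n) :
    X.mapFar A i n (X.mapToCenter A n x) = X.mapCollapse A i n x :=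
  relHomologyMap_comp_apply _ _ _ (MonoidHom.id_comp _) X.homCenter.toPairHom
    (X.homFar i).toPairHom (X.homCollapse i).toPairHom (fun _ => rfl) (X.homFar_homCenter i) A n x

lemma mapFromBd_mapCenter (n : ℕ) (x : X.HU A n) :
    X.mapFromBd A n (X.mapCenter A n x) = X.mapU A n x :=
  relHomologyMap_comp_apply _ _ _ (MonoidHom.id_comp _) X.centerHom
    (familyPairTop X.homCenter) X.homU.toPairHom (fun _ => rfl) X.centerHom_mapY A n x

lemma mapOpen_mapWall (i : Bool) (n : ℕ) (x : X.HU A n) :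
    X.mapOpen A i n (X.mapWall A i n x) = X.mapCenter A n x :=
  relHomologyMap_comp_apply _ _ _ (MonoidHom.ext (X.incl_emb i)) (X.homWall i)
    (X.openHom i) X.centerHom (X.openHom_homWall_mapX i) (X.openHom_homWall_mapY i) A n x

/-- Naturality of the boundary map for the map of triples from (G_i, ∂G_i, S_i ∪ W_i) to (G,
`bdCenter`, ∂G). It identifies the γ_i with parts of the connecting map. -/
lemma mapOpen_boundary (i : Bool) (n : ℕ) (x : X.HGi A i (n + 1)) :
    X.mapOpen A i n (X.boundary A i n x) = X.centerBoundary A n (X.mapInj A i (n + 1) x) :=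
  familyBoundary_naturality (X.incl i) (X.homOpen i) A (MonoidHom.id_comp _) X.homCenter
    (X.openHom i) (X.homInj i).toPairHom rfl n x

/-- The map `H_n(G_{i'}, ∂G_{i'}; A) → H_n(∂G ∪ G_{i'}, bdCenter; A)` is an isomorphism. -/
lemma farHom_bijective (i : Bool) (n : ℕ) : Function.Bijective (relHomologyMap (X.incl !i)
    (MonoidHom.id X.Total) (MonoidHom.id_comp _) (X.farHom i) A n) :=
  relHomologyMap_bijective_of_comp (MonoidHom.id_comp _) rfl (MonoidHom.id_comp _)
    (MonoidHom.id_comp _) (toImagePair (X.incl !i) (X.bdGi !i)) (X.farSquare i) (X.farHom i)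
    (fun _ => rfl) (fun _ => rfl) A n
    (toImagePair_bijective _ (X.incl_injective !i) X.id_injective _ A n)
    (relHomologyMap_bijective_of_isSetBicartesian _ _ A (X.farSquare_isSetBicartesian i) n)

/-- This is the exact sequence of the triple (G, ∂G ∪ G_{i'}, `bdCenter`), with its first term
replaced by H_n(G_{i'}, ∂G_{i'}). -/
lemma mapInj_mapFar_exact (i : Bool) (n : ℕ) :
    Function.Exact (X.mapInj A (!i) n) (X.mapFar A i n) := by
  have h := familyTriple_exact_middle (MonoidHom.id X.Total) (X.homFar i) A n
  have e (x : X.HGi A (!i) n) : relHomologyMap (MonoidHom.id X.Total) (MonoidHom.id X.Total) rfl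
      (familyPairTop (X.homFar i)) A n (relHomologyMap (X.incl !i) (MonoidHom.id X.Total)
        (MonoidHom.id_comp _) (X.farHom i) A n x) = X.mapInj A (!i) n x :=
    relHomologyMap_comp_apply _ _ _ (MonoidHom.id_comp _) (X.farHom i)
      (familyPairTop (X.homFar i)) (X.homInj !i).toPairHom (fun _ => rfl)
      (X.homImageInj_imageHom !i) A n x
  intro c
  refine (h c).trans ⟨?_, ?_⟩
  · rintro ⟨y, rfl⟩
    obtain ⟨x, rfl⟩ := (X.farHom_bijective A i n).2 y
    exact ⟨x, (e x).symm⟩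
  · rintro ⟨x, rfl⟩
    exact ⟨_, e x⟩

/-- The decomposition of `H_n(G, bdCenter)` as `H_n(G_1, ∂G_1) ⊕ H_n(G_2, ∂G_2)`. -/
lemma mapInj_add_eq_iff (n : ℕ) (c : X.HCenter A n) (a : X.HGi A false n) (b : X.HGi A true n) :
    X.mapInj A false n a + X.mapInj A true n b = c ↔
      X.mapExc A false n a = X.mapFar A false n c ∧ X.mapExc A true n b = X.mapFar A true n c := by
  have h₁ (b) : X.mapFar A false n (X.mapInj A true n b) = 0 :=
    (X.mapInj_mapFar_exact A false n _).2 ⟨b, rfl⟩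
  have h₂ (a) : X.mapFar A true n (X.mapInj A false n a) = 0 :=
    (X.mapInj_mapFar_exact A true n _).2 ⟨a, rfl⟩
  constructor
  · rintro rfl
    rw [map_add, map_add, h₁, h₂, mapFar_mapInj, mapFar_mapInj, add_zero, zero_add]
    exact ⟨rfl, rfl⟩
  · rintro ⟨ha, hb⟩
    -- The difference is killed in the first direction, so it comes from some y in H_n(G_2, ∂G_2).
    -- It is also killed in the second direction, where y is detected by an isomorphism.
    have h : X.mapFar A false n (c - (X.mapInj A false n a + X.mapInj A true n b)) = 0 := by
      rw [map_sub, map_add, h₁, mapFar_mapInj, ha, add_zero, sub_self]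
    obtain ⟨y, hy⟩ := (X.mapInj_mapFar_exact A false n _).1 h
    change X.mapInj A true n y = _ at hy
    have h' := congrArg (X.mapFar A true n) hy
    rw [mapFar_mapInj, map_sub, map_add, h₂, mapFar_mapInj, hb, zero_add, sub_self] at h'
    have : y = 0 := (X.mapExc_bijective A true n).1 (h'.trans (map_zero _).symm)
    rw [this, map_zero] at hy
    exact (sub_eq_zero.1 hy.symm).symm

end GluingData

/-! ### The exact sequence of a gluing -/

theorem theorem2 {k : Type u} [CommRing k] (X : GluingData.{u}) (A : Rep.{u} k X.Total) :
    (∀ i n, Function.Bijective (X.mapExc A i n)) ∧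
    (∀ i n, Function.Bijective (X.mapWall A i n)) ∧
    ∃ (β : ∀ (i : Bool) (n : ℕ), X.HG A n →ₗ[k] X.HGi A i n)
      (γ : ∀ (i : Bool) (n : ℕ), X.HGi A i (n + 1) →ₗ[k] X.HU A n),
      (∀ i n x, X.mapExc A i n (β i n x) = X.mapCollapse A i n x) ∧
      (∀ i n y, X.mapWall A i n (γ i n y) = X.boundary A i n y) ∧
      (∀ n, Function.Exact ((γ false n).coprod (γ true n)) (X.mapU A n)) ∧
      (∀ n, Function.Exact (X.mapU A n) ((β false n).prod (β true n))) ∧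
      (∀ n, Function.Exact ((β false (n + 1)).prod (β true (n + 1)))
        ((γ false n).coprod (γ true n))) ∧
      Function.Surjective ((β false 0).prod (β true 0)) := by
  let exc (i n) : X.HGi A i n ≃ₗ[k] X.HFar A i n :=
    LinearEquiv.ofBijective (X.mapExc A i n).hom (X.mapExc_bijective A i n)
  let wall (i n) : X.HU A n ≃ₗ[k] X.HWall A i n :=
    LinearEquiv.ofBijective (X.mapWall A i n).hom (X.mapWall_bijective A i n)
  let β (i n) : X.HG A n →ₗ[k] X.HGi A i n :=
    (exc i n).symm.toLinearMap ∘ₗ (X.mapCollapse A i n).hom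
  let γ (i n) : X.HGi A i (n + 1) →ₗ[k] X.HU A n :=
    (wall i n).symm.toLinearMap ∘ₗ (X.boundary A i n).hom
  have hβ (i n x) : X.mapExc A i n (β i n x) = X.mapCollapse A i n x :=
    (exc i n).apply_symm_apply _
  have hγ (i n y) : X.mapWall A i n (γ i n y) = X.boundary A i n y :=
    (wall i n).apply_symm_apply _
  -- The maps β_1, β_2 are the coordinates of H_n(G, ∂G) → H_n(G, `bdCenter`) in the decomposition
  -- of the target.
  have hjβ (n) (x : X.HG A n) (a b) : X.mapInj A false n a + X.mapInj A true n b =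
      X.mapToCenter A n x ↔ (β false n).prod (β true n) x = (a, b) := by
    rw [X.mapInj_add_eq_iff, X.mapFar_mapToCenter, X.mapFar_mapToCenter, ← hβ, ← hβ,
      (X.mapExc_bijective A false n).1.eq_iff, (X.mapExc_bijective A true n).1.eq_iff]
    exact ⟨fun h => Prod.ext h.1.symm h.2.symm,
      fun h => ⟨(congrArg Prod.fst h).symm, (congrArg Prod.snd h).symm⟩⟩
  have hdec (n) (c : X.HCenter A n) : ∃ a b, X.mapInj A false n a + X.mapInj A true n b = c := by
    obtain ⟨a, ha⟩ := (X.mapExc_bijective A false n).2 (X.mapFar A false n c)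
    obtain ⟨b, hb⟩ := (X.mapExc_bijective A true n).2 (X.mapFar A true n c)
    exact ⟨a, b, (X.mapInj_add_eq_iff A n c a b).2 ⟨ha, hb⟩⟩
  -- In the same coordinates γ_1 + γ_2 is the connecting map of the triple (G, `bdCenter`, ∂G), with
  -- its target identified with H_n(U, ∂U).
  have heγ (n a b) : X.mapCenter A n ((γ false n).coprod (γ true n) (a, b)) =
      X.centerBoundary A n (X.mapInj A false (n + 1) a + X.mapInj A true (n + 1) b) := by
    rw [LinearMap.coprod_apply, map_add, map_add, ← X.mapOpen_mapWall A false,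
      ← X.mapOpen_mapWall A true, hγ, hγ, X.mapOpen_boundary, X.mapOpen_boundary]
  have ex₁ (n) : Function.Exact (X.mapFromBd A n) (X.mapToCenter A n) :=
    familyTriple_exact_middle (MonoidHom.id X.Total) X.homCenter A n
  have ex₂ (n) : Function.Exact (X.mapToCenter A (n + 1)) (X.centerBoundary A n) :=
    familyTriple_exact_right (MonoidHom.id X.Total) X.homCenter A n
  have ex₃ (n) : Function.Exact (X.centerBoundary A n) (X.mapFromBd A n) :=
    familyTriple_exact_left (MonoidHom.id X.Total) X.homCenter A n
  refine ⟨X.mapExc_bijective A, X.mapWall_bijective A, β, γ, hβ, hγ, fun n x => ?_, fun n x => ?_,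
    fun n x => ?_, fun x => ?_⟩
  · rw [← X.mapFromBd_mapCenter, ex₃ n]
    constructor
    · rintro ⟨c, hc⟩
      obtain ⟨a, b, rfl⟩ := hdec _ c
      exact ⟨(a, b), (X.mapCenter_bijective A n).1 ((heγ n a b).trans hc)⟩
    · rintro ⟨⟨a, b⟩, rfl⟩
      exact ⟨_, (heγ n a b).symm⟩
  · have h0 : (β false n).prod (β true n) x = 0 ↔ X.mapToCenter A n x = 0 := by
      refine (hjβ n x 0 0).symm.trans ?_
      rw [map_zero, map_zero, add_zero, eq_comm]
    rw [h0, ex₁ n]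
    constructor
    · rintro ⟨p, rfl⟩
      obtain ⟨u, rfl⟩ := (X.mapCenter_bijective A n).2 p
      exact ⟨u, (X.mapFromBd_mapCenter A n u).symm⟩
    · rintro ⟨u, rfl⟩
      exact ⟨_, X.mapFromBd_mapCenter A n u⟩
  · obtain ⟨a, b⟩ := x
    -- Vanishing of γ_1 + γ_2 is tested after the injective map to H_n(`bdCenter`, ∂G), where it
    -- becomes vanishing of the connecting map.
    rw [← (X.mapCenter_bijective A n).1.eq_iff, heγ, map_zero, ex₂ n]
    exact exists_congr fun g => eq_comm.trans (hjβ (n + 1) g a b)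
  · obtain ⟨a, b⟩ := x
    -- At the end of the sequence, H_0(G, ∂G) maps onto H_0(G, `bdCenter`), because both are
    -- quotients of the chains of degree zero of G.
    obtain ⟨g, hg⟩ := familyTriple_surjective_zero (MonoidHom.id X.Total) X.homCenter A
      (X.mapInj A false 0 a + X.mapInj A true 0 b)
    exact ⟨g, (hjβ 0 g a b).1 hg.symm⟩

end
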